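/- Let $\mathbb{G}$ be a locally compact quantum group (in the sense of Kustermans and Vaes), with $C^*$-algebra $C_0(\mathbb{G})$ acting nondegenerately and faithfully on a Hilbert space and comultiplication $\Delta : C_0(\mathbb{G}) \to M(C_0(\mathbb{G})\otimes C_0(\mathbb{G}))$, where $\otimes$ is the spatial tensor product and $M(\cdot)$ the multiplier algebra. Assume that $\mathbb{G}$ is coamenable, i.e. there is a bounded linear functional $\epsilon$ on $C_0(\mathbb{G})$ with $(\epsilon\otimes\mathrm{id})\Delta=(\mathrm{id}\otimes\epsilon)\Delta=\mathrm{id}$. Let $M(\mathbb{G})=C_0(\mathbb{G})^*$, with the convolution product $\omega\star\mu=(\omega\otimes\mu)\circ\Delta$ (functionals being extended strictly to multiplier algebras). For $\omega\in M(\mathbb{G})$ and $x\in C_0(\mathbb{G})^{**}$ write $(\omega.x)(y)=\omega(xy)$ and $(x.\omega)(y)=\omega(yx)$. Let $\omega=u.|\omega|_r$ be the polar decomposition of $\omega$, where $|\omega|_r$ (the right absolute value) is a positive functional and $u\in C_0(\mathbb{G})^{**}$ is a partial isometry such that $u^*u$ is the support projection of $|\omega|_r$, and let $|\omega|_l=u.|\omega|_r.u^*$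 be the left absolute value of $\omega$. For a state $\sigma\in M(\mathbb{G})$ put $N_{\sigma\otimes\sigma}=\{X\in M(C_0(\mathbb{G})\otimes C_0(\mathbb{G})) : (\sigma\otimes\sigma)(X^*X)=0\}$. Let $\omega\in M(\mathbb{G})$ be a contractive idempotent, that is, $\omega\neq 0$, $\omega\star\omega=\omega$ and $\|\omega\|\le 1$. Then $|\omega|_r$ and $|\omega|_l$ are idempotent states, and there exists $v\in C_0(\mathbb{G})$ such that $\omega=|\omega|_l.v=v.|\omega|_r$ and $$\Delta(v)-v\otimes v\in N_{|\omega|_r\otimes|\omega|_r}\cap\bigl(N_{|\omega|_l\otimes|\omega|_l}\bigr)^*,$$ where $N^*=\{X^* : X\in N\}$. -/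

import Mathlib

open scoped TensorProduct ComplexOrder ENNReal Pointwise Topology

noncomputable section

/-! ## Hilbert space tensor products of Hilbert spaces and of operators -/

/-- The Hilbert space tensor product: the completion of the algebraic tensor product. -/
def HilbertTensor (H K : Type*) [NormedAddCommGroup H] [InnerProductSpace ℂ H]
    [NormedAddCommGroup K] [InnerProductSpace ℂ K] : Type _ :=
  UniformSpace.Completion (H ⊗[ℂ] K)

section HilbertTensor

variable {H K L : Type*} [NormedAddCommGroup H] [InnerProductSpace ℂ H]
  [NormedAddCommGroup K] [InnerProductSpace ℂ K]
  [NormedAddCommGroup L] [InnerProductSpace ℂ L]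

instance : NormedAddCommGroup (HilbertTensor H K) :=
  inferInstanceAs (NormedAddCommGroup (UniformSpace.Completion (H ⊗[ℂ] K)))

instance : InnerProductSpace ℂ (HilbertTensor H K) :=
  inferInstanceAs (InnerProductSpace ℂ (UniformSpace.Completion (H ⊗[ℂ] K)))

instance : CompleteSpace (HilbertTensor H K) :=
  inferInstanceAs (CompleteSpace (UniformSpace.Completion (H ⊗[ℂ] K)))

variable (H K) in
/-- The isometric embedding of the algebraic tensor product into its completion. -/
def tensorEmb : H ⊗[ℂ] K →ₗᵢ[ℂ] HilbertTensor H K :=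
  (UniformSpace.Completion.toComplₗᵢ :
    H ⊗[ℂ] K →ₗᵢ[ℂ] UniformSpace.Completion (H ⊗[ℂ] K))

theorem denseRange_tensorEmb : DenseRange (tensorEmb H K) :=
  UniformSpace.Completion.denseRange_coe (α := H ⊗[ℂ] K)

/-- The elementary tensor `ξ ⊗ η` in the Hilbert space tensor product. -/
def vecTensor (ξ : H) (η : K) : HilbertTensor H K := tensorEmb H K (ξ ⊗ₜ[ℂ] η)

/-- The bounded operator `a ⊗ b` with `(a ⊗ b) (ξ ⊗ η) = a ξ ⊗ b η`. -/
def opTensor (a : H →L[ℂ] H) (b : K →L[ℂ] K) : HilbertTensor H K →L[ℂ] HilbertTensor H K :=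
  ((tensorEmb H K).toContinuousLinearMap ∘L TensorProduct.mapL a b).extend
    (tensorEmb H K).toContinuousLinearMap

theorem opTensor_vecTensor (a : H →L[ℂ] H) (b : K →L[ℂ] K) (ξ : H) (η : K) :
    opTensor a b (vecTensor ξ η) = vecTensor (a ξ) (b η) :=
  ContinuousLinearMap.extend_eq _ (e := (tensorEmb H K).toContinuousLinearMap)
    denseRange_tensorEmb (tensorEmb H K).isometry.isUniformInducing (ξ ⊗ₜ η)

variable (H K L) in
/-- The isometric embedding of the algebraic tensor product `(H ⊗ K) ⊗ L` into the Hilbert space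
tensor product. -/
def tripleEmb : (H ⊗[ℂ] K) ⊗[ℂ] L →ₗᵢ[ℂ] HilbertTensor (HilbertTensor H K) L :=
  (tensorEmb (HilbertTensor H K) L).comp (LinearIsometry.rTensor L (tensorEmb H K))

theorem denseRange_tripleEmb : DenseRange (tripleEmb H K L) := by
  have h : DenseRange (LinearIsometry.rTensor L (tensorEmb H K)) := by
    intro y
    induction y with
    | zero => exact subset_closure ⟨0, by simp⟩
    | add x y hx hy =>
      exact (LinearMap.range
        (LinearIsometry.rTensor L (tensorEmb H K)).toLinearMap).topologicalClosure.add_mem hx hy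
    | tmul x ζ =>
      have hc : Continuous fun x : HilbertTensor H K => x ⊗ₜ[ℂ] ζ :=
        (TensorProduct.continuous_tmul (𝕜 := ℂ)).comp
          (continuous_id.prodMk continuous_const)
      refine denseRange_tensorEmb.induction_on (p := fun x => x ⊗ₜ[ℂ] ζ ∈ closure _) x
        (isClosed_closure.preimage hc) ?_
      intro t
      exact subset_closure ⟨t ⊗ₜ ζ, by simp⟩
  exact denseRange_tensorEmb.comp h (tensorEmb (HilbertTensor H K) L).continuous

/-- The isometry `(H ⊗ K) ⊗ L → H ⊗ (K ⊗ L)` of the algebraic tensor product into the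
Hilbert space tensor product. -/
def assocEmb : (H ⊗[ℂ] K) ⊗[ℂ] L →ₗᵢ[ℂ] HilbertTensor H (HilbertTensor K L) :=
  (tensorEmb H (HilbertTensor K L)).comp
    ((LinearIsometry.lTensor H (tensorEmb K L)).comp
      (TensorProduct.assocIsometry ℂ H K L).toLinearIsometry)

/-- The canonical unitary `(H ⊗ K) ⊗ L → H ⊗ (K ⊗ L)`, as a bounded operator. -/
def hilbertAssoc :
    HilbertTensor (HilbertTensor H K) L →L[ℂ] HilbertTensor H (HilbertTensor K L) :=
  (assocEmb (H := H) (K := K) (L := L)).toContinuousLinearMap.extend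
    (tripleEmb H K L).toContinuousLinearMap

theorem hilbertAssoc_vecTensor (ξ : H) (η : K) (ζ : L) :
    hilbertAssoc (vecTensor (vecTensor ξ η) ζ) = vecTensor ξ (vecTensor η ζ) :=
  ContinuousLinearMap.extend_eq _ (e := (tripleEmb H K L).toContinuousLinearMap)
    denseRange_tripleEmb (tripleEmb H K L).isometry.isUniformInducing ((ξ ⊗ₜ η) ⊗ₜ ζ)

end HilbertTensor

/-! ## Spatial tensor products, multiplier algebras and the strict topology -/

section CStar

variable {H K : Type*} [NormedAddCommGroup H] [InnerProductSpace ℂ H] [CompleteSpace H]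
  [NormedAddCommGroup K] [InnerProductSpace ℂ K] [CompleteSpace K]

/-- The spatial tensor product `A ⊗ B` of C*-algebras `A ⊆ B(H)` and `B ⊆ B(K)`: the closed
*-subalgebra of `B(H ⊗ K)` generated by the elementary tensors `a ⊗ b`. -/
def spatialTensor (A : NonUnitalStarSubalgebra ℂ (H →L[ℂ] H))
    (B : NonUnitalStarSubalgebra ℂ (K →L[ℂ] K)) :
    NonUnitalStarSubalgebra ℂ (HilbertTensor H K →L[ℂ] HilbertTensor H K) :=
  (NonUnitalStarAlgebra.adjoin ℂ
    {x | ∃ a ∈ A, ∃ b ∈ B, x = opTensor a b}).topologicalClosure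

/-- `A ⊆ B(H)` is nondegenerate: the vectors `a ξ` span a dense subspace of `H`. -/
def IsNondegenerate (A : NonUnitalStarSubalgebra ℂ (H →L[ℂ] H)) : Prop :=
  (Submodule.span ℂ {η : H | ∃ a ∈ A, ∃ ξ : H, η = a ξ}).topologicalClosure = ⊤

/-- The multiplier algebra of a nondegenerate C*-algebra `A ⊆ B(H)`, realised as its
idealiser in `B(H)`. -/
def multiplierAlgebra (A : NonUnitalStarSubalgebra ℂ (H →L[ℂ] H)) :
    StarSubalgebra ℂ (H →L[ℂ] H) where
  carrier := {x | ∀ a ∈ A, x * a ∈ A ∧ a * x ∈ A}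
  mul_mem' {x y} hx hy a ha := by
    refine ⟨?_, ?_⟩
    · rw [mul_assoc]; exact (hx _ (hy a ha).1).1
    · rw [← mul_assoc]; exact (hy _ (hx a ha).2).2
  add_mem' {x y} hx hy a ha := by
    refine ⟨?_, ?_⟩
    · rw [add_mul]; exact add_mem (hx a ha).1 (hy a ha).1
    · rw [mul_add]; exact add_mem (hx a ha).2 (hy a ha).2
  algebraMap_mem' r a ha := by
    refine ⟨?_, ?_⟩
    · rw [← Algebra.smul_def]; exact SMulMemClass.smul_mem r ha
    · rw [← Algebra.commutes, ← Algebra.smul_def]; exact SMulMemClass.smul_mem r ha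
  star_mem' {x} hx a ha := by
    refine ⟨?_, ?_⟩
    · have := star_mem (hx _ (star_mem ha)).2
      simpa using this
    · have := star_mem (hx _ (star_mem ha)).1
      simpa using this

theorem le_multiplierAlgebra {A : NonUnitalStarSubalgebra ℂ (H →L[ℂ] H)} {x : H →L[ℂ] H}
    (hx : x ∈ A) : x ∈ multiplierAlgebra A :=
  fun _ ha => ⟨mul_mem hx ha, mul_mem ha hx⟩

instance (A : NonUnitalStarSubalgebra ℂ (H →L[ℂ] H)) : NormedStarGroup A :=
  ⟨fun a => (norm_star (a : H →L[ℂ] H)).le⟩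

/-- The inclusion `A ⊆ M(A)`. -/
def toMultiplier {A : NonUnitalStarSubalgebra ℂ (H →L[ℂ] H)} (a : A) : multiplierAlgebra A :=
  ⟨a, le_multiplierAlgebra a.2⟩

/-- The elementary tensor `a ⊗ b` as an element of `M(A ⊗ B)`. -/
def elemTensor {A : NonUnitalStarSubalgebra ℂ (H →L[ℂ] H)}
    {B : NonUnitalStarSubalgebra ℂ (K →L[ℂ] K)} (a : A) (b : B) :
    multiplierAlgebra (spatialTensor A B) :=
  ⟨opTensor a b, le_multiplierAlgebra (NonUnitalStarSubalgebra.le_topologicalClosure _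
    (NonUnitalStarAlgebra.subset_adjoin ℂ _ ⟨a, a.2, b, b.2, rfl⟩))⟩

/-- The strict topology on `M(A)`: the weakest topology for which `x ↦ x a` and `x ↦ a x` are
norm continuous for every `a ∈ A`. -/
abbrev strictTopology (A : NonUnitalStarSubalgebra ℂ (H →L[ℂ] H)) :
    TopologicalSpace (multiplierAlgebra A) :=
  ⨅ a : A,
    TopologicalSpace.induced
      (fun x : multiplierAlgebra A => (x : H →L[ℂ] H) * (a : H →L[ℂ] H)) inferInstance ⊓
    TopologicalSpace.induced
      (fun x : multiplierAlgebra A => (a : H →L[ℂ] H) * (x : H →L[ℂ] H)) inferInstance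

variable {A : NonUnitalStarSubalgebra ℂ (H →L[ℂ] H)}

/-- `F` is the strict extension to `M(A ⊗ A)` of the functional `ω ⊗ μ` on `A ⊗ A`, that is, the
strictly continuous linear functional with `F (a ⊗ b) = ω a * μ b`. There is exactly one. -/
def IsTensorFunctional (ω μ : StrongDual ℂ A)
    (F : multiplierAlgebra (spatialTensor A A) →ₗ[ℂ] ℂ) : Prop :=
  Continuous[strictTopology (spatialTensor A A), inferInstance] F ∧
    ∀ a b : A, F (elemTensor a b) = ω a * μ b

open Classical in
/-- The functional `ω ⊗ μ` on `M(A ⊗ A)`. -/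
def tensorFunctional (ω μ : StrongDual ℂ A) : multiplierAlgebra (spatialTensor A A) →ₗ[ℂ] ℂ :=
  if h : ∃ F, IsTensorFunctional ω μ F then h.choose else 0

/-- `S : M(A ⊗ A) → M(A)` is the strict extension of the slice map `ω ⊗ id`. There is exactly
one. -/
def IsLeftSlice (ω : StrongDual ℂ A)
    (S : multiplierAlgebra (spatialTensor A A) →ₗ[ℂ] multiplierAlgebra A) : Prop :=
  Continuous[strictTopology (spatialTensor A A), strictTopology A] S ∧
    ∀ a b : A, S (elemTensor a b) = ω a • toMultiplier b

/-- `S : M(A ⊗ A) → M(A)` is the strict extension of the slice map `id ⊗ ω`. There is exactly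
one. -/
def IsRightSlice (ω : StrongDual ℂ A)
    (S : multiplierAlgebra (spatialTensor A A) →ₗ[ℂ] multiplierAlgebra A) : Prop :=
  Continuous[strictTopology (spatialTensor A A), strictTopology A] S ∧
    ∀ a b : A, S (elemTensor a b) = ω b • toMultiplier a

open Classical in
/-- The slice map `ω ⊗ id : M(A ⊗ A) → M(A)`. -/
def leftSlice (ω : StrongDual ℂ A) :
    multiplierAlgebra (spatialTensor A A) →ₗ[ℂ] multiplierAlgebra A :=
  if h : ∃ S, IsLeftSlice ω S then h.choose else 0

open Classical in
/-- The slice map `id ⊗ ω : M(A ⊗ A) → M(A)`. -/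
def rightSlice (ω : StrongDual ℂ A) :
    multiplierAlgebra (spatialTensor A A) →ₗ[ℂ] multiplierAlgebra A :=
  if h : ∃ S, IsRightSlice ω S then h.choose else 0

end CStar

/-! ## Functionals, the bidual and polar decomposition -/

section Dual

variable {A : Type*} [NonUnitalNormedRing A] [NormedSpace ℂ A]
  [IsScalarTower ℂ A A] [SMulCommClass ℂ A A]

/-- The functional `a.φ`, `(a.φ) b = φ (b a)`, as a bounded bilinear map in `φ` and `a`. -/
def leftTranslate : StrongDual ℂ A →L[ℂ] A →L[ℂ] StrongDual ℂ A :=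
  ((ContinuousLinearMap.compL ℂ A (A →L[ℂ] A) (StrongDual ℂ A)).flip
    (ContinuousLinearMap.mul ℂ A).flip).comp (ContinuousLinearMap.compL ℂ A A ℂ)

/-- The functional `φ.a`, `(φ.a) b = φ (a b)`, as a bounded bilinear map in `φ` and `a`. -/
def rightTranslate : StrongDual ℂ A →L[ℂ] A →L[ℂ] StrongDual ℂ A :=
  ((ContinuousLinearMap.compL ℂ A (A →L[ℂ] A) (StrongDual ℂ A)).flip
    (ContinuousLinearMap.mul ℂ A)).comp (ContinuousLinearMap.compL ℂ A A ℂ)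

theorem leftTranslate_apply (φ : StrongDual ℂ A) (a b : A) :
    leftTranslate φ a b = φ (b * a) := rfl

theorem rightTranslate_apply (φ : StrongDual ℂ A) (a b : A) :
    rightTranslate φ a b = φ (a * b) := rfl

variable (A) in
/-- The bidual `A**`. A functional `φ` on `A` extends to `A**` by `x ↦ x φ`. -/
abbrev Bidual : Type _ := StrongDual ℂ (StrongDual ℂ A)

/-- The action `x.φ` of `x ∈ A**` on `φ ∈ A*`, given by `(x.φ) a = φ (a x) = x (φ.a)`. -/
def bidualActLeft (x : Bidual A) : StrongDual ℂ A →L[ℂ] StrongDual ℂ A :=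
  (ContinuousLinearMap.compL ℂ A (StrongDual ℂ A) ℂ x).comp rightTranslate

/-- The action `φ.x` of `x ∈ A**` on `φ ∈ A*`, given by `(φ.x) a = φ (x a) = x (a.φ)`. -/
def bidualActRight (x : Bidual A) : StrongDual ℂ A →L[ℂ] StrongDual ℂ A :=
  (ContinuousLinearMap.compL ℂ A (StrongDual ℂ A) ℂ x).comp leftTranslate

theorem bidualActLeft_apply (x : Bidual A) (φ : StrongDual ℂ A) (a : A) :
    bidualActLeft x φ a = x (rightTranslate φ a) := rfl

theorem bidualActRight_apply (x : Bidual A) (φ : StrongDual ℂ A) (a : A) :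
    bidualActRight x φ a = x (leftTranslate φ a) := rfl

/-- The (Arens) product of the enveloping von Neumann algebra `A**`: `φ (x y) = (y.φ) x`. -/
def bidualMul (x y : Bidual A) : Bidual A := x.comp (bidualActLeft y)

variable [StarRing A] [NormedStarGroup A] [StarModule ℂ A]

/-- Positive functionals. -/
def IsPositiveFunctional (φ : StrongDual ℂ A) : Prop := ∀ a : A, 0 ≤ φ (star a * a)

/-- States: positive functionals of norm one. -/
def IsState (φ : StrongDual ℂ A) : Prop := IsPositiveFunctional φ ∧ ‖φ‖ = 1

/-- The functional `a ↦ conj (φ (a*))`. -/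
def conjFunctional (φ : StrongDual ℂ A) : StrongDual ℂ A :=
  LinearMap.mkContinuous
    { toFun := fun a => star (φ (star a))
      map_add' := fun a b => by simp
      map_smul' := fun c a => by simp } ‖φ‖ (fun a => by
        simpa using φ.le_opNorm (star a))

/-- The involution of `A**`: `φ (x*) = conj (φ^* x)` where `φ^* a = conj (φ (a*))`. -/
def bidualStar (x : Bidual A) : Bidual A :=
  LinearMap.mkContinuous
    { toFun := fun φ => star (x (conjFunctional φ))
      map_add' := fun φ ψ => by
        have : conjFunctional (φ + ψ) = conjFunctional φ + conjFunctional ψ := by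
          ext a; simp [conjFunctional]
        simp [this]
      map_smul' := fun c φ => by
        have : conjFunctional (c • φ) = star c • conjFunctional φ := by
          ext a; simp [conjFunctional]
        simp [this] } ‖x‖ (fun φ => by
        have h1 : ‖conjFunctional φ‖ ≤ ‖φ‖ := LinearMap.mkContinuous_norm_le _ (norm_nonneg _) _
        have h2 := x.le_opNorm (conjFunctional φ)
        have h3 := mul_le_mul_of_nonneg_left h1 (norm_nonneg x)
        simpa using h2.trans h3)

/-- Projections of `A**`. -/
def IsBidualProjection (p : Bidual A) : Prop := bidualMul p p = p ∧ bidualStar p = p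

/-- `φ (p x) = φ (x p) = φ x` for all `x ∈ A**`. -/
def IsCarriedBy (φ : StrongDual ℂ A) (p : Bidual A) : Prop :=
  ∀ x : Bidual A, bidualMul p x φ = x φ ∧ bidualMul x p φ = x φ

/-- `p` is the support of `φ`: the smallest projection `p` of `A**` carrying `φ`. -/
def IsSupport (φ : StrongDual ℂ A) (p : Bidual A) : Prop :=
  IsBidualProjection p ∧ IsCarriedBy φ p ∧
    ∀ q : Bidual A, IsBidualProjection q → IsCarriedBy φ q → bidualMul q p = p

/-- `ω = u.φ` is the polar decomposition of `ω`: `φ` is a positive functional and `u ∈ A**` is a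
partial isometry such that `u* u` is the support of `φ`. -/
structure IsPolarDecomposition (ω φ : StrongDual ℂ A) (u : Bidual A) : Prop where
  positive : IsPositiveFunctional φ
  partialIsometry : bidualMul (bidualMul u (bidualStar u)) u = u
  support : IsSupport φ (bidualMul (bidualStar u) u)
  eq : ω = bidualActLeft u φ

open Classical in
/-- The polar decomposition `(|ω|_r, u)` of a functional `ω` on a C*-algebra (it exists and is
unique). -/
def polarDecomposition (ω : StrongDual ℂ A) : StrongDual ℂ A × Bidual A :=
  if h : ∃ p : StrongDual ℂ A × Bidual A, IsPolarDecomposition ω p.1 p.2 then h.choose else (0, 0)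

/-- The right absolute value `|ω|_r`. -/
def rightAbs (ω : StrongDual ℂ A) : StrongDual ℂ A := (polarDecomposition ω).1

/-- The left absolute value `|ω|_l = u.|ω|_r.u*`. -/
def leftAbs (ω : StrongDual ℂ A) : StrongDual ℂ A :=
  bidualActRight (bidualStar (polarDecomposition ω).2)
    (bidualActLeft (polarDecomposition ω).2 (rightAbs ω))

end Dual

/-! ## Weights -/

section Weight

variable {H : Type*} [NormedAddCommGroup H] [InnerProductSpace ℂ H] [CompleteSpace H]
  {A : NonUnitalStarSubalgebra ℂ (H →L[ℂ] H)}

variable (A) in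
/-- The positive cone of `A`. -/
def positiveCone : Set A := {a | (a : H →L[ℂ] H).IsPositive}

/-- A norm continuous one-parameter group of *-automorphisms of `A`. -/
structure IsOneParameterGroup (σ : ℝ → A ≃⋆ₐ[ℂ] A) : Prop where
  zero : ∀ a, σ 0 a = a
  add : ∀ s t a, σ (s + t) a = σ s (σ t a)
  continuous : ∀ a, Continuous fun t => σ t a

/-- `a` belongs to the domain of the analytic extension `σ_{i/2}` and `σ_{i/2} a = b`. -/
def IsAnalyticValue (σ : ℝ → A ≃⋆ₐ[ℂ] A) (a b : A) : Prop :=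
  ∃ f : ℂ → A, DiffContOnCl ℂ f {z : ℂ | 0 < z.im ∧ z.im < 1 / 2} ∧
    (∀ t : ℝ, f t = σ t a) ∧ f (Complex.I / 2) = b

/-- Faithful KMS-weights on `A`. Only the values of `φ` on the positive cone are relevant. -/
structure IsFaithfulKMSWeight (φ : A → ℝ≥0∞) : Prop where
  add : ∀ a ∈ positiveCone A, ∀ b ∈ positiveCone A, φ (a + b) = φ a + φ b
  smul : ∀ r : NNReal, ∀ a ∈ positiveCone A, φ (((r : ℝ) : ℂ) • a) = r * φ a
  nonzero : ∃ a ∈ positiveCone A, φ a ≠ 0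
  denselyDefined : positiveCone A ⊆ closure {a | a ∈ positiveCone A ∧ φ a < ⊤}
  lowerSemicontinuous : LowerSemicontinuousOn φ (positiveCone A)
  faithful : ∀ a ∈ positiveCone A, φ a = 0 → a = 0
  kms : ∃ σ : ℝ → A ≃⋆ₐ[ℂ] A, IsOneParameterGroup σ ∧
    (∀ t, ∀ a ∈ positiveCone A, φ (σ t a) = φ a) ∧
    ∀ a b : A, IsAnalyticValue σ a b → φ (star a * a) = φ (b * star b)

end Weight

/-! ## Locally compact quantum groups -/

section Comultiplication

variable {H : Type*} [NormedAddCommGroup H] [InnerProductSpace ℂ H] [CompleteSpace H]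
  {A : NonUnitalStarSubalgebra ℂ (H →L[ℂ] H)}
  (Δ : A →⋆ₙₐ[ℂ] multiplierAlgebra (spatialTensor A A))

/-- `Δ : A → M(A ⊗ A)` is nondegenerate: `Δ(A) (A ⊗ A)` spans a dense subspace of `A ⊗ A`. -/
def IsNondegenerateComul : Prop :=
  (Submodule.span ℂ {x : HilbertTensor H H →L[ℂ] HilbertTensor H H |
    ∃ a : A, ∃ t ∈ spatialTensor A A,
      x = (Δ a : HilbertTensor H H →L[ℂ] HilbertTensor H H) * t}).topologicalClosure =
      (spatialTensor A A).toSubmodule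

/-- `(id ⊗ Δ) Δ = (Δ ⊗ id) Δ`. Here `Ψ₁` and `Ψ₂` are the extensions of `id ⊗ Δ` and of `Δ ⊗ id`
to unital *-homomorphisms on `M(A ⊗ A)`; when `A` and `Δ` are nondegenerate, they exist and are
determined by their values on elementary tensors. -/
def IsCoassociative : Prop :=
  ∃ Ψ₁ Ψ₂ : multiplierAlgebra (spatialTensor A A) →⋆ₐ[ℂ]
      (HilbertTensor H (HilbertTensor H H) →L[ℂ] HilbertTensor H (HilbertTensor H H)),
    (∀ a b : A, Ψ₁ (elemTensor a b) = opTensor (a : H →L[ℂ] H) (Δ b)) ∧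
    (∀ a b : A, Ψ₂ (elemTensor a b) ∘L hilbertAssoc =
      hilbertAssoc ∘L opTensor (Δ a) (b : H →L[ℂ] H)) ∧
    ∀ a : A, Ψ₁ (Δ a) = Ψ₂ (Δ a)

/-- The quantum cancellation laws: `Δ(A) (A ⊗ 1)` and `Δ(A) (1 ⊗ A)` both have closed linear
span `A ⊗ A`. -/
def SatisfiesCancellation : Prop :=
  (Submodule.span ℂ {x : HilbertTensor H H →L[ℂ] HilbertTensor H H |
    ∃ a b : A,
      x = (Δ a : HilbertTensor H H →L[ℂ] HilbertTensor H H) * opTensor (b : H →L[ℂ] H) 1}).topologicalClosure =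
      (spatialTensor A A).toSubmodule ∧
  (Submodule.span ℂ {x : HilbertTensor H H →L[ℂ] HilbertTensor H H |
    ∃ a b : A,
      x = (Δ a : HilbertTensor H H →L[ℂ] HilbertTensor H H) * opTensor 1 (b : H →L[ℂ] H)}).topologicalClosure =
      (spatialTensor A A).toSubmodule

/-- Left invariance: `φ ((ω ⊗ id) Δ(a)) = ω(1) φ(a)`; here `(ω ⊗ id) Δ(a)` lies in `A` by
the cancellation laws, and `ω(1) = ‖ω‖` as `ω` is positive. -/
def IsLeftInvariant (φ : A → ℝ≥0∞) : Prop :=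
  ∀ ω : StrongDual ℂ A, IsPositiveFunctional ω → ∀ a ∈ positiveCone A, φ a < ⊤ →
    ∃ b : A, leftSlice ω (Δ a) = toMultiplier b ∧ φ b = ENNReal.ofReal ‖ω‖ * φ a

/-- Right invariance: `ψ ((id ⊗ ω) Δ(a)) = ω(1) ψ(a)`. -/
def IsRightInvariant (ψ : A → ℝ≥0∞) : Prop :=
  ∀ ω : StrongDual ℂ A, IsPositiveFunctional ω → ∀ a ∈ positiveCone A, ψ a < ⊤ →
    ∃ b : A, rightSlice ω (Δ a) = toMultiplier b ∧ ψ b = ENNReal.ofReal ‖ω‖ * ψ a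

end Comultiplication

/-- A locally compact quantum group, given by the C*-algebra `C0` (acting faithfully and
nondegenerately on a Hilbert space `H`) with its comultiplication. -/
structure LocallyCompactQuantumGroup (H : Type*) [NormedAddCommGroup H] [InnerProductSpace ℂ H]
    [CompleteSpace H] where
  /-- The C*-algebra of continuous functions vanishing at infinity. -/
  C0 : NonUnitalStarSubalgebra ℂ (H →L[ℂ] H)
  isClosed : IsClosed (C0 : Set (H →L[ℂ] H))
  nondegenerate : IsNondegenerate C0
  /-- The comultiplication. -/
  comul : C0 →⋆ₙₐ[ℂ] multiplierAlgebra (spatialTensor C0 C0)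
  comul_nondegenerate : IsNondegenerateComul comul
  coassociative : IsCoassociative comul
  cancellation : SatisfiesCancellation comul
  exists_leftHaar : ∃ φ : C0 → ℝ≥0∞, IsFaithfulKMSWeight φ ∧ IsLeftInvariant comul φ
  exists_rightHaar : ∃ ψ : C0 → ℝ≥0∞, IsFaithfulKMSWeight ψ ∧ IsRightInvariant comul ψ

namespace LocallyCompactQuantumGroup

variable {H : Type*} [NormedAddCommGroup H] [InnerProductSpace ℂ H] [CompleteSpace H]
  (G : LocallyCompactQuantumGroup H)

/-- The measure algebra `M(G)`, the Banach space dual of `C0`. -/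
abbrev MeasureAlgebra : Type _ := StrongDual ℂ G.C0

/-- Coamenability: the existence of a bounded counit. -/
def IsCoamenable : Prop :=
  ∃ ε : G.MeasureAlgebra, ∀ a : G.C0,
    leftSlice ε (G.comul a) = toMultiplier a ∧ rightSlice ε (G.comul a) = toMultiplier a

variable {G}

/-- The convolution `(ω ⊗ μ) ∘ Δ`. -/
def convolution (ω μ : G.MeasureAlgebra) (a : G.C0) : ℂ := tensorFunctional ω μ (G.comul a)

/-- Idempotent functionals: nonzero `ω` with `ω ⋆ ω = ω`. -/
def IsIdempotent (ω : G.MeasureAlgebra) : Prop :=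
  ω ≠ 0 ∧ ∀ a : G.C0, convolution ω ω a = ω a

/-- Contractive idempotents. -/
def IsContractiveIdempotent (ω : G.MeasureAlgebra) : Prop := IsIdempotent ω ∧ ‖ω‖ ≤ 1

/-- Idempotent states. -/
def IsIdempotentState (ω : G.MeasureAlgebra) : Prop := IsIdempotent ω ∧ IsState ω

/-- The set `N_{σ ⊗ σ} = {X ∈ M(C0 ⊗ C0) : (σ ⊗ σ)(X* X) = 0}`. -/
def tensorNull (σ : G.MeasureAlgebra) : Set (multiplierAlgebra (spatialTensor G.C0 G.C0)) :=
  {X | tensorFunctional σ σ (star X * X) = 0}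

end LocallyCompactQuantumGroup

end

noncomputable section

open Filter
open scoped InnerProductSpace

universe u

theorem exists_norm_add_smul_eq (z w : ℂ) : ∃ c : ℂ, ‖c‖ = 1 ∧ ‖z + c * w‖ = ‖z‖ + ‖w‖ := by
  by_cases hz : z = 0
  · exact ⟨1, by simp, by simp [hz]⟩
  by_cases hw : w = 0
  · exact ⟨1, by simp, by simp [hw]⟩
  have hz' : (‖z‖ : ℂ) ≠ 0 := by simpa using hz
  have hw' : (‖w‖ : ℂ) ≠ 0 := by simpa using hw
  refine ⟨(z / ‖z‖) * (‖w‖ / w), by simp [hz, hw], ?_⟩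
  have : z + z / ‖z‖ * (‖w‖ / w) * w = z / ‖z‖ * ((‖z‖ + ‖w‖ : ℝ) : ℂ) := by
    push_cast
    field_simp
  rw [this, norm_mul, norm_div, Complex.norm_real, Complex.norm_real, norm_norm, div_self (by simpa using hz),
    one_mul, Real.norm_of_nonneg (by positivity)]

section ApproxUnit

variable (A : Type*) [NonUnitalCStarAlgebra A]

/-- An approximate unit of a C*-algebra, consisting of positive contractions. -/
def approxUnit : Filter A :=
  letI := CStarAlgebra.spectralOrder A
  letI := CStarAlgebra.spectralOrderedRing A
  CStarAlgebra.approximateUnit A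

instance : (approxUnit A).NeBot :=
  let _ := CStarAlgebra.spectralOrder A
  let _ := CStarAlgebra.spectralOrderedRing A
  (CStarAlgebra.increasingApproximateUnit A).neBot

variable {A}

theorem tendsto_approxUnit_mul (a : A) : Tendsto (fun e => e * a) (approxUnit A) (𝓝 a) :=
  let _ := CStarAlgebra.spectralOrder A
  let _ := CStarAlgebra.spectralOrderedRing A
  (CStarAlgebra.increasingApproximateUnit A).tendsto_mul_right a

theorem tendsto_mul_approxUnit (a : A) : Tendsto (fun e => a * e) (approxUnit A) (𝓝 a) :=
  let _ := CStarAlgebra.spectralOrder A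
  let _ := CStarAlgebra.spectralOrderedRing A
  (CStarAlgebra.increasingApproximateUnit A).tendsto_mul_left a

theorem eventually_approxUnit_norm_le : ∀ᶠ e in approxUnit A, ‖e‖ ≤ 1 :=
  let _ := CStarAlgebra.spectralOrder A
  let _ := CStarAlgebra.spectralOrderedRing A
  (CStarAlgebra.increasingApproximateUnit A).eventually_norm

theorem eventually_approxUnit_eq_star_mul_self :
    ∀ᶠ e in approxUnit A, ∃ s : A, e = star s * s := by
  let _ := CStarAlgebra.spectralOrder A
  let _ := CStarAlgebra.spectralOrderedRing A
  filter_upwards [(CStarAlgebra.increasingApproximateUnit A).eventually_nonneg] with e he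
  exact CStarAlgebra.nonneg_iff_eq_star_mul_self.mp he

theorem eventually_approxUnit_star_eq : ∀ᶠ e in approxUnit A, star e = e := by
  filter_upwards [eventually_approxUnit_eq_star_mul_self] with e ⟨s, hs⟩
  simp [hs]

/-- Cauchy-Schwarz for a product of a row and a column with entries in a C*-algebra. -/
theorem norm_mul_add_mul_le {U : Type*} [NonUnitalCStarAlgebra U] (p₁ p₂ q₁ q₂ : U) :
    ‖p₁ * q₁ + p₂ * q₂‖ ≤
      √‖p₁ * star p₁ + p₂ * star p₂‖ * √‖star q₁ * q₁ + star q₂ * q₂‖ := by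
  let _ := CStarAlgebra.spectralOrder U
  let _ := CStarAlgebra.spectralOrderedRing U
  have h := CStarModule.norm_inner_le (A := U) (E := WithCStarModule U (U × U))
    (x := (WithCStarModule.equiv U (U × U)).symm (star q₁, star q₂))
    (y := (WithCStarModule.equiv U (U × U)).symm (p₁, p₂))
  rw [WithCStarModule.prod_inner, WithCStarModule.prod_norm, WithCStarModule.prod_norm] at h
  change ‖p₁ * star (star q₁) + p₂ * star (star q₂)‖ ≤
    √‖star q₁ * star (star q₁) + star q₂ * star (star q₂)‖ * √‖p₁ * star p₁ + p₂ * star p₂‖ at h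
  rw [star_star, star_star, mul_comm (√_)] at h
  exact h

theorem norm_mul_add_smul_sub_le {e b c : A} {t : ℝ} (he : ∃ s : A, e = star s * s)
    (he1 : ‖e‖ ≤ 1) (hb : ‖b‖ ≤ 1) (hc : ‖c‖ ≤ 1) :
    ‖c * e + (t : ℂ) • (b - b * e)‖ ≤ √(1 + t ^ 2) := by
  let _ := CStarAlgebra.spectralOrder (Unitization ℂ A)
  let _ := CStarAlgebra.spectralOrderedRing (Unitization ℂ A)
  set E : Unitization ℂ A := (e : Unitization ℂ A) with hE
  have hE0 : 0 ≤ E := by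
    obtain ⟨s, rfl⟩ := he
    rw [hE, Unitization.inr_mul, Unitization.inr_star]
    exact star_mul_self_nonneg _
  have hE1 : E ≤ 1 := by
    rw [← CStarAlgebra.norm_le_one_iff_of_nonneg E hE0, hE, Unitization.norm_inr]
    exact he1
  have hsa : star E = E := hE0.isSelfAdjoint.star_eq
  have hEE : E * E ≤ E := by
    have := CStarAlgebra.pow_antitone hE0 hE1 one_le_two
    simpa [sq] using this
  have h1 : ‖star E * E + star (1 - E) * (1 - E)‖ ≤ 1 := by
    rw [CStarAlgebra.norm_le_one_iff_of_nonneg _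
      (add_nonneg (star_mul_self_nonneg _) (star_mul_self_nonneg _)), star_sub, star_one, hsa,
      ← sub_nonneg]
    have : 1 - (E * E + (1 - E) * (1 - E)) = (E - E * E) + (E - E * E) := by noncomm_ring
    rw [this]
    exact add_nonneg (sub_nonneg.mpr hEE) (sub_nonneg.mpr hEE)
  have h2 : ‖(c : Unitization ℂ A) * star (c : Unitization ℂ A) +
      (((t : ℂ) • b : A) : Unitization ℂ A) * star (((t : ℂ) • b : A) : Unitization ℂ A)‖ ≤
      1 + t ^ 2 := by
    refine (norm_add_le _ _).trans ?_
    rw [CStarRing.norm_self_mul_star, CStarRing.norm_self_mul_star, Unitization.norm_inr,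
      Unitization.norm_inr, norm_smul, Complex.norm_real, Real.norm_eq_abs]
    have h3 : |t| * ‖b‖ ≤ |t| := mul_le_of_le_one_right (abs_nonneg _) hb
    have h4 := abs_mul_abs_self t
    have h5 := mul_self_le_mul_self (by positivity) h3
    nlinarith [norm_nonneg c]
  have h3 := norm_mul_add_mul_le (c : Unitization ℂ A) (((t : ℂ) • b : A) : Unitization ℂ A) E (1 - E)
  have h4 : (c : Unitization ℂ A) * E + (((t : ℂ) • b : A) : Unitization ℂ A) * (1 - E) =
      ((c * e + (t : ℂ) • (b - b * e) : A) : Unitization ℂ A) := by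
    rw [hE, mul_sub, mul_one, smul_sub]
    simp [Unitization.inr_add, Unitization.inr_mul, Unitization.inr_sub, Unitization.inr_smul]
  rw [h4, Unitization.norm_inr] at h3
  calc _ ≤ _ := h3
    _ ≤ √(1 + t ^ 2) * √1 := by gcongr
    _ = _ := by simp

theorem inner_star_mul_self_apply {H : Type*} [NormedAddCommGroup H] [InnerProductSpace ℂ H]
    [CompleteSpace H] (π : A →⋆ₙₐ[ℂ] (H →L[ℂ] H)) (s : A) (ζ : H) :
    ⟪ζ, π (star s * s) ζ⟫_ℂ = (‖π s ζ‖ : ℂ) ^ 2 := by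
  rw [map_mul, map_star, ContinuousLinearMap.mul_def, ContinuousLinearMap.comp_apply, ContinuousLinearMap.star_eq_adjoint,
    ContinuousLinearMap.adjoint_inner_right, inner_self_eq_norm_sq_to_K]
  simp

/-- An element represented by a positive operator is of the form `b* b`. -/
theorem exists_eq_star_mul_self {H : Type*} [NormedAddCommGroup H] [InnerProductSpace ℂ H]
    [CompleteSpace H] (π : A →⋆ₙₐ[ℂ] (H →L[ℂ] H)) (hπ : Function.Injective π) {a : A}
    (h0 : ∀ ζ, 0 ≤ ⟪ζ, π a ζ⟫_ℂ) :
    ∃ b : A, a = star b * b := by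
  let _ := CStarAlgebra.spectralOrder A
  let _ := CStarAlgebra.spectralOrderedRing A
  have hsa : IsSelfAdjoint a := by
    have hp : (π a).IsPositive := by
      rw [ContinuousLinearMap.isPositive_iff_complex]
      intro ζ
      have h := h0 ζ
      have h2 := RCLike.nonneg_iff.mp h
      have h3 : ⟪(π a) ζ, ζ⟫_ℂ = ⟪ζ, (π a) ζ⟫_ℂ := by
        rw [← inner_conj_symm]
        exact RCLike.conj_eq_iff_im.mpr h2.2
      rw [h3]
      exact ⟨Complex.ext rfl h2.2.symm, h2.1⟩
    exact hπ ((map_star π a).trans hp.isSelfAdjoint)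
  obtain ⟨s, hs⟩ : ∃ s : A, a⁻ = star s * s :=
    CStarAlgebra.nonneg_iff_eq_star_mul_self.mp (CFC.negPart_nonneg a)
  have hn : IsSelfAdjoint (a⁻) := (CFC.negPart_nonneg a).isSelfAdjoint
  have hmul : a⁻ * a * a⁻ = -(a⁻ * a⁻ * a⁻) := by
    have : a * a⁻ = -(a⁻ * a⁻) := by
      conv_lhs => enter [1]; rw [← CFC.posPart_sub_negPart a hsa]
      simp [sub_mul, CFC.posPart_mul_negPart]
    rw [mul_assoc, this, mul_neg, mul_assoc]
  have hz : a⁻ = 0 := by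
    refine hπ (ContinuousLinearMap.ext fun ζ => ?_)
    rw [map_zero]
    set n : H →L[ℂ] H := π (a⁻) with hn_def
    have hadj : ∀ x y, ⟪x, n y⟫_ℂ = ⟪n x, y⟫_ℂ := by
      intro x y
      have : star n = n := by rw [hn_def, ← map_star, hn.star_eq]
      rw [← ContinuousLinearMap.adjoint_inner_left, ← ContinuousLinearMap.star_eq_adjoint, this]
    have h1 := h0 (n ζ)
    rw [← hadj] at h1
    have h2 : n ((π a) (n ζ)) = -(n (n (n ζ))) := by
      have := congrArg (fun x : A => π x ζ) hmul
      simpa using this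
    have h3 : ⟪n ζ, n (n ζ)⟫_ℂ = (‖π s (n ζ)‖ : ℂ) ^ 2 := by
      rw [← inner_star_mul_self_apply, ← hs, hn_def]
    rw [h2, inner_neg_right, hadj ζ, h3] at h1
    have h3 : π s (n ζ) = 0 := by
      have h4 : (0:ℂ) ≤ ((-‖π s (n ζ)‖ ^ 2 : ℝ) : ℂ) := by simpa using h1
      rw [Complex.zero_le_real] at h4
      have : ‖π s (n ζ)‖ ^ 2 = 0 := le_antisymm (by linarith) (by positivity)
      simpa using this
    have h5 : n (n ζ) = 0 := by
      have : n (n ζ) = π (star s) (π s (n ζ)) := by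
        rw [hn_def, hs, map_mul]; rfl
      rw [this, h3, map_zero]
    have h6 : ⟪n ζ, n ζ⟫_ℂ = 0 := by rw [← hadj, h5, inner_zero_right]
    simpa using inner_self_eq_zero.mp h6
  have ha : a = a⁺ := by
    conv_lhs => rw [← CFC.posPart_sub_negPart a hsa, hz, sub_zero]
  exact CStarAlgebra.nonneg_iff_eq_star_mul_self.mp (ha ▸ CFC.posPart_nonneg a)

theorem norm_apply_mul_add_le (F : StrongDual ℂ A) {e b c : A} {t : ℝ} (ht : 0 ≤ t)
    (he : ∃ s : A, e = star s * s) (he1 : ‖e‖ ≤ 1) (hb : ‖b‖ ≤ 1) (hc : ‖c‖ ≤ 1) :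
    ‖F (c * e)‖ + t * ‖F (b - b * e)‖ ≤ ‖F‖ * (1 + t ^ 2 / 2) := by
  obtain ⟨z, hz, hz'⟩ := exists_norm_add_smul_eq (F (c * e)) ((t : ℂ) * F (b - b * e))
  have hzb : ‖z • b‖ ≤ 1 := by
    have : ‖z • b‖ = ‖z‖ * ‖b‖ := norm_smul z b
    rw [this, hz, one_mul]
    exact hb
  have h4 := norm_mul_add_smul_sub_le (t := t) he he1 hzb hc
  have h5 : F (c * e + (t : ℂ) • (z • b - (z • b) * e)) =
      F (c * e) + z * ((t : ℂ) * F (b - b * e)) := by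
    rw [map_add, map_smul, map_sub, map_sub, smul_mul_assoc, map_smul, map_smul]
    simp only [smul_eq_mul]
    ring
  have h6 := F.le_opNorm (c * e + (t : ℂ) • (z • b - (z • b) * e))
  rw [h5, hz', norm_mul, Complex.norm_real, Real.norm_of_nonneg ht] at h6
  have h7 : √(1 + t ^ 2) ≤ 1 + t ^ 2 / 2 := Real.sqrt_one_add_le (by nlinarith)
  exact h6.trans (mul_le_mul_of_nonneg_left (h4.trans h7) (norm_nonneg F))

theorem exists_norm_le_one_lt_norm_apply {E : Type*} [NormedAddCommGroup E] [NormedSpace ℂ E]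
    (F : StrongDual ℂ E) {δ : ℝ} (hδ : 0 < δ) : ∃ c : E, ‖c‖ ≤ 1 ∧ ‖F‖ - δ < ‖F c‖ := by
  by_cases h0 : ‖F‖ - δ < 0
  · exact ⟨0, by simp, by simpa using h0⟩
  · obtain ⟨c, hc, hc'⟩ := F.exists_lt_apply_of_lt_opNorm (r := ‖F‖ - δ) (by linarith)
    exact ⟨c, hc.le, hc'⟩

theorem norm_sub_leftTranslate_le (F : StrongDual ℂ A) {e c : A} {t δ : ℝ} (ht : 0 < t)
    (he : ∃ s : A, e = star s * s) (he1 : ‖e‖ ≤ 1) (hc : ‖c‖ ≤ 1) (hFc : ‖F‖ - δ < ‖F (c * e)‖) :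
    ‖F - leftTranslate F e‖ ≤ ‖F‖ * (t / 2) + δ / t := by
  have hδ : 0 ≤ ‖F‖ * (t / 2) + δ / t := by
    have h1 := norm_apply_mul_add_le F (b := 0) ht.le he he1 (by simp) hc
    have h2 : 0 < t * (‖F‖ * (t / 2) + δ / t) := by
      have : t * (‖F‖ * (t / 2) + δ / t) = ‖F‖ * (t ^ 2 / 2) + δ := by field_simp
      rw [this]
      simp only [zero_mul, sub_zero, map_zero, norm_zero, mul_zero, add_zero] at h1
      linarith
    exact (pos_of_mul_pos_right h2 ht.le).le
  refine ContinuousLinearMap.opNorm_le_of_unit_norm hδ fun b hb => ?_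
  have h1 := norm_apply_mul_add_le F (b := b) ht.le he he1 hb.le hc
  have h2 : (F - leftTranslate F e) b = F (b - b * e) := by
    rw [map_sub]; rfl
  rw [h2]
  have h3 : t * ‖F (b - b * e)‖ ≤ t * (‖F‖ * (t / 2) + δ / t) := by
    have : t * (‖F‖ * (t / 2) + δ / t) = ‖F‖ * (t ^ 2 / 2) + δ := by field_simp
    rw [this]
    linarith
  exact le_of_mul_le_mul_left h3 ht

theorem tendsto_leftTranslate_approxUnit (F : StrongDual ℂ A) :
    Tendsto (fun e => leftTranslate F e) (approxUnit A) (𝓝 F) := by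
  rw [tendsto_iff_norm_sub_tendsto_zero]
  refine (nhds_basis_Ioo_pos (0 : ℝ)).tendsto_right_iff.mpr fun ε hε => ?_
  have hF := norm_nonneg F
  obtain ⟨t, ht0, ht⟩ : ∃ t : ℝ, 0 < t ∧ ‖F‖ * (t / 2) ≤ ε / 4 := by
    refine ⟨ε / (2 * (‖F‖ + 1)), by positivity, ?_⟩
    rw [div_div, mul_div_assoc', div_le_div_iff₀ (by positivity) (by positivity)]
    nlinarith
  have hδ0 : 0 < ε * t / 4 := by positivity
  obtain ⟨c, hc1, hc2⟩ := exists_norm_le_one_lt_norm_apply F hδ0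
  have hlim : Tendsto (fun e => ‖F (c * e)‖) (approxUnit A) (𝓝 ‖F c‖) :=
    (F.continuous.norm.tendsto c).comp (tendsto_mul_approxUnit c)
  filter_upwards [hlim.eventually (lt_mem_nhds hc2), eventually_approxUnit_norm_le,
    eventually_approxUnit_eq_star_mul_self] with e h1 h2 h3
  have h4 := norm_sub_leftTranslate_le F ht0 h3 h2 hc1 h1
  rw [norm_sub_rev] at h4
  have h5 : ε * t / 4 / t = ε / 4 := by field_simp
  rw [h5] at h4
  constructor
  · linarith [norm_nonneg (leftTranslate F e - F)]
  · linarith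

theorem conjFunctional_apply (F : StrongDual ℂ A) (a : A) :
    conjFunctional F a = star (F (star a)) := rfl

theorem conjFunctional_conjFunctional (F : StrongDual ℂ A) :
    conjFunctional (conjFunctional F) = F := by
  ext a; simp [conjFunctional_apply]

theorem norm_conjFunctional_le (F : StrongDual ℂ A) : ‖conjFunctional F‖ ≤ ‖F‖ :=
  LinearMap.mkContinuous_norm_le _ (norm_nonneg _) _

theorem norm_conjFunctional (F : StrongDual ℂ A) : ‖conjFunctional F‖ = ‖F‖ :=
  le_antisymm (norm_conjFunctional_le F)
    ((congrArg norm (conjFunctional_conjFunctional F)).symm.le.trans (norm_conjFunctional_le _))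

theorem conjFunctional_sub (F G : StrongDual ℂ A) :
    conjFunctional (F - G) = conjFunctional F - conjFunctional G := by
  ext a; simp [conjFunctional_apply]

theorem conjFunctional_smul (c : ℂ) (F : StrongDual ℂ A) :
    conjFunctional (c • F) = star c • conjFunctional F := by
  ext a; simp [conjFunctional_apply]

theorem conjFunctional_leftTranslate (F : StrongDual ℂ A) (a : A) :
    conjFunctional (leftTranslate F a) = rightTranslate (conjFunctional F) (star a) := by
  ext b; simp [conjFunctional_apply, leftTranslate_apply, rightTranslate_apply]

theorem conjFunctional_rightTranslate (F : StrongDual ℂ A) (a : A) :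
    conjFunctional (rightTranslate F a) = leftTranslate (conjFunctional F) (star a) := by
  ext b; simp [conjFunctional_apply, leftTranslate_apply, rightTranslate_apply]

theorem tendsto_conjFunctional {ι : Type*} {l : Filter ι} {f : ι → StrongDual ℂ A}
    {F : StrongDual ℂ A} (h : Tendsto f l (𝓝 F)) :
    Tendsto (fun i => conjFunctional (f i)) l (𝓝 (conjFunctional F)) := by
  rw [tendsto_iff_norm_sub_tendsto_zero] at h ⊢
  simpa only [← conjFunctional_sub, norm_conjFunctional] using h

theorem tendsto_rightTranslate_approxUnit (F : StrongDual ℂ A) :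
    Tendsto (fun e => rightTranslate F e) (approxUnit A) (𝓝 F) := by
  have h := tendsto_conjFunctional (tendsto_leftTranslate_approxUnit (conjFunctional F))
  rw [conjFunctional_conjFunctional] at h
  refine h.congr' ?_
  filter_upwards [eventually_approxUnit_star_eq] with e he
  rw [conjFunctional_leftTranslate, conjFunctional_conjFunctional, he]

/-- A factorization `F = ∑ F_k(· e_k)` of a functional, with rapidly decreasing `F_k`. -/
theorem exists_leftTranslate_series (F : StrongDual ℂ A) :
    ∃ (e : ℕ → A) (f : ℕ → StrongDual ℂ A) (C : ℝ), 0 ≤ C ∧ (∀ k, ‖e k‖ ≤ 1) ∧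
      (∀ k, ‖f k‖ ≤ C * (1 / 4) ^ k) ∧ ∀ a, HasSum (fun k => f k (a * e k)) (F a) := by
  have key : ∀ (G : StrongDual ℂ A) (ε : ℝ), 0 < ε →
      ∃ e : A, ‖e‖ ≤ 1 ∧ ‖G - leftTranslate G e‖ ≤ ε := by
    intro G ε hε
    have h := (tendsto_iff_norm_sub_tendsto_zero.mp (tendsto_leftTranslate_approxUnit G)).eventually
      (gt_mem_nhds hε)
    obtain ⟨e, h1, h2⟩ := (h.and eventually_approxUnit_norm_le).exists
    exact ⟨e, h2, by rw [norm_sub_rev]; exact h1.le⟩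
  choose e he1 he2 using key
  let f : ℕ → StrongDual ℂ A := fun n => Nat.rec F
    (fun k G => G - leftTranslate G (e G ((1 / 4) ^ (k + 1)) (by positivity))) n
  let d : ℕ → A := fun k => e (f k) ((1 / 4) ^ (k + 1)) (by positivity)
  have hf : ∀ k, f (k + 1) = f k - leftTranslate (f k) (d k) := fun k => rfl
  have hfn : ∀ k, ‖f k‖ ≤ (1 + ‖F‖) * (1 / 4) ^ k := by
    rintro (_ | k)
    · change ‖F‖ ≤ _; simp
    · rw [hf]
      refine (he2 _ _ _).trans ?_
      exact le_mul_of_one_le_left (by positivity) (by linarith [norm_nonneg F])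
  have hd : ∀ k, ‖d k‖ ≤ 1 := fun k => he1 _ _ _
  refine ⟨d, f, 1 + ‖F‖, by positivity, hd, hfn, fun a => ?_⟩
  have hsum : ∀ n, ∑ k ∈ Finset.range n, f k (a * d k) = F a - f n a := by
    intro n
    induction n with
    | zero => simp [f]
    | succ n ih =>
      rw [Finset.sum_range_succ, ih, hf, _root_.sub_apply, leftTranslate_apply]
      ring
  have hterm : ∀ k, ‖f k (a * d k)‖ ≤ (1 + ‖F‖) * ‖a‖ * (1 / 4) ^ k := by
    intro k
    calc ‖f k (a * d k)‖ ≤ ‖f k‖ * ‖a * d k‖ := (f k).le_opNorm _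
      _ ≤ ((1 + ‖F‖) * (1 / 4) ^ k) * (‖a‖ * 1) := by
        gcongr
        · exact hfn k
        · exact (norm_mul_le _ _).trans (by gcongr; exact hd k)
      _ = _ := by ring
  have hs : Summable fun k => f k (a * d k) :=
    Summable.of_norm_bounded ((summable_geometric_of_lt_one (by norm_num) (by norm_num)).mul_left _)
      hterm
  rw [hs.hasSum_iff_tendsto_nat]
  simp_rw [hsum]
  have h0 : Tendsto (fun n => f n a) atTop (𝓝 0) := by
    refine squeeze_zero_norm (a := fun n => (1 + ‖F‖) * ‖a‖ * (1 / 4) ^ n) (fun n => ?_) ?_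
    · calc ‖f n a‖ ≤ ‖f n‖ * ‖a‖ := (f n).le_opNorm _
        _ ≤ ((1 + ‖F‖) * (1 / 4) ^ n) * ‖a‖ := by gcongr; exact hfn n
        _ = _ := by ring
    · simpa using (tendsto_pow_atTop_nhds_zero_of_lt_one (r := (1 / 4 : ℝ)) (by norm_num)
        (by norm_num)).const_mul ((1 + ‖F‖) * ‖a‖)
  simpa using h0.const_sub (F a)

theorem norm_apply_sq_le_of_le {T : A →L[ℂ] A} (hT : ∀ a b, T (a * b) = T a * b) {b c s : A}
    (h : star b * b = c * star c + star s * s) : ‖T c‖ ≤ ‖T (star b)‖ := by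
  let _ := CStarAlgebra.spectralOrder A
  let _ := CStarAlgebra.spectralOrderedRing A
  have key : ∀ x y : A, T (star (T (x * star y))) = T y * star (T x) := by
    intro x y
    rw [hT, star_mul, star_star, hT]
  have h1 : T (star b) * star (T (star b)) = T c * star (T c) + T (star s) * star (T (star s)) := by
    rw [← key, ← key, ← key, star_star, star_star, h, map_add, star_add, map_add]
  have h2 : T c * star (T c) ≤ T (star b) * star (T (star b)) := by
    rw [h1]
    exact le_add_of_nonneg_right (mul_star_self_nonneg _)
  have h3 := CStarAlgebra.norm_le_norm_of_nonneg_of_le (mul_star_self_nonneg _) h2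
  rw [CStarRing.norm_self_mul_star, CStarRing.norm_self_mul_star] at h3
  exact abs_le_abs_of_nonneg (norm_nonneg _) (by
    by_contra hlt
    push Not at hlt
    nlinarith [norm_nonneg (T (star b))]) |>.trans' (le_abs_self _) |>.trans (abs_norm _).le

theorem exists_dominating (e : ℕ → A) (he : ∀ k, ‖e k‖ ≤ 1) :
    ∃ b : A, ∀ T : A →L[ℂ] A, (∀ x y, T (x * y) = T x * y) →
      ∀ k, ‖T (e k)‖ ≤ 2 ^ k * ‖T (star b)‖ := by
  let _ := CStarAlgebra.spectralOrder A
  let _ := CStarAlgebra.spectralOrderedRing A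
  set f : ℕ → A := fun k => (((1 / 2 : ℝ) ^ k : ℝ) : ℂ) • e k with hf
  have hfn : ∀ k, ‖f k * star (f k)‖ ≤ (1 / 4) ^ k := by
    intro k
    rw [CStarRing.norm_self_mul_star, hf]
    simp only [norm_smul, Complex.norm_real, Real.norm_eq_abs, abs_pow, abs_of_pos
      (show (0 : ℝ) < 1 / 2 by norm_num)]
    calc (1 / 2 : ℝ) ^ k * ‖e k‖ * ((1 / 2) ^ k * ‖e k‖) ≤ (1 / 2) ^ k * 1 * ((1 / 2) ^ k * 1) := by
          gcongr <;> exact he k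
      _ = (1 / 4) ^ k := by rw [mul_one, ← mul_pow]; norm_num
  have hs : Summable fun k => f k * star (f k) :=
    Summable.of_norm_bounded (summable_geometric_of_lt_one (by norm_num) (by norm_num)) hfn
  obtain ⟨b, hb⟩ := CStarAlgebra.nonneg_iff_eq_star_mul_self.mp
    (tsum_nonneg fun k => mul_star_self_nonneg (f k))
  refine ⟨b, fun T hT k => ?_⟩
  have h1 : f k * star (f k) ≤ star b * b := by
    rw [← hb]
    exact hs.le_tsum k fun j _ => mul_star_self_nonneg (f j)
  obtain ⟨s, hs'⟩ := CStarAlgebra.nonneg_iff_eq_star_mul_self.mp (sub_nonneg.mpr h1)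
  have h2 := norm_apply_sq_le_of_le hT (b := b) (c := f k) (s := s) (by rw [← hs']; abel)
  have h3 : e k = ((2 ^ k : ℝ) : ℂ) • f k := by
    rw [hf, smul_smul, ← Complex.ofReal_mul, ← mul_pow]
    norm_num
  rw [h3, map_smul, norm_smul, Complex.norm_real, Real.norm_of_nonneg (by positivity)]
  gcongr

theorem exists_hasSum_dual {E : Type*} [NormedAddCommGroup E] [NormedSpace ℂ E]
    (G : ℕ → StrongDual ℂ E) (C : ℝ) (hG : ∀ k, ‖G k‖ ≤ C * (1 / 4) ^ k) :
    ∃ G' : StrongDual ℂ E, ∀ T, HasSum (fun k => G k T) (G' T) := by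
  have hs : Summable G :=
    Summable.of_norm_bounded ((summable_geometric_of_lt_one (by norm_num) (by norm_num)).mul_left _)
      hG
  exact ⟨∑' k, G k, fun T => (ContinuousLinearMap.apply ℂ ℂ T).hasSum hs.hasSum⟩

/-- Every functional on a C*-algebra extends to its left multipliers, continuously for the seminorm
`T ↦ ‖T g‖` of some element `g`. -/
theorem exists_extension_leftMultipliers (F : StrongDual ℂ A) :
    ∃ (G : StrongDual ℂ (A →L[ℂ] A)) (g : A) (C : ℝ),
      (∀ T : A →L[ℂ] A, (∀ x y, T (x * y) = T x * y) → ‖G T‖ ≤ C * ‖T g‖) ∧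
        ∀ a, G (ContinuousLinearMap.mul ℂ A a) = F a := by
  obtain ⟨e, f, C, hC, he, hf, hF⟩ := exists_leftTranslate_series F
  obtain ⟨b, hb⟩ := exists_dominating e he
  have hGn : ∀ k, ‖(f k).comp (ContinuousLinearMap.apply ℂ A (e k))‖ ≤ C * (1 / 4) ^ k := by
    intro k
    refine ContinuousLinearMap.opNorm_le_bound _ (by positivity) fun T => ?_
    calc ‖f k (T (e k))‖ ≤ ‖f k‖ * ‖T (e k)‖ := (f k).le_opNorm _
      _ ≤ (C * (1 / 4) ^ k) * (‖T‖ * 1) := by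
        gcongr
        · exact hf k
        · exact (T.le_opNorm _).trans (by gcongr; exact he k)
      _ = _ := by ring
  obtain ⟨G, hsum⟩ := exists_hasSum_dual _ C hGn
  refine ⟨G, star b, C * 2, fun T hT => ?_, fun a => (hsum _).unique (hF a)⟩
  have h1 : HasSum (fun k : ℕ => C * ‖T (star b)‖ * (1 / 2) ^ k) (C * 2 * ‖T (star b)‖) := by
    rw [show C * 2 * ‖T (star b)‖ = C * ‖T (star b)‖ * 2 by ring]
    exact hasSum_geometric_two.mul_left _
  refine (hsum T).norm_le_of_bounded h1 fun k => ?_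
  calc ‖f k (T (e k))‖ ≤ ‖f k‖ * ‖T (e k)‖ := (f k).le_opNorm _
    _ ≤ (C * (1 / 4) ^ k) * (2 ^ k * ‖T (star b)‖) := by
      gcongr
      · exact hf k
      · exact hb T hT k
    _ = C * ‖T (star b)‖ * ((1 / 4) ^ k * 2 ^ k) := by ring
    _ = _ := by rw [← mul_pow]; norm_num

end ApproxUnit

section Domination

variable {A : Type*} [NonUnitalCStarAlgebra A]

theorem norm_add_smul_mul_le {h y : A} (hh : star h = h) (t : ℝ) (hy : ‖y‖ ≤ 1) :
    ‖y + (Complex.I * t) • (h * y)‖ ≤ √(1 + t ^ 2 * ‖h‖ ^ 2) := by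
  set x : Unitization ℂ A := 1 + (Complex.I * t) • (h : Unitization ℂ A) with hx
  have h1 : ‖x‖ ^ 2 ≤ 1 + t ^ 2 * ‖h‖ ^ 2 := by
    rw [sq, ← CStarRing.norm_star_mul_self]
    have h2 : star x * x = 1 + ((t ^ 2 : ℝ) : ℂ) • ((h : Unitization ℂ A) * h) := by
      rw [hx, star_add, star_one, star_smul, ← Unitization.inr_star, hh, star_mul', Complex.star_def,
        Complex.conj_I, Complex.conj_ofReal, mul_add, add_mul, add_mul, one_mul,
        mul_one, one_mul, smul_mul_smul_comm]
      have : -Complex.I * (t : ℂ) * (Complex.I * t) = ((t ^ 2 : ℝ) : ℂ) := by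
        push_cast
        linear_combination (-(t : ℂ) ^ 2) * Complex.I_sq
      rw [this, neg_mul, neg_smul]
      abel
    rw [h2]
    refine (norm_add_le _ _).trans ?_
    rw [norm_smul, Complex.norm_real, Real.norm_of_nonneg (sq_nonneg t), norm_one]
    gcongr
    refine (norm_mul_le _ _).trans ?_
    rw [Unitization.norm_inr, sq]
  have h3 : x * (y : Unitization ℂ A) = ((y + (Complex.I * t) • (h * y) : A) : Unitization ℂ A) := by
    rw [hx, add_mul, one_mul, smul_mul_assoc, ← Unitization.inr_mul, ← Unitization.inr_smul,
      ← Unitization.inr_add]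
  rw [← Unitization.norm_inr (𝕜 := ℂ), ← h3]
  refine (norm_mul_le _ _).trans ?_
  rw [Unitization.norm_inr]
  refine (mul_le_of_le_one_right (norm_nonneg _) hy).trans ?_
  exact Real.le_sqrt_of_sq_le h1

theorem norm_sub_mul_star_mul_add_le {a y : A} {t T : ℝ} (hT : 0 < T)
    (hTt : T = 2 * t - t ^ 2 * ‖a‖ ^ 2) (hy : ‖y‖ ≤ 1) (z : ℂ) :
    ‖y - (t : ℂ) • (a * star a * y) + z • a‖ ≤ √(1 + ‖z‖ ^ 2 / T) := by
  let _ := CStarAlgebra.spectralOrder (Unitization ℂ A)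
  let _ := CStarAlgebra.spectralOrderedRing (Unitization ℂ A)
  set b : Unitization ℂ A := (a : Unitization ℂ A) with hb
  set c := b * star b with hc
  have hc0 : 0 ≤ c := mul_star_self_nonneg b
  have hcs : star c = c := hc0.isSelfAdjoint.star_eq
  have hcc : c * c ≤ ((‖a‖ ^ 2 : ℝ) : ℂ) • c := by
    have h1 := CStarAlgebra.star_right_conjugate_le_norm_smul (a := b) (b := star b * b)
      (IsSelfAdjoint.star_mul_self b)
    rw [CStarRing.norm_star_mul_self, hb, Unitization.norm_inr, ← sq, ← hb,
      ← Complex.coe_smul] at h1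
    calc c * c = b * (star b * b) * star b := by rw [hc]; noncomm_ring
      _ ≤ _ := h1
  have hp : ‖(1 - (t : ℂ) • c) * star (1 - (t : ℂ) • c) +
      (((√T : ℝ) : ℂ) • b) * star (((√T : ℝ) : ℂ) • b)‖ ≤ 1 := by
    rw [CStarAlgebra.norm_le_one_iff_of_nonneg _
      (add_nonneg (mul_star_self_nonneg _) (mul_star_self_nonneg _)), star_sub, star_one,
      star_smul, hcs, star_smul, Complex.star_def, Complex.conj_ofReal,
      Complex.conj_ofReal, smul_mul_smul_comm, ← Complex.ofReal_mul, Real.mul_self_sqrt hT.le, ← hc,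
      ← sub_nonneg]
    have h1 : 1 - ((1 - (t : ℂ) • c) * (1 - (t : ℂ) • c) + (T : ℂ) • c) =
        ((t ^ 2 : ℝ) : ℂ) • (((‖a‖ ^ 2 : ℝ) : ℂ) • c - c * c) := by
      have e1 : (1 - (t : ℂ) • c) * (1 - (t : ℂ) • c) =
          1 - (t : ℂ) • c - (t : ℂ) • c + ((t : ℂ) * t) • (c * c) := by
        rw [sub_mul, mul_sub, mul_sub, one_mul, one_mul, mul_one, smul_mul_smul_comm]
        abel
      rw [e1, hTt]
      push_cast
      module
    rw [h1]
    have h2 := sub_nonneg.mpr hcc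
    rw [Complex.coe_smul]
    exact smul_nonneg (sq_nonneg t) h2
  have hq : ‖star (y : Unitization ℂ A) * y + star ((z / (√T : ℝ)) • (1 : Unitization ℂ A)) *
      ((z / (√T : ℝ)) • (1 : Unitization ℂ A))‖ ≤ 1 + ‖z‖ ^ 2 / T := by
    refine (norm_add_le _ _).trans ?_
    rw [CStarRing.norm_star_mul_self, CStarRing.norm_star_mul_self, Unitization.norm_inr, norm_smul,
      norm_div, Complex.norm_real, Real.norm_of_nonneg (Real.sqrt_nonneg _), norm_one, mul_one,
      div_mul_div_comm, Real.mul_self_sqrt hT.le, ← sq, ← sq]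
    gcongr
    exact pow_le_one₀ (norm_nonneg _) hy
  have h := norm_mul_add_mul_le (1 - (t : ℂ) • c) (((√T : ℝ) : ℂ) • b) (y : Unitization ℂ A)
    ((z / (√T : ℝ)) • (1 : Unitization ℂ A))
  have hT0 : ((√T : ℝ) : ℂ) ≠ 0 := by
    rw [Ne, Complex.ofReal_eq_zero]; exact (Real.sqrt_pos.mpr hT).ne'
  have he : (1 - (t : ℂ) • c) * (y : Unitization ℂ A) + (((√T : ℝ) : ℂ) • b) *
      ((z / (√T : ℝ)) • (1 : Unitization ℂ A)) =
      ((y - (t : ℂ) • (a * star a * y) + z • a : A) : Unitization ℂ A) := by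
    rw [smul_mul_smul_comm, mul_one, mul_div_cancel₀ _ hT0, sub_mul, one_mul, smul_mul_assoc, hc, hb,
      ← Unitization.inr_star, ← Unitization.inr_mul, ← Unitization.inr_mul, ← Unitization.inr_smul,
      ← Unitization.inr_smul, ← Unitization.inr_sub, ← Unitization.inr_add]
  rw [he, Unitization.norm_inr] at h
  calc _ ≤ _ := h
    _ ≤ √1 * √(1 + ‖z‖ ^ 2 / T) := by gcongr
    _ = _ := by simp

theorem norm_sub_rightTranslate_add_le (ω : StrongDual ℂ A) (a : A) {t T s : ℝ} (hT : 0 < T)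
    (hTt : T = 2 * t - t ^ 2 * ‖a‖ ^ 2) (hs : 0 ≤ s) :
    ‖ω - (t : ℂ) • rightTranslate ω (a * star a)‖ + s * ‖ω a‖ ≤ ‖ω‖ * √(1 + s ^ 2 / T) := by
  set L : StrongDual ℂ A := ω - (t : ℂ) • rightTranslate ω (a * star a) with hL
  have key : ∀ y : A, ‖y‖ ≤ 1 → ‖L y‖ + s * ‖ω a‖ ≤ ‖ω‖ * √(1 + s ^ 2 / T) := by
    intro y hy
    obtain ⟨c, hc, hc'⟩ := exists_norm_add_smul_eq (L y) (s * ω a)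
    have h1 : ω (y - (t : ℂ) • (a * star a * y) + (c * s) • a) = L y + c * (s * ω a) := by
      rw [map_add, map_sub, map_smul, map_smul, hL]
      simp [rightTranslate_apply, mul_assoc]
    have h2 := norm_sub_mul_star_mul_add_le hT hTt hy (c * s)
    rw [norm_mul, hc, one_mul, Complex.norm_real, Real.norm_of_nonneg hs] at h2
    have h3 := ω.le_opNorm (y - (t : ℂ) • (a * star a * y) + (c * s) • a)
    rw [h1, hc', norm_mul, Complex.norm_real, Real.norm_of_nonneg hs] at h3
    exact h3.trans (mul_le_mul_of_nonneg_left h2 (norm_nonneg _))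
  have h0 := key 0 (by simp)
  rw [map_zero, norm_zero, zero_add] at h0
  have := ContinuousLinearMap.opNorm_le_of_unit_norm (f := L) (sub_nonneg.mpr h0) fun y hy => by
    have := key y hy.le
    linarith
  linarith

theorem norm_add_smul_rightTranslate_le (ω : StrongDual ℂ A) {h : A} (hh : star h = h) (t : ℝ) :
    ‖ω + (Complex.I * t) • rightTranslate ω h‖ ≤ ‖ω‖ * √(1 + t ^ 2 * ‖h‖ ^ 2) := by
  refine ContinuousLinearMap.opNorm_le_of_unit_norm (by positivity) fun y hy => ?_
  have h1 : (ω + (Complex.I * t) • rightTranslate ω h) y = ω (y + (Complex.I * t) • (h * y)) := by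
    rw [map_add, map_smul]; rfl
  rw [h1]
  exact (ω.le_opNorm _).trans
    (mul_le_mul_of_nonneg_left (norm_add_smul_mul_le hh t hy.le) (norm_nonneg _))

variable {ω : StrongDual ℂ A} {x : Bidual A}

theorem bidualActLeft_im_eq_zero (hx : ‖x‖ ≤ 1) (hxω : x ω = ‖ω‖) {h : A} (hh : star h = h) :
    (bidualActLeft x ω h).im = 0 := by
  set c := (bidualActLeft x ω h).im with hc
  set k := ‖ω‖ * ‖h‖ ^ 2 / 2 with hk
  have hk0 : 0 ≤ k := by positivity
  have key : ∀ t : ℝ, -(t * c) ≤ k * t ^ 2 := by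
    intro t
    have h1 : x (ω + (Complex.I * t) • rightTranslate ω h) =
        ‖ω‖ + Complex.I * t * bidualActLeft x ω h := by
      rw [map_add, map_smul, hxω, bidualActLeft_apply, smul_eq_mul]
    have h2 : (x (ω + (Complex.I * t) • rightTranslate ω h)).re = ‖ω‖ - t * c := by
      rw [h1, hc]; simp [sub_eq_add_neg]
    have h3 := (Complex.re_le_norm _).trans ((x.le_opNorm (ω + (Complex.I * t) • rightTranslate ω h)).trans
      (mul_le_of_le_one_left (norm_nonneg _) hx))
    rw [h2] at h3
    have h4 := h3.trans (norm_add_smul_rightTranslate_le ω hh t)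
    have h5 : √(1 + t ^ 2 * ‖h‖ ^ 2) ≤ 1 + t ^ 2 * ‖h‖ ^ 2 / 2 :=
      Real.sqrt_one_add_le (by nlinarith [sq_nonneg (t * ‖h‖)])
    have h6 := h4.trans (mul_le_mul_of_nonneg_left h5 (norm_nonneg ω))
    rw [hk]
    linarith
  have h1 := key (-c / (k + 1))
  have h2 : k * (-c / (k + 1)) ^ 2 = c ^ 2 * k / (k + 1) ^ 2 := by rw [div_pow, neg_sq]; ring
  have h3 : -(-c / (k + 1) * c) = c ^ 2 * (k + 1) / (k + 1) ^ 2 := by field_simp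
  rw [h2, h3, div_le_div_iff_of_pos_right (by positivity)] at h1
  have : c ^ 2 ≤ 0 := by linarith
  exact pow_eq_zero_iff two_ne_zero |>.mp (le_antisymm this (sq_nonneg _))

theorem norm_apply_sq_le_bidualActLeft (hx : ‖x‖ ≤ 1) (hxω : x ω = ‖ω‖) (a : A) :
    ‖ω a‖ ^ 2 ≤ ‖ω‖ * (bidualActLeft x ω (a * star a)).re := by
  set P := (bidualActLeft x ω (a * star a)).re with hP
  set W := ‖ω a‖ with hW
  have h0 : ∀ r t : ℝ, 0 ≤ r → 0 < t → 0 < 2 - t * ‖a‖ ^ 2 →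
      r * W ≤ P + ‖ω‖ * (r ^ 2 / (2 * (2 - t * ‖a‖ ^ 2))) := by
    intro r t hr ht hT
    have h1 := norm_sub_rightTranslate_add_le ω a (T := t * (2 - t * ‖a‖ ^ 2)) (s := r * t) (t := t)
      (by positivity) (by ring) (by positivity)
    have h2 : (x (ω - (t : ℂ) • rightTranslate ω (a * star a))).re = ‖ω‖ - t * P := by
      rw [map_sub, map_smul, hxω, hP, bidualActLeft_apply, smul_eq_mul]
      simp
    have h3 := (Complex.re_le_norm _).trans ((x.le_opNorm (ω - (t : ℂ) • rightTranslate ω (a * star a))).trans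
      (mul_le_of_le_one_left (norm_nonneg _) hx))
    rw [h2] at h3
    have h5 : √(1 + (r * t) ^ 2 / (t * (2 - t * ‖a‖ ^ 2))) ≤
        1 + (r * t) ^ 2 / (t * (2 - t * ‖a‖ ^ 2)) / 2 :=
      Real.sqrt_one_add_le (le_trans (by norm_num) (by positivity : (0 : ℝ) ≤ _))
    have h6 := h1.trans (mul_le_mul_of_nonneg_left h5 (norm_nonneg ω))
    have h7 : (r * t) ^ 2 / (t * (2 - t * ‖a‖ ^ 2)) / 2 = t * (r ^ 2 / (2 * (2 - t * ‖a‖ ^ 2))) := by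
      field_simp
    rw [h7] at h6
    have h8 : t * (r * W) ≤ t * (P + ‖ω‖ * (r ^ 2 / (2 * (2 - t * ‖a‖ ^ 2)))) := by
      linarith
    exact le_of_mul_le_mul_left h8 ht
  have h1 : ∀ r : ℝ, 0 ≤ r → r * W ≤ P + ‖ω‖ * (r ^ 2 / 4) := by
    intro r hr
    have hc : Tendsto (fun t : ℝ => P + ‖ω‖ * (r ^ 2 / (2 * (2 - t * ‖a‖ ^ 2)))) (𝓝[>] 0)
        (𝓝 (P + ‖ω‖ * (r ^ 2 / (2 * (2 - 0 * ‖a‖ ^ 2))))) := by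
      refine Tendsto.mono_left (ContinuousAt.tendsto ?_) nhdsWithin_le_nhds
      have : (2 : ℝ) * (2 - 0 * ‖a‖ ^ 2) ≠ 0 := by norm_num
      fun_prop (disch := assumption)
    have h2 : P + ‖ω‖ * (r ^ 2 / (2 * (2 - 0 * ‖a‖ ^ 2))) = P + ‖ω‖ * (r ^ 2 / 4) := by norm_num
    rw [h2] at hc
    refine ge_of_tendsto hc ?_
    have hpos : ∀ᶠ t : ℝ in 𝓝[>] 0, 0 < 2 - t * ‖a‖ ^ 2 := by
      have hcont : Continuous fun t : ℝ => 2 - t * ‖a‖ ^ 2 := by fun_prop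
      exact nhdsWithin_le_nhds (hcont.continuousAt.eventually (lt_mem_nhds (by norm_num)))
    filter_upwards [hpos, self_mem_nhdsWithin] with t ht ht0
    exact h0 r t hr ht0 ht
  rcases (norm_nonneg ω).eq_or_lt with hω | hω
  · have : ω = 0 := norm_eq_zero.mp hω.symm
    simp [hW, this]
  · have h2 := h1 (2 * W / ‖ω‖) (by positivity)
    have h3 : ‖ω‖ * ((2 * W / ‖ω‖) ^ 2 / 4) = W ^ 2 / ‖ω‖ := by field_simp; ring
    have h4 : 2 * W / ‖ω‖ * W = W ^ 2 / ‖ω‖ + W ^ 2 / ‖ω‖ := by field_simp; ring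
    rw [h3, h4] at h2
    have h5 : W ^ 2 / ‖ω‖ ≤ P := by linarith
    rw [div_le_iff₀ hω] at h5
    linarith

theorem isPositiveFunctional_bidualActLeft (hx : ‖x‖ ≤ 1) (hxω : x ω = ‖ω‖) :
    IsPositiveFunctional (bidualActLeft x ω) := by
  intro a
  have h1 := norm_apply_sq_le_bidualActLeft hx hxω (star a)
  rw [star_star] at h1
  have h2 := bidualActLeft_im_eq_zero hx hxω (h := star a * a) (by simp)
  rw [Complex.nonneg_iff]
  refine ⟨?_, h2.symm⟩
  rcases (norm_nonneg ω).eq_or_lt with hω | hω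
  · have : ω = 0 := norm_eq_zero.mp hω.symm
    simp [this]
  · by_contra hlt
    push Not at hlt
    nlinarith [sq_nonneg ‖ω (star a)‖]

theorem norm_bidualActLeft_le (x : Bidual A) (ω : StrongDual ℂ A) :
    ‖bidualActLeft x ω‖ ≤ ‖x‖ * ‖ω‖ := by
  refine ContinuousLinearMap.opNorm_le_bound _ (by positivity) fun a => ?_
  rw [bidualActLeft_apply]
  refine (x.le_opNorm _).trans ?_
  rw [mul_assoc]
  gcongr
  refine ContinuousLinearMap.opNorm_le_bound _ (by positivity) fun b => ?_
  rw [rightTranslate_apply, mul_assoc]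
  refine (ω.le_opNorm _).trans ?_
  gcongr
  exact norm_mul_le _ _

end Domination

section Representation

variable {A : Type*} [NonUnitalCStarAlgebra A]
  {K : Type*} [NormedAddCommGroup K] [InnerProductSpace ℂ K] [CompleteSpace K]
  {L : Type*} [NormedAddCommGroup L] [InnerProductSpace ℂ L] [CompleteSpace L]
  (π : A →⋆ₙₐ[ℂ] (K →L[ℂ] K)) (ρ : A →⋆ₙₐ[ℂ] (L →L[ℂ] L))

theorem norm_rep_apply_le (a : A) (β : K) : ‖π a β‖ ≤ ‖a‖ * ‖β‖ :=
  ((π a).le_opNorm β).trans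
    (mul_le_mul_of_nonneg_right (NonUnitalStarAlgHom.norm_apply_le π a) (norm_nonneg β))

theorem inner_rep_star_left (a : A) (α β : K) : ⟪π (star a) α, β⟫_ℂ = ⟪α, π a β⟫_ℂ := by
  rw [map_star, ContinuousLinearMap.star_eq_adjoint, ContinuousLinearMap.adjoint_inner_left]

theorem inner_rep_left (a : A) (α β : K) : ⟪π a α, β⟫_ℂ = ⟪α, π (star a) β⟫_ℂ := by
  rw [← inner_rep_star_left, star_star]

/-- The coefficient functional `a ↦ ⟪α, π a β⟫` of a representation. -/
def coeffFunctional (α β : K) : StrongDual ℂ A :=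
  LinearMap.mkContinuous
    { toFun := fun a => ⟪α, π a β⟫_ℂ
      map_add' := fun a b => by simp
      map_smul' := fun c a => by simp } (‖α‖ * ‖β‖) fun a => by
    refine (norm_inner_le_norm (𝕜 := ℂ) α (π a β)).trans ?_
    rw [mul_assoc, mul_comm ‖β‖]
    exact mul_le_mul_of_nonneg_left (norm_rep_apply_le π a β) (norm_nonneg α)

theorem coeffFunctional_apply (α β : K) (a : A) : coeffFunctional π α β a = ⟪α, π a β⟫_ℂ := rfl

theorem norm_coeffFunctional_le (α β : K) : ‖coeffFunctional π α β‖ ≤ ‖α‖ * ‖β‖ :=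
  LinearMap.mkContinuous_norm_le _ (by positivity) _

theorem conjFunctional_coeffFunctional (α β : K) :
    conjFunctional (coeffFunctional π α β) = coeffFunctional π β α := by
  ext a
  rw [conjFunctional_apply, coeffFunctional_apply, coeffFunctional_apply, Complex.star_def,
    inner_conj_symm, inner_rep_star_left]

theorem leftTranslate_coeffFunctional (α β : K) (a : A) :
    leftTranslate (coeffFunctional π α β) a = coeffFunctional π α (π a β) := by
  ext b
  rw [leftTranslate_apply, coeffFunctional_apply, coeffFunctional_apply, map_mul]
  rfl

theorem rightTranslate_coeffFunctional (α β : K) (a : A) :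
    rightTranslate (coeffFunctional π α β) a = coeffFunctional π (π (star a) α) β := by
  ext b
  rw [rightTranslate_apply, coeffFunctional_apply, coeffFunctional_apply, map_mul,
    inner_rep_star_left]
  rfl

/-- The extension of a representation of `A` to its bidual. -/
def bidualRep (x : Bidual A) : K →L[ℂ] K :=
  ContinuousLinearMap.adjoint (InnerProductSpace.continuousLinearMapOfBilin (𝕜 := ℂ)
    (LinearMap.mkContinuous₂ (LinearMap.mk₂'ₛₗ (starRingEnd ℂ) (RingHom.id ℂ)
      (fun α β => x (coeffFunctional π α β))
      (fun α α' β => by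
        rw [← map_add]; congr 1; ext a; simp [coeffFunctional_apply])
      (fun c α β => by
        rw [smul_eq_mul, ← smul_eq_mul, ← map_smul]; congr 1; ext a
        simp [coeffFunctional_apply, mul_comm])
      (fun α β β' => by
        rw [← map_add]; congr 1; ext a; simp [coeffFunctional_apply])
      (fun c α β => by
        rw [RingHom.id_apply, ← map_smul]; congr 1; ext a
        simp [coeffFunctional_apply])) ‖x‖ (fun α β => by
        rw [mul_assoc]
        exact (x.le_opNorm _).trans (mul_le_mul_of_nonneg_left (norm_coeffFunctional_le π α β)
          (norm_nonneg x)))))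

theorem inner_bidualRep (x : Bidual A) (α β : K) :
    ⟪α, bidualRep π x β⟫_ℂ = x (coeffFunctional π α β) := by
  rw [bidualRep, ContinuousLinearMap.adjoint_inner_right,
    InnerProductSpace.continuousLinearMapOfBilin_apply]
  rfl

theorem norm_bidualRep_apply_le (x : Bidual A) (β : K) : ‖bidualRep π x β‖ ≤ ‖x‖ * ‖β‖ := by
  by_cases h : ‖bidualRep π x β‖ = 0
  · rw [h]; positivity
  have h0 : 0 < ‖bidualRep π x β‖ := lt_of_le_of_ne (norm_nonneg _) (Ne.symm h)
  have h1 : ‖bidualRep π x β‖ * ‖bidualRep π x β‖ ≤ ‖bidualRep π x β‖ * (‖x‖ * ‖β‖) := by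
    have h2 : ‖⟪bidualRep π x β, bidualRep π x β⟫_ℂ‖ = ‖bidualRep π x β‖ * ‖bidualRep π x β‖ := by
      rw [inner_self_eq_norm_sq_to_K]
      simp [sq]
    rw [← h2, inner_bidualRep]
    refine (x.le_opNorm _).trans ?_
    calc _ ≤ ‖x‖ * (‖bidualRep π x β‖ * ‖β‖) := by gcongr; exact norm_coeffFunctional_le π _ _
      _ = _ := by ring
  exact le_of_mul_le_mul_left h1 h0

theorem bidualActLeft_coeffFunctional (x : Bidual A) (α β : K) :
    bidualActLeft x (coeffFunctional π α β) = coeffFunctional π α (bidualRep π x β) := by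
  ext a
  rw [bidualActLeft_apply, rightTranslate_coeffFunctional, ← inner_bidualRep,
    coeffFunctional_apply, inner_rep_star_left]

theorem bidualMul_coeffFunctional (x y : Bidual A) (α β : K) :
    bidualMul x y (coeffFunctional π α β) = ⟪α, bidualRep π x (bidualRep π y β)⟫_ℂ := by
  rw [inner_bidualRep, ← bidualActLeft_coeffFunctional]
  rfl

theorem bidualRep_bidualMul (x y : Bidual A) :
    bidualRep π (bidualMul x y) = bidualRep π x * bidualRep π y := by
  refine ContinuousLinearMap.ext fun β => ext_inner_left ℂ fun α => ?_
  rw [inner_bidualRep, bidualMul_coeffFunctional]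
  rfl

theorem bidualRep_bidualStar (x : Bidual A) :
    bidualRep π (bidualStar x) = star (bidualRep π x) := by
  refine ContinuousLinearMap.ext fun β => ext_inner_left ℂ fun α => ?_
  rw [inner_bidualRep, ContinuousLinearMap.star_eq_adjoint,
    ContinuousLinearMap.adjoint_inner_right, ← inner_conj_symm, inner_bidualRep]
  change star (x (conjFunctional (coeffFunctional π α β))) = _
  rw [conjFunctional_coeffFunctional]
  rfl

theorem bidualActRight_coeffFunctional (x : Bidual A) (α β : K) :
    bidualActRight x (coeffFunctional π α β) =
      coeffFunctional π (star (bidualRep π x) α) β := by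
  ext a
  rw [bidualActRight_apply, leftTranslate_coeffFunctional, ← inner_bidualRep,
    coeffFunctional_apply, ContinuousLinearMap.star_eq_adjoint,
    ContinuousLinearMap.adjoint_inner_left]

/-- Intertwiners of representations. -/
def IsIntertwiner (T : K →L[ℂ] L) : Prop := ∀ a β, T (π a β) = ρ a (T β)

variable {π ρ}

theorem IsIntertwiner.adjoint {T : K →L[ℂ] L} (hT : IsIntertwiner π ρ T) :
    IsIntertwiner ρ π (ContinuousLinearMap.adjoint T) := by
  intro a β
  refine ext_inner_left ℂ fun α => ?_
  rw [ContinuousLinearMap.adjoint_inner_right, ← inner_rep_star_left, ← hT,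
    ← inner_rep_star_left π, ContinuousLinearMap.adjoint_inner_right]

theorem IsIntertwiner.comp {M : Type*} [NormedAddCommGroup M] [InnerProductSpace ℂ M]
    [CompleteSpace M] {σ : A →⋆ₙₐ[ℂ] (M →L[ℂ] M)} {S : L →L[ℂ] M} {T : K →L[ℂ] L}
    (hS : IsIntertwiner ρ σ S) (hT : IsIntertwiner π ρ T) : IsIntertwiner π σ (S ∘L T) := by
  intro a β
  rw [ContinuousLinearMap.comp_apply, hT, hS]
  rfl

theorem IsIntertwiner.bidualRep {T : K →L[ℂ] L} (hT : IsIntertwiner π ρ T) (x : Bidual A) (β : K) :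
    T (bidualRep π x β) = bidualRep ρ x (T β) := by
  refine ext_inner_left ℂ fun α => ?_
  rw [inner_bidualRep, ← ContinuousLinearMap.adjoint_inner_left, inner_bidualRep]
  congr 1
  ext a
  rw [coeffFunctional_apply, coeffFunctional_apply, ← hT, ContinuousLinearMap.adjoint_inner_left]

end Representation

section GNS

/-- A representation with a cyclic vector. -/
structure CyclicRep (A : Type u) [NonUnitalCStarAlgebra A] where
  space : Type u
  [normed : NormedAddCommGroup space]
  [innerProduct : InnerProductSpace ℂ space]
  [complete : CompleteSpace space]
  rep : A →⋆ₙₐ[ℂ] (space →L[ℂ] space)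
  vec : space
  cyclic : DenseRange fun a => rep a vec

attribute [instance] CyclicRep.normed CyclicRep.innerProduct CyclicRep.complete

theorem exists_inner_of_norm_sq_le {V K : Type*} [AddCommGroup V] [Module ℂ V]
    [NormedAddCommGroup K] [InnerProductSpace ℂ K] [CompleteSpace K] (J : V →ₗ[ℂ] K)
    (hJ : DenseRange J) (ℓ : V →ₗ[ℂ] ℂ) {C : ℝ} (hC : 0 ≤ C)
    (h : ∀ a, ‖ℓ a‖ ^ 2 ≤ C * ‖J a‖ ^ 2) :
    ∃ η : K, ‖η‖ ^ 2 ≤ C ∧ ∀ a, ℓ a = ⟪η, J a⟫_ℂ := by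
  have h' : ∀ a, ‖ℓ a‖ ≤ √C * ‖J a‖ := by
    intro a
    refine le_of_sq_le_sq ?_ (by positivity)
    rw [mul_pow, Real.sq_sqrt hC]
    exact h a
  have hle : ‖ℓ.extendOfNorm J‖ ≤ √C :=
    ContinuousLinearMap.opNorm_le_bound _ (by positivity)
      fun x => LinearMap.norm_extendOfNorm_apply_le hJ _ h' x
  refine ⟨(InnerProductSpace.toDual ℂ K).symm (ℓ.extendOfNorm J), ?_, fun a => ?_⟩
  · rw [LinearIsometryEquiv.norm_map, ← Real.sq_sqrt hC]
    gcongr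
  · rw [InnerProductSpace.toDual_symm_apply, LinearMap.extendOfNorm_eq hJ ⟨_, h'⟩]

theorem norm_apply_star_mul_sq_le {A : Type*} [NonUnitalCStarAlgebra A] (φ : StrongDual ℂ A)
    {K : Type*} [SeminormedAddCommGroup K] [InnerProductSpace ℂ K] (J : A →ₗ[ℂ] K)
    (hJ : ∀ a b, ⟪J a, J b⟫_ℂ = φ (star a * b)) (a : A) : ‖φ a‖ ^ 2 ≤ ‖φ‖ * ‖J a‖ ^ 2 := by
  have hlim : Tendsto (fun e => ‖φ (e * a)‖ ^ 2) (approxUnit A) (𝓝 (‖φ a‖ ^ 2)) :=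
    ((φ.continuous.norm.pow 2).tendsto a).comp (tendsto_approxUnit_mul a)
  refine le_of_tendsto hlim ?_
  filter_upwards [eventually_approxUnit_star_eq, eventually_approxUnit_norm_le] with e he he1
  have h1 := norm_inner_le_norm (𝕜 := ℂ) (J e) (J a)
  rw [hJ, he] at h1
  have h2 : ‖J e‖ ^ 2 ≤ ‖φ‖ := by
    have h3 : ((‖J e‖ ^ 2 : ℝ) : ℂ) = φ (star e * e) := by
      rw [← hJ, inner_self_eq_norm_sq_to_K]; simp
    have h4 : ‖J e‖ ^ 2 = ‖φ (star e * e)‖ := by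
      rw [← h3, Complex.norm_real, Real.norm_of_nonneg (by positivity)]
    rw [h4]
    refine (φ.le_opNorm _).trans (mul_le_of_le_one_right (norm_nonneg _) ?_)
    rw [CStarRing.norm_star_mul_self]
    exact mul_le_one₀ he1 (norm_nonneg _) he1
  calc ‖φ (e * a)‖ ^ 2 ≤ (‖J e‖ * ‖J a‖) ^ 2 := by gcongr
    _ = ‖J e‖ ^ 2 * ‖J a‖ ^ 2 := by ring
    _ ≤ _ := by gcongr

/-- The GNS construction for a positive functional on a C*-algebra. -/
theorem exists_cyclicRep {A : Type u} [NonUnitalCStarAlgebra A] {φ : StrongDual ℂ A}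
    (hφ : IsPositiveFunctional φ) :
    ∃ R : CyclicRep A, φ = coeffFunctional R.rep R.vec R.vec ∧ ‖R.vec‖ ^ 2 ≤ ‖φ‖ := by
  let _ := CStarAlgebra.spectralOrder A
  let _ := CStarAlgebra.spectralOrderedRing A
  let f : A →ₚ[ℂ] ℂ := PositiveLinearMap.mk₀ φ.toLinearMap fun a ha => by
    obtain ⟨s, rfl⟩ := CStarAlgebra.nonneg_iff_eq_star_mul_self.mp ha
    exact hφ s
  have hf : ∀ a, f a = φ a := fun a => rfl
  let J : A →ₗ[ℂ] f.GNS :=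
    (UniformSpace.Completion.toComplₗᵢ (𝕜 := ℂ) (E := f.PreGNS)).toLinearMap ∘ₗ
      f.toPreGNS.toLinearMap
  have hJ : ∀ a b, ⟪J a, J b⟫_ℂ = φ (star a * b) := by
    intro a b
    change ⟪((f.toPreGNS a : f.PreGNS) : f.GNS), ((f.toPreGNS b : f.PreGNS) : f.GNS)⟫_ℂ = _
    rw [UniformSpace.Completion.inner_coe, PositiveLinearMap.preGNS_inner_def]
    rfl
  have hπ : ∀ a b, f.gnsNonUnitalStarAlgHom a (J b) = J (a * b) := by
    intro a b
    change f.gnsNonUnitalStarAlgHom a ((f.toPreGNS b : f.PreGNS) : f.GNS) = _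
    rw [PositiveLinearMap.gnsNonUnitalStarAlgHom_apply_coe]
    rfl
  have hd : DenseRange J := by
    have h := UniformSpace.Completion.denseRange_coe (α := f.PreGNS)
    exact h.comp f.toPreGNS.surjective.denseRange (UniformSpace.Completion.continuous_coe _)
  obtain ⟨ξ, hξ, hξ'⟩ := exists_inner_of_norm_sq_le J hd φ.toLinearMap (norm_nonneg φ)
    (norm_apply_star_mul_sq_le φ J hJ)
  have hvec : ∀ a, f.gnsNonUnitalStarAlgHom a ξ = J a := by
    intro a
    refine hd.eq_of_inner_left ℂ ?_
    intro b
    rw [inner_rep_left, hπ, ← hξ', hJ]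
    rfl
  refine ⟨{ space := f.GNS, rep := f.gnsNonUnitalStarAlgHom, vec := ξ, cyclic := ?_ }, ?_, hξ⟩
  · simpa only [hvec] using hd
  · ext a
    rw [coeffFunctional_apply]
    change φ a = ⟪ξ, f.gnsNonUnitalStarAlgHom a ξ⟫_ℂ
    rw [hvec]
    exact hξ' a

end GNS

section Support

variable {A : Type u} [NonUnitalCStarAlgebra A]

theorem map_starProjection_of_mapsTo {K L : Type*} [NormedAddCommGroup K] [InnerProductSpace ℂ K]
    [CompleteSpace K] [NormedAddCommGroup L] [InnerProductSpace ℂ L] [CompleteSpace L]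
    (S : K →L[ℂ] L) (U : Submodule ℂ K) (V : Submodule ℂ L) [U.HasOrthogonalProjection]
    [V.HasOrthogonalProjection] (h : ∀ x ∈ U, S x ∈ V)
    (h' : ∀ y ∈ V, ContinuousLinearMap.adjoint S y ∈ U) (β : K) :
    S (U.starProjection β) = V.starProjection (S β) := by
  refine (Submodule.eq_starProjection_of_mem_of_inner_eq_zero
    (h _ (U.starProjection_apply_mem β)) fun w hw => ?_).symm
  rw [← map_sub, ← ContinuousLinearMap.adjoint_inner_right]
  exact U.starProjection_inner_eq_zero β _ (h' w hw)

variable (R : CyclicRep A)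
  {K : Type*} [NormedAddCommGroup K] [InnerProductSpace ℂ K] [CompleteSpace K]
  {L : Type*} [NormedAddCommGroup L] [InnerProductSpace ℂ L] [CompleteSpace L]
  (π : A →⋆ₙₐ[ℂ] (K →L[ℂ] K)) (ρ : A →⋆ₙₐ[ℂ] (L →L[ℂ] L))

/-- The closed subspace generated by the images of the cyclic vector under intertwiners. -/
def supportSpace : Submodule ℂ K :=
  (Submodule.span ℂ {β | ∃ T, IsIntertwiner R.rep π T ∧ β = T R.vec}).topologicalClosure

instance : CompleteSpace (supportSpace R π) :=
  (Submodule.isClosed_topologicalClosure _).completeSpace_coe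

/-- The support projection of the vector functional of `R`, in the representation `π`. -/
def supportOp : K →L[ℂ] K := (supportSpace R π).starProjection

variable {R π ρ}

theorem intertwiner_vec_mem_supportSpace {T : R.space →L[ℂ] K} (hT : IsIntertwiner R.rep π T) :
    T R.vec ∈ supportSpace R π :=
  subset_closure (Submodule.subset_span ⟨T, hT, rfl⟩)

theorem supportSpace_induction {N : Type*} [NormedAddCommGroup N] [InnerProductSpace ℂ N]
    {S : K →L[ℂ] N} {V : Submodule ℂ N}
    (hV : IsClosed (V : Set N)) (h : ∀ T, IsIntertwiner R.rep π T → S (T R.vec) ∈ V) :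
    ∀ x ∈ supportSpace R π, S x ∈ V := by
  have h1 : supportSpace R π ≤ V.comap S.toLinearMap := by
    refine Submodule.topologicalClosure_minimal _ (Submodule.span_le.mpr ?_)
      (hV.preimage S.continuous)
    rintro _ ⟨T, hT, rfl⟩
    exact h T hT
  exact h1

theorem isIntertwiner_mapsTo_supportSpace {S : K →L[ℂ] L} (hS : IsIntertwiner π ρ S) :
    ∀ x ∈ supportSpace R π, S x ∈ supportSpace R ρ :=
  supportSpace_induction (Submodule.isClosed_topologicalClosure _) fun _ hT =>
    intertwiner_vec_mem_supportSpace (hS.comp hT)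

theorem IsIntertwiner.supportOp {S : K →L[ℂ] L} (hS : IsIntertwiner π ρ S) (β : K) :
    S (supportOp R π β) = supportOp R ρ (S β) :=
  map_starProjection_of_mapsTo S _ _ (isIntertwiner_mapsTo_supportSpace hS)
    (isIntertwiner_mapsTo_supportSpace hS.adjoint) β

theorem supportOp_vec : supportOp R R.rep R.vec = R.vec := by
  refine Submodule.starProjection_eq_self_iff.mpr ?_
  exact intertwiner_vec_mem_supportSpace (T := ContinuousLinearMap.id ℂ R.space) fun _ _ => rfl

theorem supportOp_supportOp (β : K) : supportOp R π (supportOp R π β) = supportOp R π β :=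
  Submodule.starProjection_eq_self_iff.mpr (Submodule.starProjection_apply_mem _ _)

theorem inner_supportOp (α β : K) : ⟪α, supportOp R π β⟫_ℂ = ⟪supportOp R π α, β⟫_ℂ :=
  (Submodule.inner_starProjection_left_eq_right _ α β).symm

/-- A natural operator fixing the cyclic vector fixes the support. -/
theorem apply_supportOp_of_fixed {x : Bidual A} (hx : bidualRep R.rep x R.vec = R.vec) (β : K) :
    bidualRep π x (supportOp R π β) = supportOp R π β := by
  have h : ∀ y ∈ supportSpace R π,
      (bidualRep π x - ContinuousLinearMap.id ℂ K) y ∈ (⊥ : Submodule ℂ K) := by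
    refine supportSpace_induction (by simp) fun T hT => ?_
    rw [Submodule.mem_bot]
    change bidualRep π x (T R.vec) - T R.vec = 0
    rw [← hT.bidualRep, hx, sub_self]
  have h1 := h _ (Submodule.starProjection_apply_mem _ β)
  rw [Submodule.mem_bot] at h1
  exact sub_eq_zero.mp h1

theorem CyclicRep.eq_zero_of_forall (R : CyclicRep A) {β : R.space} (h : ∀ a, R.rep a β = 0) :
    β = 0 := by
  refine R.cyclic.eq_zero_of_inner_left ℂ fun a => ?_
  rw [← inner_rep_star_left, h, inner_zero_left]

theorem exists_intertwiner (R : CyclicRep A) {π : A →⋆ₙₐ[ℂ] (K →L[ℂ] K)}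
    (hπ : ∀ β, (∀ a, π a β = 0) → β = 0) {α : K} (h : ∀ a, ‖π a α‖ ≤ ‖R.rep a R.vec‖) :
    ∃ T, IsIntertwiner R.rep π T ∧ T R.vec = α := by
  let f : A →ₗ[ℂ] K :=
    { toFun := fun a => π a α, map_add' := fun a b => by simp, map_smul' := fun c a => by simp }
  let e : A →ₗ[ℂ] R.space :=
    { toFun := fun a => R.rep a R.vec, map_add' := fun a b => by simp
      map_smul' := fun c a => by simp }
  have he : DenseRange e := R.cyclic
  have hT : ∀ a, f.extendOfNorm e (R.rep a R.vec) = π a α := fun a =>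
    LinearMap.extendOfNorm_eq (f := f) (e := e) he ⟨1, fun x => by rw [one_mul]; exact h x⟩ a
  have hint : IsIntertwiner R.rep π (f.extendOfNorm e) := by
    intro a β
    refine R.cyclic.induction_on (p := fun β => f.extendOfNorm e (R.rep a β) =
      π a (f.extendOfNorm e β)) β (isClosed_eq (by fun_prop) (by fun_prop)) fun b => ?_
    have h1 : R.rep a (R.rep b R.vec) = R.rep (a * b) R.vec := by rw [map_mul]; rfl
    rw [h1, hT, hT, map_mul]
    rfl
  refine ⟨_, hint, sub_eq_zero.mp (hπ _ fun a => ?_)⟩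
  rw [map_sub, ← hint, hT, sub_self]

theorem re_coeffFunctional_self (π : A →⋆ₙₐ[ℂ] (K →L[ℂ] K)) (α : K) (a : A) :
    coeffFunctional π α α (star a * a) = (‖π a α‖ ^ 2 : ℝ) := by
  rw [coeffFunctional_apply, inner_star_mul_self_apply]
  push_cast
  rfl

theorem isPositiveFunctional_coeffFunctional (π : A →⋆ₙₐ[ℂ] (K →L[ℂ] K)) (α : K) :
    IsPositiveFunctional (coeffFunctional π α α) := by
  intro a
  rw [re_coeffFunctional_self, Complex.zero_le_real]
  positivity

theorem inner_supportOp_add (S₁ S₂ S₃ : CyclicRep A) (c : ℂ) (α₁ β₁ : S₁.space) (α₂ β₂ : S₂.space)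
    (α₃ β₃ : S₃.space) (h : coeffFunctional S₁.rep α₁ β₁ + c • coeffFunctional S₂.rep α₂ β₂ =
      coeffFunctional S₃.rep α₃ β₃) :
    ⟪α₁, supportOp R S₁.rep β₁⟫_ℂ + c * ⟪α₂, supportOp R S₂.rep β₂⟫_ℂ =
      ⟪α₃, supportOp R S₃.rep β₃⟫_ℂ := by
  obtain ⟨S, hS, -⟩ := exists_cyclicRep (φ := coeffFunctional S₁.rep α₁ α₁ +
      coeffFunctional S₂.rep α₂ α₂ + coeffFunctional S₃.rep α₃ α₃) fun a =>
    add_nonneg (add_nonneg (isPositiveFunctional_coeffFunctional _ _ a)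
      (isPositiveFunctional_coeffFunctional _ _ a)) (isPositiveFunctional_coeffFunctional _ _ a)
  have hsum : ∀ a, ‖S₁.rep a α₁‖ ^ 2 + ‖S₂.rep a α₂‖ ^ 2 + ‖S₃.rep a α₃‖ ^ 2 =
      ‖S.rep a S.vec‖ ^ 2 := by
    intro a
    have := congrArg (fun F => F (star a * a)) hS
    simp only [_root_.add_apply, re_coeffFunctional_self] at this
    exact_mod_cast this
  have key : ∀ (S' : CyclicRep A) (α' β' : S'.space), (∀ a, ‖S'.rep a α'‖ ≤ ‖S.rep a S.vec‖) →
      ∃ β : S.space, coeffFunctional S'.rep α' β' = coeffFunctional S.rep S.vec β ∧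
        ⟪α', supportOp R S'.rep β'⟫_ℂ = ⟪S.vec, supportOp R S.rep β⟫_ℂ := by
    intro S' α' β' h'
    obtain ⟨T, hT, rfl⟩ := exists_intertwiner S (fun _ => S'.eq_zero_of_forall) h'
    refine ⟨ContinuousLinearMap.adjoint T β', ?_, ?_⟩
    · ext a
      rw [coeffFunctional_apply, coeffFunctional_apply, ← hT.adjoint,
        ContinuousLinearMap.adjoint_inner_right]
    · rw [← hT.adjoint.supportOp, ContinuousLinearMap.adjoint_inner_right]
  obtain ⟨γ₁, h1, h1'⟩ := key S₁ α₁ β₁ fun a => le_of_sq_le_sq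
    (by nlinarith [hsum a, sq_nonneg ‖S₂.rep a α₂‖, sq_nonneg ‖S₃.rep a α₃‖]) (norm_nonneg _)
  obtain ⟨γ₂, h2, h2'⟩ := key S₂ α₂ β₂ fun a => le_of_sq_le_sq
    (by nlinarith [hsum a, sq_nonneg ‖S₁.rep a α₁‖, sq_nonneg ‖S₃.rep a α₃‖]) (norm_nonneg _)
  obtain ⟨γ₃, h3, h3'⟩ := key S₃ α₃ β₃ fun a => le_of_sq_le_sq
    (by nlinarith [hsum a, sq_nonneg ‖S₂.rep a α₂‖, sq_nonneg ‖S₁.rep a α₁‖]) (norm_nonneg _)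
  rw [h1, h2, h3] at h
  have hγ : γ₁ + c • γ₂ = γ₃ := by
    refine S.cyclic.eq_of_inner_left ℂ fun a => ?_
    have := congrArg (fun F => F (star a)) h
    simp only [_root_.add_apply, _root_.smul_apply, coeffFunctional_apply] at this
    rw [← inner_conj_symm, ← inner_conj_symm γ₃]
    congr 1
    rw [inner_rep_left, inner_rep_left, map_add, map_smul, inner_add_right, inner_smul_right]
    exact this
  rw [h1', h2', h3', ← hγ, map_add, map_smul, inner_add_right, inner_smul_right]

end Support

section Polar

variable {A : Type u} [NonUnitalCStarAlgebra A]

theorem exists_cyclicRep_coeff (ω : StrongDual ℂ A) : ∃ (x : Bidual A) (R : CyclicRep A)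
    (η : R.space), ‖x‖ ≤ 1 ∧ x ω = ‖ω‖ ∧ bidualActLeft x ω = coeffFunctional R.rep R.vec R.vec ∧
      ω = coeffFunctional R.rep R.vec η ∧ ‖R.vec‖ ^ 2 ≤ ‖ω‖ ∧ ‖η‖ ^ 2 ≤ ‖ω‖ := by
  obtain ⟨x, hx, hxω⟩ := exists_dual_vector'' ℂ ω
  obtain ⟨R, hR, hv⟩ := exists_cyclicRep (isPositiveFunctional_bidualActLeft hx hxω)
  have hv' : ‖R.vec‖ ^ 2 ≤ ‖ω‖ := (hv.trans (norm_bidualActLeft_le x ω)).trans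
    (mul_le_of_le_one_left (norm_nonneg _) hx)
  let J : A →ₗ[ℂ] R.space :=
    { toFun := fun a => R.rep a R.vec, map_add' := fun a b => by simp
      map_smul' := fun c a => by simp }
  obtain ⟨η, hη, hη'⟩ := exists_inner_of_norm_sq_le J R.cyclic (conjFunctional ω).toLinearMap
    (norm_nonneg ω) fun a => by
      have h := norm_apply_sq_le_bidualActLeft hx hxω (star a)
      rw [star_star, hR, re_coeffFunctional_self, Complex.ofReal_re] at h
      change ‖conjFunctional ω a‖ ^ 2 ≤ ‖ω‖ * ‖R.rep a R.vec‖ ^ 2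
      rwa [conjFunctional_apply, norm_star]
  refine ⟨x, R, η, hx, hxω, hR, ?_, hv', hη⟩
  ext a
  have h := hη' (star a)
  change conjFunctional ω (star a) = ⟪η, R.rep (star a) R.vec⟫_ℂ at h
  rw [conjFunctional_apply, star_star, ← inner_rep_left, ← inner_conj_symm] at h
  rw [coeffFunctional_apply]
  exact star_injective h

theorem bidual_ext {x y : Bidual A}
    (h : ∀ S : CyclicRep A, bidualRep S.rep x = bidualRep S.rep y) : x = y := by
  ext F
  obtain ⟨-, S, η, -, -, -, hF, -⟩ := exists_cyclicRep_coeff F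
  rw [hF, ← inner_bidualRep, h, inner_bidualRep]

theorem norm_apply_le_of_forall_rep {x : Bidual A}
    (h : ∀ (S : CyclicRep A) (β : S.space), ‖bidualRep S.rep x β‖ ≤ ‖β‖) (F : StrongDual ℂ A) :
    ‖x F‖ ≤ ‖F‖ := by
  obtain ⟨-, S, η, -, -, -, hF, h1, h2⟩ := exists_cyclicRep_coeff F
  have h3 : ‖x F‖ ≤ ‖S.vec‖ * ‖η‖ := by
    conv_lhs => rw [hF, ← inner_bidualRep]
    exact (norm_inner_le_norm _ _).trans (mul_le_mul_of_nonneg_left (h S η) (norm_nonneg _))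
  nlinarith [sq_nonneg (‖S.vec‖ - ‖η‖)]

theorem inner_supportOp_congr (R S₁ S₂ : CyclicRep A) (α₁ β₁ : S₁.space) (α₂ β₂ : S₂.space)
    (h : coeffFunctional S₁.rep α₁ β₁ = coeffFunctional S₂.rep α₂ β₂) :
    ⟪α₁, supportOp R S₁.rep β₁⟫_ℂ = ⟪α₂, supportOp R S₂.rep β₂⟫_ℂ := by
  have := inner_supportOp_add (R := R) S₁ S₁ S₂ 0 α₁ β₁ α₁ β₁ α₂ β₂
    (by
      have h0 : (0 : ℂ) • coeffFunctional S₁.rep α₁ β₁ = 0 := by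
        ext a
        exact zero_mul _
      rw [h0, add_zero, h])
  rwa [zero_mul, add_zero] at this

theorem exists_supportElement (R : CyclicRep A) :
    ∃ P : Bidual A, ∀ S : CyclicRep A, bidualRep S.rep P = supportOp R S.rep := by
  have hex : ∀ F : StrongDual ℂ A, ∃ S : CyclicRep A, ∃ η : S.space,
      F = coeffFunctional S.rep S.vec η ∧ ‖S.vec‖ ^ 2 ≤ ‖F‖ ∧ ‖η‖ ^ 2 ≤ ‖F‖ := fun F => by
    obtain ⟨-, S, η, -, -, -, h⟩ := exists_cyclicRep_coeff F
    exact ⟨S, η, h⟩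
  choose S η hF hS hη using hex
  have hadd : ∀ (F G : StrongDual ℂ A) (c : ℂ),
      ⟪(S F).vec, supportOp R (S F).rep (η F)⟫_ℂ + c * ⟪(S G).vec, supportOp R (S G).rep (η G)⟫_ℂ =
        ⟪(S (F + c • G)).vec, supportOp R (S (F + c • G)).rep (η (F + c • G))⟫_ℂ :=
    fun F G c => inner_supportOp_add _ _ _ c _ _ _ _ _ _ (by rw [← hF, ← hF, ← hF])
  have hzero : ⟪(S 0).vec, supportOp R (S 0).rep (η 0)⟫_ℂ = 0 := by
    have h0 : (1 : ℂ) • (0 : StrongDual ℂ A) = 0 := by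
      ext a
      exact mul_zero _
    have := hadd 0 0 1
    rw [h0, add_zero, one_mul] at this
    exact add_eq_left.mp this
  let P : Bidual A := LinearMap.mkContinuous
    { toFun := fun F => ⟪(S F).vec, supportOp R (S F).rep (η F)⟫_ℂ
      map_add' := fun F G => by
        have h1 : (1 : ℂ) • G = G := one_smul ℂ G
        have := hadd F G 1
        rw [h1, one_mul] at this
        exact this.symm
      map_smul' := fun c F => by
        have := hadd 0 F c
        rw [zero_add, hzero, zero_add] at this
        exact this.symm } 1 fun F => by
    have h1 : ‖supportOp R (S F).rep (η F)‖ ≤ ‖η F‖ :=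
      Submodule.norm_starProjection_apply_le _ _
    have h2 := (norm_inner_le_norm (𝕜 := ℂ) (S F).vec (supportOp R (S F).rep (η F))).trans
      (mul_le_mul_of_nonneg_left h1 (norm_nonneg _))
    change ‖⟪(S F).vec, supportOp R (S F).rep (η F)⟫_ℂ‖ ≤ 1 * ‖F‖
    nlinarith [sq_nonneg (‖(S F).vec‖ - ‖η F‖), hS F, hη F]
  refine ⟨P, fun T => ContinuousLinearMap.ext fun β => ext_inner_left ℂ fun α => ?_⟩
  rw [inner_bidualRep]
  exact inner_supportOp_congr _ _ _ _ _ _ _ (hF _).symm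

theorem bidualRep_inclusion {K : Type*} [NormedAddCommGroup K] [InnerProductSpace ℂ K]
    [CompleteSpace K] (π : A →⋆ₙₐ[ℂ] (K →L[ℂ] K)) (a : A) :
    bidualRep π (NormedSpace.inclusionInDoubleDual ℂ A a) = π a := by
  refine ContinuousLinearMap.ext fun β => ext_inner_left ℂ fun α => ?_
  rw [inner_bidualRep]
  rfl

theorem CyclicRep.eq_of_coeff_eq (R : CyclicRep A) {β γ : R.space}
    (h : coeffFunctional R.rep R.vec β = coeffFunctional R.rep R.vec γ) : β = γ := by
  refine R.cyclic.eq_of_inner_right ℂ fun a => ?_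
  rw [inner_rep_left, inner_rep_left]
  exact congrArg (fun F => F (star a)) h

/-- A projection carrying a vector functional fixes the cyclic vector. -/
theorem bidualRep_vec_of_isCarriedBy (R : CyclicRep A) {q : Bidual A}
    (hq : IsCarriedBy (coeffFunctional R.rep R.vec R.vec) q) : bidualRep R.rep q R.vec = R.vec := by
  refine R.eq_of_coeff_eq ?_
  ext a
  have h := (hq (NormedSpace.inclusionInDoubleDual ℂ A a)).2
  rwa [bidualMul_coeffFunctional, bidualRep_inclusion] at h

theorem exists_isPolarDecomposition (ω : StrongDual ℂ A) :
    ∃ p : StrongDual ℂ A × Bidual A, IsPolarDecomposition ω p.1 p.2 := by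
  obtain ⟨x, R, η, hx, hxω, hφ, hω, hv, hη⟩ := exists_cyclicRep_coeff ω
  obtain ⟨P, hP⟩ := exists_supportElement R
  have hXη : bidualRep R.rep x η = R.vec := by
    refine R.eq_of_coeff_eq ?_
    rw [← bidualActLeft_coeffFunctional, ← hω, hφ]
  have hvn : ‖R.vec‖ ^ 2 = ‖ω‖ := by
    have h1 : ((‖R.vec‖ ^ 2 : ℝ) : ℂ) = (‖ω‖ : ℂ) := by
      refine Eq.trans ?_ hxω
      conv_rhs => rw [hω, ← inner_bidualRep, hXη, inner_self_eq_norm_sq_to_K]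
      simp
    exact_mod_cast h1
  have hXv : star (bidualRep R.rep x) R.vec = η := by
    have h1 : ‖star (bidualRep R.rep x) R.vec‖ ≤ ‖R.vec‖ := by
      refine ((star (bidualRep R.rep x)).le_opNorm _).trans
        (mul_le_of_le_one_left (norm_nonneg _) ?_)
      rw [norm_star]
      exact ContinuousLinearMap.opNorm_le_bound _ zero_le_one fun β =>
        (norm_bidualRep_apply_le R.rep x β).trans
          (mul_le_mul_of_nonneg_right hx (norm_nonneg β))
    have h2 : RCLike.re ⟪star (bidualRep R.rep x) R.vec, η⟫_ℂ = ‖R.vec‖ ^ 2 := by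
      rw [ContinuousLinearMap.star_eq_adjoint, ContinuousLinearMap.adjoint_inner_left, hXη,
        inner_self_eq_norm_sq]
    have h3 := norm_sub_sq (𝕜 := ℂ) (star (bidualRep R.rep x) R.vec) η
    rw [h2] at h3
    have h4 : ‖star (bidualRep R.rep x) R.vec - η‖ ^ 2 ≤ 0 := by
      rw [h3]
      nlinarith [norm_nonneg (star (bidualRep R.rep x) R.vec)]
    exact sub_eq_zero.mp (norm_eq_zero.mp (pow_eq_zero_iff two_ne_zero |>.mp
      (le_antisymm h4 (by positivity))))
  have hfix : ∀ (S : CyclicRep A) β, bidualRep S.rep x (star (bidualRep S.rep x)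
      (supportOp R S.rep β)) = supportOp R S.rep β := by
    intro S β
    have h := apply_supportOp_of_fixed (R := R) (π := S.rep) (x := bidualMul x (bidualStar x))
      (by rw [bidualRep_bidualMul, bidualRep_bidualStar]
          change bidualRep R.rep x (star (bidualRep R.rep x) R.vec) = R.vec
          rw [hXv, hXη]) β
    rwa [bidualRep_bidualMul, bidualRep_bidualStar] at h
  have hPstar : ∀ S : CyclicRep A, star (supportOp R S.rep) = supportOp R S.rep := by
    intro S
    refine ContinuousLinearMap.ext fun β => ext_inner_left ℂ fun α => ?_
    rw [ContinuousLinearMap.star_eq_adjoint, ContinuousLinearMap.adjoint_inner_right,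
      inner_supportOp]
  have hPP : ∀ S : CyclicRep A, supportOp R S.rep * supportOp R S.rep = supportOp R S.rep :=
    fun S => ContinuousLinearMap.ext fun β => supportOp_supportOp β
  have hfix' : ∀ S : CyclicRep A, bidualRep S.rep x * (star (bidualRep S.rep x) *
      supportOp R S.rep) = supportOp R S.rep := fun S => ContinuousLinearMap.ext (hfix S)
  have huu : bidualMul (bidualStar (bidualMul (bidualStar x) P)) (bidualMul (bidualStar x) P) =
      P := by
    refine bidual_ext fun S => ?_
    simp only [bidualRep_bidualMul, bidualRep_bidualStar, hP, star_mul, star_star, hPstar]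
    rw [mul_assoc, hfix', hPP]
  refine ⟨(bidualActLeft x ω, bidualMul (bidualStar x) P),
    isPositiveFunctional_bidualActLeft hx hxω, ?_, ?_, ?_⟩
  · refine bidual_ext fun S => ?_
    simp only [bidualRep_bidualMul, bidualRep_bidualStar, hP, star_mul, star_star, hPstar]
    rw [mul_assoc, mul_assoc (supportOp R S.rep), hfix', mul_assoc, hPP, hPP]
  · change IsSupport _ (bidualMul (bidualStar (bidualMul (bidualStar x) P))
      (bidualMul (bidualStar x) P))
    rw [huu, hφ]
    refine ⟨⟨bidual_ext fun S => ?_, bidual_ext fun S => ?_⟩, fun y => ⟨?_, ?_⟩,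
      fun q hq hqc => bidual_ext fun S => ?_⟩
    · rw [bidualRep_bidualMul, hP, hPP]
    · rw [bidualRep_bidualStar, hP, hPstar]
    · rw [bidualMul_coeffFunctional, hP, inner_supportOp, supportOp_vec, inner_bidualRep]
    · rw [bidualMul_coeffFunctional, hP, supportOp_vec, inner_bidualRep]
    · rw [bidualRep_bidualMul, hP]
      exact ContinuousLinearMap.ext fun β =>
        apply_supportOp_of_fixed (bidualRep_vec_of_isCarriedBy R hqc) β
  · change ω = bidualActLeft (bidualMul (bidualStar x) P) (bidualActLeft x ω)
    rw [hφ, bidualActLeft_coeffFunctional, bidualRep_bidualMul, bidualRep_bidualStar, hP]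
    change ω = coeffFunctional R.rep R.vec (star (bidualRep R.rep x) (supportOp R R.rep R.vec))
    rw [supportOp_vec, hXv, ← hω]

theorem isPolarDecomposition_polarDecomposition (ω : StrongDual ℂ A) :
    IsPolarDecomposition ω (polarDecomposition ω).1 (polarDecomposition ω).2 := by
  unfold polarDecomposition
  rw [dif_pos (exists_isPolarDecomposition ω)]
  exact (exists_isPolarDecomposition ω).choose_spec

theorem norm_apply_le_of_partialIsometry {K : Type*} [NormedAddCommGroup K]
    [InnerProductSpace ℂ K] [CompleteSpace K] {U : K →L[ℂ] K} (hU : U * star U * U = U) (β : K) :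
    ‖U β‖ ≤ ‖β‖ := by
  have h1 : star U * U * (star U * U) = star U * U := by
    rw [mul_assoc, ← mul_assoc U, hU]
  have h2 : ‖star U * U‖ ≤ 1 := by
    have h3 : ‖star U * U‖ * ‖star U * U‖ = ‖star U * U‖ := by
      have := CStarRing.norm_star_mul_self (x := star U * U)
      rwa [star_mul, star_star, h1, eq_comm] at this
    nlinarith [norm_nonneg (star U * U)]
  rw [CStarRing.norm_star_mul_self] at h2
  exact (U.le_opNorm β).trans (mul_le_of_le_one_left (norm_nonneg _) (by nlinarith [norm_nonneg U]))

/-- A functional of norm one is a coefficient of unit vectors implementing its absolute values. -/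
theorem exists_coeff_absoluteValues {ω : StrongDual ℂ A} (hω : ‖ω‖ = 1) :
    ∃ (R : CyclicRep A) (η : R.space), ‖R.vec‖ = 1 ∧ ‖η‖ = 1 ∧
      ω = coeffFunctional R.rep R.vec η ∧ rightAbs ω = coeffFunctional R.rep R.vec R.vec ∧
      leftAbs ω = coeffFunctional R.rep η η := by
  have h := isPolarDecomposition_polarDecomposition ω
  unfold leftAbs rightAbs
  generalize (polarDecomposition ω).1 = φ at *
  generalize (polarDecomposition ω).2 = w at *
  obtain ⟨R, hR, -⟩ := exists_cyclicRep h.positive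
  have hiso : ∀ S : CyclicRep A,
      bidualRep S.rep w * star (bidualRep S.rep w) * bidualRep S.rep w = bidualRep S.rep w := by
    intro S
    have := congrArg (bidualRep S.rep) h.partialIsometry
    rwa [bidualRep_bidualMul, bidualRep_bidualMul, bidualRep_bidualStar] at this
  have hfix : star (bidualRep R.rep w) (bidualRep R.rep w R.vec) = R.vec := by
    have := bidualRep_vec_of_isCarriedBy R (hR ▸ h.support.2.1)
    rwa [bidualRep_bidualMul, bidualRep_bidualStar] at this
  have hωc : ω = coeffFunctional R.rep R.vec (bidualRep R.rep w R.vec) := by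
    rw [← bidualActLeft_coeffFunctional, ← hR]
    exact h.eq
  have hnorm : ‖bidualRep R.rep w R.vec‖ ^ 2 = ‖R.vec‖ ^ 2 := by
    rw [← inner_self_eq_norm_sq (𝕜 := ℂ), ← inner_self_eq_norm_sq (𝕜 := ℂ),
      ← ContinuousLinearMap.adjoint_inner_right, ← ContinuousLinearMap.star_eq_adjoint, hfix]
  have hnorm' : ‖bidualRep R.rep w R.vec‖ = ‖R.vec‖ := by
    rwa [sq_eq_sq₀ (norm_nonneg _) (norm_nonneg _)] at hnorm
  have hle : ‖R.vec‖ ^ 2 ≤ 1 := by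
    have h1 := norm_apply_le_of_forall_rep (x := bidualStar w) (fun S β => by
      rw [bidualRep_bidualStar]
      refine norm_apply_le_of_partialIsometry ?_ β
      have := congrArg star (hiso S)
      rwa [star_mul, star_mul, ← mul_assoc] at this) ω
    rw [hω] at h1
    have h2 : bidualStar w ω = ((‖R.vec‖ ^ 2 : ℝ) : ℂ) := by
      rw [hωc, ← inner_bidualRep, bidualRep_bidualStar, hfix, inner_self_eq_norm_sq_to_K]
      simp
    rw [h2, Complex.norm_real, Real.norm_of_nonneg (by positivity)] at h1
    exact h1
  have hge : 1 ≤ ‖R.vec‖ * ‖R.vec‖ := by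
    have h1 := norm_coeffFunctional_le R.rep R.vec (bidualRep R.rep w R.vec)
    rwa [← hωc, hω, hnorm'] at h1
  have hvec : ‖R.vec‖ = 1 := by nlinarith [norm_nonneg R.vec]
  refine ⟨R, bidualRep R.rep w R.vec, hvec, hnorm'.trans hvec, hωc, hR, ?_⟩
  rw [hR, bidualActLeft_coeffFunctional, bidualActRight_coeffFunctional, bidualRep_bidualStar,
    star_star]

end Polar

/-- A C*-algebra `A` on `H` together with a C*-algebra `E` on `K = H ⊗ H` densely spanned by
elementary tensors and a *-algebra `M` of operators on `K` containing `E` as an ideal. -/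
structure TensorSquare (A E M H K : Type*) [NonUnitalCStarAlgebra A] [NonUnitalCStarAlgebra E]
    [Ring M] [StarRing M] [Algebra ℂ M] [NormedAddCommGroup H] [InnerProductSpace ℂ H]
    [CompleteSpace H] [NormedAddCommGroup K] [InnerProductSpace ℂ K] [CompleteSpace K] where
  rep : A →⋆ₙₐ[ℂ] (H →L[ℂ] H)
  rep_injective : Function.Injective rep
  vec : H →L[ℂ] H →L[ℂ] K
  inner_vec : ∀ α β α' β', ⟪vec α β, vec α' β'⟫_ℂ = ⟪α, α'⟫_ℂ * ⟪β, β'⟫_ℂ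
  dense_vec : Dense (Submodule.span ℂ {ζ | ∃ α β, ζ = vec α β} : Set K)
  incl : E →⋆ₙₐ[ℂ] M
  op : M →⋆ₐ[ℂ] (K →L[ℂ] K)
  op_incl_injective : Function.Injective fun e => op (incl e)
  exists_mul : ∀ X e, ∃ e', incl e' = X * incl e
  tmul : A → A → E
  op_tmul_vec : ∀ a b α β, op (incl (tmul a b)) (vec α β) = vec (rep a α) (rep b β)
  dense_tmul : Dense (Submodule.span ℂ {t | ∃ a b, t = tmul a b} : Set E)

namespace TensorSquare

variable {A E M H K : Type*} [NonUnitalCStarAlgebra A] [NonUnitalCStarAlgebra E]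
    [Ring M] [StarRing M] [Algebra ℂ M] [NormedAddCommGroup H] [InnerProductSpace ℂ H]
    [CompleteSpace H] [NormedAddCommGroup K] [InnerProductSpace ℂ K] [CompleteSpace K]
    (S : TensorSquare A E M H K)

/-- The system with the two legs exchanged. -/
def swap : TensorSquare A E M H K where
  rep := S.rep
  rep_injective := S.rep_injective
  vec := S.vec.flip
  inner_vec := fun α β α' β' => by
    rw [ContinuousLinearMap.flip_apply, ContinuousLinearMap.flip_apply, S.inner_vec, mul_comm]
  dense_vec := by
    have h : {ζ | ∃ α β, ζ = S.vec.flip α β} = {ζ | ∃ α β, ζ = S.vec α β} := by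
      ext t
      exact exists_comm
    rw [h]
    exact S.dense_vec
  incl := S.incl
  op := S.op
  op_incl_injective := S.op_incl_injective
  exists_mul := S.exists_mul
  tmul := fun a b => S.tmul b a
  op_tmul_vec := fun a b α β => S.op_tmul_vec b a β α
  dense_tmul := by
    have h : {t | ∃ a b, t = S.tmul b a} = {t | ∃ a b, t = S.tmul a b} := by
      ext t
      exact exists_comm
    rw [h]
    exact S.dense_tmul

/-- The representation of `E`. -/
def opIncl : E →⋆ₙₐ[ℂ] (K →L[ℂ] K) := S.op.toNonUnitalStarAlgHom.comp S.incl

theorem opIncl_apply (e : E) : S.opIncl e = S.op (S.incl e) := rfl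

theorem opIncl_injective : Function.Injective S.opIncl := S.op_incl_injective

theorem norm_opIncl (e : E) : ‖S.opIncl e‖ = ‖e‖ :=
  NonUnitalStarAlgHom.norm_map S.opIncl S.opIncl_injective e

theorem norm_rep (a : A) : ‖S.rep a‖ = ‖a‖ :=
  NonUnitalStarAlgHom.norm_map S.rep S.rep_injective a

/-- The product of an element of `M` and an element of the ideal `E`. -/
def mulE (X : M) (e : E) : E := (S.exists_mul X e).choose

theorem incl_mulE (X : M) (e : E) : S.incl (S.mulE X e) = X * S.incl e :=
  (S.exists_mul X e).choose_spec

theorem opIncl_mulE (X : M) (e : E) : S.opIncl (S.mulE X e) = S.op X * S.opIncl e := by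
  rw [opIncl_apply, incl_mulE, map_mul]
  rfl

theorem mulE_incl (x e : E) : S.mulE (S.incl x) e = x * e :=
  S.opIncl_injective (by rw [opIncl_mulE, map_mul]; rfl)

theorem mulE_mul (X : M) (x y : E) : S.mulE X (x * y) = S.mulE X x * y :=
  S.opIncl_injective (by rw [opIncl_mulE, map_mul, map_mul, opIncl_mulE, mul_assoc])

theorem norm_mulE_le (X : M) (e : E) : ‖S.mulE X e‖ ≤ ‖S.op X‖ * ‖e‖ := by
  rw [← S.norm_opIncl (S.mulE X e), opIncl_mulE, ← S.norm_opIncl e]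
  exact norm_mul_le _ _

/-- Left multiplication by an element of `M` on the ideal `E`. -/
def mulEL : M →ₗ[ℂ] E →L[ℂ] E where
  toFun X := LinearMap.mkContinuous
    { toFun := S.mulE X
      map_add' := fun x y => S.opIncl_injective (by
        rw [map_add, opIncl_mulE, opIncl_mulE, opIncl_mulE, map_add, mul_add])
      map_smul' := fun c x => S.opIncl_injective (by
        rw [RingHom.id_apply, map_smul, opIncl_mulE, opIncl_mulE, map_smul, mul_smul_comm]) }
    ‖S.op X‖ (S.norm_mulE_le X)
  map_add' X Y := by
    ext e
    refine S.opIncl_injective ?_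
    change S.opIncl (S.mulE (X + Y) e) = S.opIncl (S.mulE X e + S.mulE Y e)
    rw [map_add, opIncl_mulE, opIncl_mulE, opIncl_mulE, map_add, add_mul]
  map_smul' c X := by
    ext e
    refine S.opIncl_injective ?_
    change S.opIncl (S.mulE (c • X) e) = S.opIncl (c • S.mulE X e)
    rw [map_smul, opIncl_mulE, opIncl_mulE, map_smul, smul_mul_assoc]

theorem mulEL_apply (X : M) (e : E) : S.mulEL X e = S.mulE X e := rfl

theorem continuous_mulE (X : M) : Continuous (S.mulE X) := (S.mulEL X).continuous

/-- A functional on `M` which is strictly continuous in the sense of a one-sided estimate. -/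
def IsStrict (F : M →ₗ[ℂ] ℂ) : Prop := ∃ (g : E) (C : ℝ), ∀ X, ‖F X‖ ≤ C * ‖S.mulE X g‖

theorem exists_strictExtension (F : StrongDual ℂ E) :
    ∃ F' : M →ₗ[ℂ] ℂ, S.IsStrict F' ∧ ∀ e, F' (S.incl e) = F e := by
  obtain ⟨G, g, C, hG, hGF⟩ := exists_extension_leftMultipliers F
  refine ⟨G.toLinearMap ∘ₗ S.mulEL, ⟨g, C, fun X => hG _ fun x y => S.mulE_mul X x y⟩,
    fun e => ?_⟩
  rw [← hGF]
  change G (S.mulEL (S.incl e)) = _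
  congr 1
  ext x
  exact S.mulE_incl e x

variable {S}

theorem IsStrict.tendsto {F : M →ₗ[ℂ] ℂ} (hF : S.IsStrict F) {ι : Type*} {l : Filter ι}
    {Y : ι → M} {X : M} (h : ∀ g, Tendsto (fun j => S.mulE (Y j) g) l (𝓝 (S.mulE X g))) :
    Tendsto (fun j => F (Y j)) l (𝓝 (F X)) := by
  obtain ⟨g, C, hC⟩ := hF
  rw [tendsto_iff_norm_sub_tendsto_zero]
  have h1 := (tendsto_iff_norm_sub_tendsto_zero.mp (h g)).const_mul C
  rw [mul_zero] at h1
  refine squeeze_zero (fun _ => norm_nonneg _) (fun j => ?_) h1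
  rw [← map_sub, ← mulEL_apply, ← mulEL_apply, ← _root_.sub_apply, ← map_sub]
  exact hC _

variable (S)

theorem mulE_mul_left (X Y : M) (e : E) : S.mulE (X * Y) e = S.mulE X (S.mulE Y e) :=
  S.opIncl_injective (by rw [opIncl_mulE, opIncl_mulE, opIncl_mulE, map_mul, mul_assoc])

theorem tendsto_mulE_mul_incl (X : M) (g : E) :
    Tendsto (fun e => S.mulE (X * S.incl e) g) (approxUnit E) (𝓝 (S.mulE X g)) := by
  simp_rw [mulE_mul_left, mulE_incl]
  exact ((S.continuous_mulE X).tendsto g).comp (tendsto_approxUnit_mul g)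

theorem tendsto_mulE_incl_mul (X : M) (g : E) :
    Tendsto (fun e => S.mulE (S.incl e * X) g) (approxUnit E) (𝓝 (S.mulE X g)) := by
  simp_rw [mulE_mul_left, mulE_incl]
  exact tendsto_approxUnit_mul _

theorem tendsto_mulE_incl_mul_incl (X : M) (g : E) :
    Tendsto (fun e => S.mulE (S.incl e * (X * S.incl e)) g) (approxUnit E) (𝓝 (S.mulE X g)) := by
  simp_rw [mulE_mul_left, mulE_incl]
  have h1 := tendsto_approxUnit_mul (S.mulE X g)
  have h2 : Tendsto (fun e => e * S.mulE X (e * g) - e * S.mulE X g) (approxUnit E) (𝓝 0) := by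
    rw [tendsto_zero_iff_norm_tendsto_zero]
    have h3 := ((S.continuous_mulE X).tendsto g).comp (tendsto_approxUnit_mul g)
    refine squeeze_zero' (Eventually.of_forall fun _ => norm_nonneg _) ?_
      (tendsto_iff_norm_sub_tendsto_zero.mp h3)
    filter_upwards [eventually_approxUnit_norm_le] with e he
    rw [← mul_sub]
    exact (norm_mul_le _ _).trans (mul_le_of_le_one_left (norm_nonneg _) he)
  simpa using h2.add h1

theorem ext_tmul {F F' : StrongDual ℂ E} (h : ∀ a b, F (S.tmul a b) = F' (S.tmul a b)) :
    F = F' := by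
  refine ContinuousLinearMap.ext_on S.dense_tmul ?_
  rintro _ ⟨a, b, rfl⟩
  exact h a b

end TensorSquare

theorem exists_operator_of_form {H : Type*} [NormedAddCommGroup H] [InnerProductSpace ℂ H]
    [CompleteSpace H] (f : H → H → ℂ) (h₁ : ∀ α α' β, f (α + α') β = f α β + f α' β)
    (h₂ : ∀ (c : ℂ) α β, f (c • α) β = starRingEnd ℂ c * f α β)
    (h₃ : ∀ α β β', f α (β + β') = f α β + f α β')
    (h₄ : ∀ (c : ℂ) α β, f α (c • β) = c * f α β) {C : ℝ} (hC : 0 ≤ C)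
    (h : ∀ α β, ‖f α β‖ ≤ C * ‖α‖ * ‖β‖) :
    ∃ B : H →L[ℂ] H, (∀ α β, ⟪α, B β⟫_ℂ = f α β) ∧ ‖B‖ ≤ C := by
  let g := LinearMap.mkContinuous₂ (LinearMap.mk₂'ₛₗ (starRingEnd ℂ) (RingHom.id ℂ) f h₁ h₂ h₃ h₄)
    C h
  have hB : ∀ α β, ⟪α, ContinuousLinearMap.adjoint
      (InnerProductSpace.continuousLinearMapOfBilin g) β⟫_ℂ = f α β := by
    intro α β
    rw [ContinuousLinearMap.adjoint_inner_right,
      InnerProductSpace.continuousLinearMapOfBilin_apply]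
    rfl
  refine ⟨_, hB, ContinuousLinearMap.opNorm_le_of_re_inner_le hC fun β α hβ hα => ?_⟩
  refine (RCLike.re_le_norm (K := ℂ) _).trans ?_
  rw [← inner_conj_symm, RCLike.norm_conj, hB]
  exact (h _ _).trans (le_of_eq (by rw [hα, hβ, mul_one, mul_one]))

namespace TensorSquare

variable {A E M H K : Type*} [NonUnitalCStarAlgebra A] [NonUnitalCStarAlgebra E]
    [Ring M] [StarRing M] [Algebra ℂ M] [NormedAddCommGroup H] [InnerProductSpace ℂ H]
    [CompleteSpace H] [NormedAddCommGroup K] [InnerProductSpace ℂ K] [CompleteSpace K]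
    (S : TensorSquare A E M H K)

theorem norm_vec (α β : H) : ‖S.vec α β‖ = ‖α‖ * ‖β‖ := by
  have h : ((‖S.vec α β‖ ^ 2 : ℝ) : ℂ) = ((‖α‖ * ‖β‖) ^ 2 : ℝ) := by
    have h1 := S.inner_vec α β α β
    rw [inner_self_eq_norm_sq_to_K, inner_self_eq_norm_sq_to_K, inner_self_eq_norm_sq_to_K] at h1
    rw [mul_pow]
    exact_mod_cast h1
  rw [← sq_eq_sq₀ (norm_nonneg _) (by positivity)]
  exact_mod_cast h

theorem rep_ext {a a' : A} (h : ∀ β β', ⟪β, S.rep a β'⟫_ℂ = ⟪β, S.rep a' β'⟫_ℂ) : a = a' :=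
  S.rep_injective (ContinuousLinearMap.ext fun β' => ext_inner_left ℂ fun β => h β β')

theorem exists_rep_eq (L : E →L[ℂ] H →L[ℂ] H) (h : ∀ a b, ∃ c, S.rep c = L (S.tmul a b)) (e : E) :
    ∃ c, S.rep c = L e := by
  have hiso : Isometry S.rep := AddMonoidHomClass.isometry_of_norm S.rep S.norm_rep
  let W : Submodule ℂ (H →L[ℂ] H) :=
    { carrier := Set.range S.rep
      add_mem' := by
        rintro _ _ ⟨a, rfl⟩ ⟨b, rfl⟩
        exact ⟨a + b, map_add _ _ _⟩
      zero_mem' := ⟨0, map_zero _⟩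
      smul_mem' := by
        rintro c _ ⟨a, rfl⟩
        exact ⟨c • a, map_smul _ _ _⟩ }
  have hW : IsClosed (W : Set (H →L[ℂ] H)) := hiso.isClosedEmbedding.isClosed_range
  have h1 : Submodule.span ℂ {t | ∃ a b, t = S.tmul a b} ≤ W.comap L.toLinearMap := by
    refine Submodule.span_le.mpr ?_
    rintro _ ⟨a, b, rfl⟩
    exact h a b
  have h2 : closure (Submodule.span ℂ {t | ∃ a b, t = S.tmul a b} : Set E) ⊆ L ⁻¹' W :=
    closure_minimal h1 (hW.preimage L.continuous)
  rw [S.dense_tmul.closure_eq] at h2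
  exact h2 (Set.mem_univ e)

theorem exists_vectorSlice (α α' : H) (e : E) :
    ∃ c, ∀ β β', ⟪β, S.rep c β'⟫_ℂ = ⟪S.vec α β, S.opIncl e (S.vec α' β')⟫_ℂ := by
  let L : E →L[ℂ] H →L[ℂ] H := LinearMap.mkContinuous
    { toFun := fun e => ContinuousLinearMap.adjoint (S.vec α) ∘L (S.opIncl e ∘L S.vec α')
      map_add' := fun x y => by ext; simp
      map_smul' := fun c x => by ext; simp }
    (‖ContinuousLinearMap.adjoint (S.vec α)‖ * ‖S.vec α'‖) fun e => by
      refine (ContinuousLinearMap.opNorm_comp_le _ _).trans ?_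
      rw [mul_assoc, ← S.norm_opIncl e, mul_comm ‖S.vec α'‖]
      exact mul_le_mul_of_nonneg_left (ContinuousLinearMap.opNorm_comp_le _ _) (norm_nonneg _)
  obtain ⟨c, hc⟩ := S.exists_rep_eq L (fun a b => by
    refine ⟨⟪α, S.rep a α'⟫_ℂ • b, ContinuousLinearMap.ext fun β' => ext_inner_left ℂ fun β => ?_⟩
    change _ = ⟪β, ContinuousLinearMap.adjoint (S.vec α)
      (S.op (S.incl (S.tmul a b)) (S.vec α' β'))⟫_ℂ
    rw [ContinuousLinearMap.adjoint_inner_right, S.op_tmul_vec, S.inner_vec, map_smul,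
      _root_.smul_apply, inner_smul_right]) e
  refine ⟨c, fun β β' => ?_⟩
  rw [hc, ← ContinuousLinearMap.adjoint_inner_right]
  rfl

/-- The slice of `e` by the vector functional `⟪α, · α'⟫` in the first leg. -/
def vectorSlice (α α' : H) (e : E) : A := (S.exists_vectorSlice α α' e).choose

theorem inner_vectorSlice (α α' β β' : H) (e : E) :
    ⟪β, S.rep (S.vectorSlice α α' e) β'⟫_ℂ = ⟪S.vec α β, S.opIncl e (S.vec α' β')⟫_ℂ :=
  (S.exists_vectorSlice α α' e).choose_spec β β'

theorem norm_vectorSlice_le (α α' : H) (e : E) :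
    ‖S.vectorSlice α α' e‖ ≤ ‖e‖ * ‖α‖ * ‖α'‖ := by
  rw [← S.norm_rep]
  refine ContinuousLinearMap.opNorm_le_of_re_inner_le (by positivity) fun β' β hβ' hβ => ?_
  refine (RCLike.re_le_norm (K := ℂ) _).trans ?_
  rw [← inner_conj_symm, RCLike.norm_conj, inner_vectorSlice]
  calc _ ≤ ‖S.vec α β‖ * (‖S.opIncl e‖ * ‖S.vec α' β'‖) :=
        (norm_inner_le_norm _ _).trans
          (mul_le_mul_of_nonneg_left (ContinuousLinearMap.le_opNorm _ _) (norm_nonneg _))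
    _ = _ := by rw [norm_vec, norm_vec, norm_opIncl, hβ, hβ']; ring

theorem vectorSlice_tmul (α α' : H) (a b : A) :
    S.vectorSlice α α' (S.tmul a b) = ⟪α, S.rep a α'⟫_ℂ • b := by
  refine S.rep_ext fun β β' => ?_
  rw [inner_vectorSlice, opIncl_apply, S.op_tmul_vec, S.inner_vec, map_smul, _root_.smul_apply,
    inner_smul_right]

theorem vectorSlice_add (α α' : H) (e e' : E) :
    S.vectorSlice α α' (e + e') = S.vectorSlice α α' e + S.vectorSlice α α' e' := by
  refine S.rep_ext fun β β' => ?_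
  rw [map_add, _root_.add_apply, inner_add_right]
  simp only [inner_vectorSlice]
  rw [map_add, _root_.add_apply, inner_add_right]

theorem vectorSlice_smul (α α' : H) (c : ℂ) (e : E) :
    S.vectorSlice α α' (c • e) = c • S.vectorSlice α α' e := by
  refine S.rep_ext fun β β' => ?_
  rw [map_smul, _root_.smul_apply, inner_smul_right]
  simp only [inner_vectorSlice]
  rw [map_smul, _root_.smul_apply, inner_smul_right]

/-- Existence of the slice map `id ⊗ ν` on `E`. -/
theorem exists_slice (ν : StrongDual ℂ A) : ∃ s : E →ₗ[ℂ] A, (∀ e, ‖s e‖ ≤ ‖ν‖ * ‖e‖) ∧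
    ∀ α α' e, ⟪α, S.rep (s e) α'⟫_ℂ = ν (S.vectorSlice α α' e) := by
  have h1 : ∀ e, ∃ B : H →L[ℂ] H, (∀ α α', ⟪α, B α'⟫_ℂ = ν (S.vectorSlice α α' e)) ∧
      ‖B‖ ≤ ‖ν‖ * ‖e‖ := by
    intro e
    refine exists_operator_of_form (fun α α' => ν (S.vectorSlice α α' e)) ?_ ?_ ?_ ?_
      (by positivity) ?_
    · intro α α' β
      rw [← map_add]
      congr 1
      refine S.rep_ext fun γ γ' => ?_
      rw [map_add, _root_.add_apply, inner_add_right]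
      simp only [inner_vectorSlice, map_add, _root_.add_apply, inner_add_left]
    · intro c α β
      rw [← smul_eq_mul, ← map_smul]
      congr 1
      refine S.rep_ext fun γ γ' => ?_
      rw [map_smul, _root_.smul_apply, inner_smul_right]
      simp only [inner_vectorSlice, map_smul, _root_.smul_apply, inner_smul_left]
    · intro α α' β
      rw [← map_add]
      congr 1
      refine S.rep_ext fun γ γ' => ?_
      rw [map_add, _root_.add_apply, inner_add_right]
      simp only [inner_vectorSlice, map_add, _root_.add_apply, inner_add_right]
    · intro c α β
      rw [← smul_eq_mul, ← map_smul]
      congr 1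
      refine S.rep_ext fun γ γ' => ?_
      rw [map_smul, _root_.smul_apply, inner_smul_right]
      simp only [inner_vectorSlice, map_smul, _root_.smul_apply, inner_smul_right]
    · intro α α'
      calc _ ≤ ‖ν‖ * (‖e‖ * ‖α‖ * ‖α'‖) := (ν.le_opNorm _).trans
            (mul_le_mul_of_nonneg_left (S.norm_vectorSlice_le α α' e) (norm_nonneg _))
        _ = _ := by ring
  choose B hB hBn using h1
  let L : E →L[ℂ] H →L[ℂ] H := LinearMap.mkContinuous
    { toFun := B
      map_add' := fun x y => ContinuousLinearMap.ext fun β => ext_inner_left ℂ fun α => by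
        rw [_root_.add_apply, inner_add_right, hB, hB, hB, vectorSlice_add, map_add]
      map_smul' := fun c x => ContinuousLinearMap.ext fun β => ext_inner_left ℂ fun α => by
        rw [RingHom.id_apply, _root_.smul_apply, inner_smul_right, hB, hB, vectorSlice_smul,
          map_smul, smul_eq_mul] } ‖ν‖ hBn
  have h2 := S.exists_rep_eq L fun a b => ⟨ν b • a, ContinuousLinearMap.ext fun β =>
    ext_inner_left ℂ fun α => by
      change _ = ⟪α, B (S.tmul a b) β⟫_ℂ
      rw [hB, vectorSlice_tmul, map_smul, map_smul, _root_.smul_apply, inner_smul_right,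
        smul_eq_mul, mul_comm]⟩
  choose s hs using h2
  refine ⟨{ toFun := s, map_add' := fun x y => ?_, map_smul' := fun c x => ?_ },
    fun e => ?_, fun α α' e => ?_⟩
  · refine S.rep_injective ?_
    rw [map_add, hs, hs, hs, map_add]
  · refine S.rep_injective ?_
    rw [RingHom.id_apply, map_smul, hs, hs, map_smul]
  · change ‖s e‖ ≤ _
    rw [← S.norm_rep (s e), hs]
    exact hBn e
  · change ⟪α, S.rep (s e) α'⟫_ℂ = _
    rw [hs]
    exact hB e α α'

/-- The slice map `id ⊗ ν` on `E`. -/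
def slice (ν : StrongDual ℂ A) : E →L[ℂ] A :=
  LinearMap.mkContinuous (S.exists_slice ν).choose ‖ν‖ (S.exists_slice ν).choose_spec.1

theorem norm_slice_le (ν : StrongDual ℂ A) (e : E) : ‖S.slice ν e‖ ≤ ‖ν‖ * ‖e‖ :=
  (S.exists_slice ν).choose_spec.1 e

theorem inner_slice (ν : StrongDual ℂ A) (α α' : H) (e : E) :
    ⟪α, S.rep (S.slice ν e) α'⟫_ℂ = ν (S.vectorSlice α α' e) :=
  (S.exists_slice ν).choose_spec.2 α α' e

theorem slice_tmul (ν : StrongDual ℂ A) (a b : A) : S.slice ν (S.tmul a b) = ν b • a := by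
  refine S.rep_ext fun α α' => ?_
  rw [inner_slice, vectorSlice_tmul, map_smul, map_smul, _root_.smul_apply, inner_smul_right,
    smul_eq_mul, mul_comm]

theorem exists_slice_eq_star_mul_self {ν : StrongDual ℂ A} (hν : IsPositiveFunctional ν) (e : E) :
    ∃ c, S.slice ν (star e * e) = star c * c := by
  refine exists_eq_star_mul_self S.rep S.rep_injective fun α => ?_
  rw [inner_slice]
  obtain ⟨b, hb⟩ := exists_eq_star_mul_self S.rep S.rep_injective
    (a := S.vectorSlice α α (star e * e)) fun β => by
      rw [inner_vectorSlice, inner_star_mul_self_apply]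
      exact_mod_cast sq_nonneg ‖S.opIncl e (S.vec α β)‖
  rw [hb]
  exact hν b

/-- The functional `μ ⊗ ν` on `E`. -/
def dualTmul (μ ν : StrongDual ℂ A) : StrongDual ℂ E := μ.comp (S.slice ν)

theorem dualTmul_apply (μ ν : StrongDual ℂ A) (e : E) : S.dualTmul μ ν e = μ (S.slice ν e) := rfl

theorem dualTmul_tmul (μ ν : StrongDual ℂ A) (a b : A) :
    S.dualTmul μ ν (S.tmul a b) = μ a * ν b := by
  rw [dualTmul_apply, slice_tmul, map_smul, smul_eq_mul, mul_comm]

theorem norm_dualTmul_apply_le (μ ν : StrongDual ℂ A) (e : E) :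
    ‖S.dualTmul μ ν e‖ ≤ ‖μ‖ * ‖ν‖ * ‖e‖ := by
  rw [mul_assoc]
  exact (μ.le_opNorm _).trans (mul_le_mul_of_nonneg_left (S.norm_slice_le ν e) (norm_nonneg _))

theorem dualTmul_swap (μ ν : StrongDual ℂ A) : S.swap.dualTmul ν μ = S.dualTmul μ ν := by
  refine S.ext_tmul fun a b => ?_
  rw [dualTmul_tmul, mul_comm]
  exact S.swap.dualTmul_tmul ν μ b a

theorem dualTmul_star_mul_self_nonneg {σ τ : StrongDual ℂ A} (hσ : IsPositiveFunctional σ)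
    (hτ : IsPositiveFunctional τ) (e : E) : 0 ≤ S.dualTmul σ τ (star e * e) := by
  obtain ⟨c, hc⟩ := S.exists_slice_eq_star_mul_self hτ e
  rw [dualTmul_apply, hc]
  exact hσ c

end TensorSquare

namespace TensorSquare

variable {A E M H K : Type*} [NonUnitalCStarAlgebra A] [NonUnitalCStarAlgebra E]
    [Ring M] [StarRing M] [Algebra ℂ M] [NormedAddCommGroup H] [InnerProductSpace ℂ H]
    [CompleteSpace H] [NormedAddCommGroup K] [InnerProductSpace ℂ K] [CompleteSpace K]
    (S : TensorSquare A E M H K)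

theorem op_ext {T T' : K →L[ℂ] K} (h : ∀ α β, T (S.vec α β) = T' (S.vec α β)) : T = T' := by
  refine ContinuousLinearMap.ext_on S.dense_vec ?_
  rintro _ ⟨α, β, rfl⟩
  exact h α β

theorem opIncl_tmul_vec (a b : A) (α β : H) :
    S.opIncl (S.tmul a b) (S.vec α β) = S.vec (S.rep a α) (S.rep b β) :=
  S.op_tmul_vec a b α β

theorem tmul_mul_tmul (a b c d : A) : S.tmul a b * S.tmul c d = S.tmul (a * c) (b * d) := by
  refine S.opIncl_injective (S.op_ext fun α β => ?_)
  rw [map_mul]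
  change S.opIncl (S.tmul a b) (S.opIncl (S.tmul c d) (S.vec α β)) = _
  rw [opIncl_tmul_vec, opIncl_tmul_vec, opIncl_tmul_vec, map_mul, map_mul]
  rfl

theorem star_tmul (a b : A) : star (S.tmul a b) = S.tmul (star a) (star b) := by
  refine S.opIncl_injective (S.op_ext fun α β => ?_)
  have h : ∀ γ δ, ⟪S.vec γ δ, S.opIncl (star (S.tmul a b)) (S.vec α β)⟫_ℂ =
      ⟪S.vec γ δ, S.opIncl (S.tmul (star a) (star b)) (S.vec α β)⟫_ℂ := by
    intro γ δ
    rw [← inner_rep_left, opIncl_tmul_vec, opIncl_tmul_vec, S.inner_vec, S.inner_vec,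
      inner_rep_left, inner_rep_left]
  refine S.dense_vec.eq_of_inner_right ℂ fun ζ hζ => ?_
  induction hζ using Submodule.span_induction with
  | mem x hx =>
    obtain ⟨γ, δ, rfl⟩ := hx
    exact h γ δ
  | zero => rw [inner_zero_left, inner_zero_left]
  | add x y _ _ hx hy => rw [inner_add_left, inner_add_left, hx, hy]
  | smul c x _ hx => rw [inner_smul_left, inner_smul_left, hx]

theorem rightTranslate_dualTmul (μ ν : StrongDual ℂ A) (a b : A) :
    rightTranslate (S.dualTmul μ ν) (S.tmul a b) =
      S.dualTmul (rightTranslate μ a) (rightTranslate ν b) := by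
  refine S.ext_tmul fun c d => ?_
  rw [rightTranslate_apply, tmul_mul_tmul, dualTmul_tmul, dualTmul_tmul]
  rfl

theorem conjFunctional_dualTmul (μ ν : StrongDual ℂ A) :
    conjFunctional (S.dualTmul μ ν) = S.dualTmul (conjFunctional μ) (conjFunctional ν) := by
  refine S.ext_tmul fun c d => ?_
  rw [conjFunctional_apply, star_tmul, dualTmul_tmul, dualTmul_tmul, star_mul']
  rfl

theorem dualTmul_add_left (μ μ' ν : StrongDual ℂ A) :
    S.dualTmul (μ + μ') ν = S.dualTmul μ ν + S.dualTmul μ' ν := rfl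

theorem dualTmul_smul_left (c : ℂ) (μ ν : StrongDual ℂ A) :
    S.dualTmul (c • μ) ν = c • S.dualTmul μ ν := rfl

theorem dualTmul_add_right (μ ν ν' : StrongDual ℂ A) :
    S.dualTmul μ (ν + ν') = S.dualTmul μ ν + S.dualTmul μ ν' := by
  refine S.ext_tmul fun a b => ?_
  simp only [_root_.add_apply, dualTmul_tmul, mul_add]

theorem dualTmul_smul_right (c : ℂ) (μ ν : StrongDual ℂ A) :
    S.dualTmul μ (c • ν) = c • S.dualTmul μ ν := by
  refine S.ext_tmul fun a b => ?_
  simp only [_root_.smul_apply, dualTmul_tmul, smul_eq_mul]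
  ring

/-- The strict extension of `μ ⊗ ν` to `M`. -/
def tensorFun (μ ν : StrongDual ℂ A) : M →ₗ[ℂ] ℂ :=
  (S.exists_strictExtension (S.dualTmul μ ν)).choose

theorem isStrict_tensorFun (μ ν : StrongDual ℂ A) : S.IsStrict (S.tensorFun μ ν) :=
  (S.exists_strictExtension (S.dualTmul μ ν)).choose_spec.1

theorem tensorFun_incl (μ ν : StrongDual ℂ A) (e : E) :
    S.tensorFun μ ν (S.incl e) = S.dualTmul μ ν e :=
  (S.exists_strictExtension (S.dualTmul μ ν)).choose_spec.2 e

theorem tensorFun_mul_incl (μ ν : StrongDual ℂ A) (X : M) (e : E) :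
    S.tensorFun μ ν (X * S.incl e) = S.dualTmul μ ν (S.mulE X e) := by
  rw [← incl_mulE, tensorFun_incl]

theorem tendsto_dualTmul_mulE (μ ν : StrongDual ℂ A) (X : M) :
    Tendsto (fun e => S.dualTmul μ ν (S.mulE X e)) (approxUnit E) (𝓝 (S.tensorFun μ ν X)) := by
  simp_rw [← tensorFun_mul_incl]
  exact (S.isStrict_tensorFun μ ν).tendsto (S.tendsto_mulE_mul_incl X)

theorem tensorFun_eq_of_tendsto {μ ν : StrongDual ℂ A} {X : M} {z : ℂ}
    (h : Tendsto (fun e => S.dualTmul μ ν (S.mulE X e)) (approxUnit E) (𝓝 z)) :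
    S.tensorFun μ ν X = z :=
  tendsto_nhds_unique (S.tendsto_dualTmul_mulE μ ν X) h

theorem norm_tensorFun_apply_le (μ ν : StrongDual ℂ A) (X : M) :
    ‖S.tensorFun μ ν X‖ ≤ ‖μ‖ * ‖ν‖ * ‖S.op X‖ := by
  refine le_of_tendsto (S.tendsto_dualTmul_mulE μ ν X).norm ?_
  filter_upwards [eventually_approxUnit_norm_le] with e he
  refine (S.norm_dualTmul_apply_le μ ν _).trans (mul_le_mul_of_nonneg_left ?_ (by positivity))
  exact (S.norm_mulE_le X e).trans (mul_le_of_le_one_right (norm_nonneg _) he)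

theorem eq_tensorFun {μ ν : StrongDual ℂ A} {F : M →ₗ[ℂ] ℂ}
    (hF : Continuous fun e => F (S.incl e))
    (htmul : ∀ a b, F (S.incl (S.tmul a b)) = μ a * ν b)
    (hlim : ∀ X, Tendsto (fun e => F (X * S.incl e)) (approxUnit E) (𝓝 (F X))) :
    F = S.tensorFun μ ν := by
  let F₀ : StrongDual ℂ E := ⟨F ∘ₗ (S.incl : E →ₗ[ℂ] M), hF⟩
  have h0 : F₀ = S.dualTmul μ ν := by
    refine S.ext_tmul fun a b => ?_
    rw [dualTmul_tmul]
    exact htmul a b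
  ext X
  refine (S.tensorFun_eq_of_tendsto ?_).symm
  rw [← h0]
  refine (hlim X).congr fun e => ?_
  exact congrArg F (S.incl_mulE X e).symm

theorem tensorFun_add_left (μ μ' ν : StrongDual ℂ A) (X : M) :
    S.tensorFun (μ + μ') ν X = S.tensorFun μ ν X + S.tensorFun μ' ν X := by
  refine S.tensorFun_eq_of_tendsto ?_
  simp_rw [dualTmul_add_left, _root_.add_apply]
  exact (S.tendsto_dualTmul_mulE μ ν X).add (S.tendsto_dualTmul_mulE μ' ν X)

theorem tensorFun_smul_left (c : ℂ) (μ ν : StrongDual ℂ A) (X : M) :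
    S.tensorFun (c • μ) ν X = c * S.tensorFun μ ν X := by
  refine S.tensorFun_eq_of_tendsto ?_
  simp_rw [dualTmul_smul_left, _root_.smul_apply, smul_eq_mul]
  exact (S.tendsto_dualTmul_mulE μ ν X).const_mul c

theorem tensorFun_add_right (μ ν ν' : StrongDual ℂ A) (X : M) :
    S.tensorFun μ (ν + ν') X = S.tensorFun μ ν X + S.tensorFun μ ν' X := by
  refine S.tensorFun_eq_of_tendsto ?_
  simp_rw [dualTmul_add_right, _root_.add_apply]
  exact (S.tendsto_dualTmul_mulE μ ν X).add (S.tendsto_dualTmul_mulE μ ν' X)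

theorem tensorFun_smul_right (c : ℂ) (μ ν : StrongDual ℂ A) (X : M) :
    S.tensorFun μ (c • ν) X = c * S.tensorFun μ ν X := by
  refine S.tensorFun_eq_of_tendsto ?_
  simp_rw [dualTmul_smul_right, _root_.smul_apply, smul_eq_mul]
  exact (S.tendsto_dualTmul_mulE μ ν X).const_mul c

theorem tensorFun_tmul_mul (μ ν : StrongDual ℂ A) (a b : A) (X : M) :
    S.tensorFun μ ν (S.incl (S.tmul a b) * X) =
      S.tensorFun (rightTranslate μ a) (rightTranslate ν b) X := by
  refine S.tensorFun_eq_of_tendsto ?_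
  simp_rw [mulE_mul_left, mulE_incl]
  have h := S.tendsto_dualTmul_mulE (rightTranslate μ a) (rightTranslate ν b) X
  simp_rw [← rightTranslate_dualTmul] at h
  exact h

theorem tensorFun_conj (μ ν : StrongDual ℂ A) (X : M) :
    S.tensorFun μ ν (star X) =
      star (S.tensorFun (conjFunctional μ) (conjFunctional ν) X) := by
  have h1 : Tendsto (fun e => S.tensorFun μ ν (S.incl e * star X)) (approxUnit E)
      (𝓝 (S.tensorFun μ ν (star X))) :=
    (S.isStrict_tensorFun μ ν).tendsto (S.tendsto_mulE_incl_mul (star X))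
  refine tendsto_nhds_unique h1 ?_
  refine (((continuous_star (R := ℂ)).tendsto _).comp
    (S.tendsto_dualTmul_mulE (conjFunctional μ) (conjFunctional ν) X)).congr' ?_
  filter_upwards [eventually_approxUnit_star_eq] with e he
  have h2 : S.incl e * star X = S.incl (star (S.mulE X e)) := by
    rw [map_star, incl_mulE, star_mul, ← map_star, he]
  rw [h2, tensorFun_incl, Function.comp_apply, ← conjFunctional_dualTmul, conjFunctional_apply,
    star_star]

theorem tensorFun_mul_tmul (μ ν : StrongDual ℂ A) (a b : A) (X : M) :
    S.tensorFun μ ν (X * S.incl (S.tmul a b)) =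
      S.tensorFun (leftTranslate μ a) (leftTranslate ν b) X := by
  have h : X * S.incl (S.tmul a b) = star (S.incl (S.tmul (star a) (star b)) * star X) := by
    rw [← star_tmul, map_star, star_mul, star_star, star_star]
  rw [h, tensorFun_conj, tensorFun_tmul_mul, tensorFun_conj, star_star,
    conjFunctional_rightTranslate, conjFunctional_rightTranslate, conjFunctional_conjFunctional,
    conjFunctional_conjFunctional, star_star, star_star]

theorem tensorFun_star_mul_self_nonneg {σ τ : StrongDual ℂ A} (hσ : IsPositiveFunctional σ)
    (hτ : IsPositiveFunctional τ) (X : M) : 0 ≤ S.tensorFun σ τ (star X * X) := by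
  have h := (S.isStrict_tensorFun σ τ).tendsto (S.tendsto_mulE_incl_mul_incl (star X * X))
  refine ge_of_tendsto h ?_
  filter_upwards [eventually_approxUnit_star_eq] with e he
  have h2 : S.incl e * (star X * X * S.incl e) = S.incl (star (S.mulE X e) * S.mulE X e) := by
    rw [map_mul, map_star, incl_mulE, star_mul, ← map_star, he]
    simp only [mul_assoc]
  rw [h2, tensorFun_incl]
  exact S.dualTmul_star_mul_self_nonneg hσ hτ _

theorem tensorFun_swap (μ ν : StrongDual ℂ A) (X : M) :
    S.swap.tensorFun ν μ X = S.tensorFun μ ν X := by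
  refine S.swap.tensorFun_eq_of_tendsto ?_
  simp_rw [dualTmul_swap]
  exact S.tendsto_dualTmul_mulE μ ν X

section Convolution

variable (Δ : A →⋆ₙₐ[ℂ] M)

theorem norm_op_comul_le (a : A) : ‖S.op (Δ a)‖ ≤ ‖a‖ :=
  NonUnitalStarAlgHom.norm_apply_le (S.op.toNonUnitalStarAlgHom.comp Δ) a

/-- The convolution of two functionals. -/
def convFun (μ ν : StrongDual ℂ A) : StrongDual ℂ A :=
  LinearMap.mkContinuous (S.tensorFun μ ν ∘ₗ (Δ : A →ₗ[ℂ] M)) (‖μ‖ * ‖ν‖) fun a =>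
    (S.norm_tensorFun_apply_le μ ν (Δ a)).trans
      (mul_le_mul_of_nonneg_left (S.norm_op_comul_le Δ a) (by positivity))

theorem norm_convFun_le (μ ν : StrongDual ℂ A) : ‖S.convFun Δ μ ν‖ ≤ ‖μ‖ * ‖ν‖ :=
  LinearMap.mkContinuous_norm_le _ (by positivity) _

/-- Convolution of functionals, as a bounded bilinear map. -/
def conv : StrongDual ℂ A →L[ℂ] StrongDual ℂ A →L[ℂ] StrongDual ℂ A :=
  LinearMap.mkContinuous₂ (LinearMap.mk₂ ℂ (S.convFun Δ)
    (fun μ μ' ν => by ext a; exact S.tensorFun_add_left μ μ' ν (Δ a))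
    (fun c μ ν => by ext a; exact S.tensorFun_smul_left c μ ν (Δ a))
    (fun μ ν ν' => by ext a; exact S.tensorFun_add_right μ ν ν' (Δ a))
    (fun c μ ν => by ext a; exact S.tensorFun_smul_right c μ ν (Δ a))) 1 fun μ ν => by
      rw [one_mul]
      exact S.norm_convFun_le Δ μ ν

theorem conv_apply (μ ν : StrongDual ℂ A) (a : A) :
    S.conv Δ μ ν a = S.tensorFun μ ν (Δ a) := rfl

theorem norm_conv_le (μ ν : StrongDual ℂ A) : ‖S.conv Δ μ ν‖ ≤ ‖μ‖ * ‖ν‖ :=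
  S.norm_convFun_le Δ μ ν

theorem conv_swap (μ ν : StrongDual ℂ A) : S.swap.conv Δ ν μ = S.conv Δ μ ν := by
  ext a
  exact S.tensorFun_swap μ ν (Δ a)

end Convolution

end TensorSquare

namespace TensorSquare

variable {A E M H K : Type*} [NonUnitalCStarAlgebra A] [NonUnitalCStarAlgebra E]
    [Ring M] [StarRing M] [Algebra ℂ M] [NormedAddCommGroup H] [InnerProductSpace ℂ H]
    [CompleteSpace H] [NormedAddCommGroup K] [InnerProductSpace ℂ K] [CompleteSpace K]
    (S : TensorSquare A E M H K) (Δ : A →⋆ₙₐ[ℂ] M)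

section Cancellation

/-- The products `Δ(a) (c ⊗ 1)` lie in `E` and span a dense subspace. -/
def Cancels : Prop := ∃ f : A → A → E,
  (∀ a c α β, S.opIncl (f a c) (S.vec α β) = S.op (Δ a) (S.vec (S.rep c α) β)) ∧
    Dense (Submodule.span ℂ {t | ∃ a c, t = f a c} : Set E)

variable {S}

theorem slice_eq_slice_mul {z f : E} {c : A}
    (h : ∀ α β, S.opIncl f (S.vec α β) = S.opIncl z (S.vec (S.rep c α) β)) (ν : StrongDual ℂ A) :
    S.slice ν f = S.slice ν z * c := by
  refine S.rep_ext fun α α' => ?_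
  rw [map_mul]
  change _ = ⟪α, S.rep (S.slice ν z) (S.rep c α')⟫_ℂ
  rw [inner_slice, inner_slice]
  congr 1
  refine S.rep_ext fun β β' => ?_
  rw [inner_vectorSlice, inner_vectorSlice, h]

theorem tensorFun_leftTranslate_eq {X : M} {f : E} {c : A}
    (h : ∀ α β, S.opIncl f (S.vec α β) = S.op X (S.vec (S.rep c α) β)) (κ ν : StrongDual ℂ A) :
    S.tensorFun (leftTranslate κ c) ν X = S.dualTmul κ ν f := by
  have h1 := (S.isStrict_tensorFun (leftTranslate κ c) ν).tendsto (S.tendsto_mulE_incl_mul X)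
  have h2 : Tendsto (fun e => S.dualTmul κ ν (e * f)) (approxUnit E) (𝓝 (S.dualTmul κ ν f)) :=
    ((S.dualTmul κ ν).continuous.tendsto f).comp (tendsto_approxUnit_mul f)
  refine tendsto_nhds_unique h1 (h2.congr fun e => ?_)
  have h3 : S.incl e * X = S.incl (star (S.mulE (star X) (star e))) := by
    rw [map_star, incl_mulE, star_mul, star_star, map_star, star_star]
  rw [h3, tensorFun_incl, dualTmul_apply, dualTmul_apply, leftTranslate_apply]
  congr 1
  refine slice_eq_slice_mul (fun α β => ?_) ν
  rw [opIncl_apply _ (star _), ← h3, map_mul, map_mul]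
  change S.opIncl e (S.opIncl f (S.vec α β)) = S.opIncl e (S.op X (S.vec (S.rep c α) β))
  rw [h]

theorem Cancels.exists_slice_conv (hS : S.Cancels Δ) (μ : StrongDual ℂ A) (a : A) :
    ∃ b, ∀ ν : StrongDual ℂ A, ν b = S.conv Δ μ ν a := by
  let Φ : StrongDual ℂ A → Bidual A := fun μ =>
    (NormedSpace.inclusionInDoubleDual ℂ A a).comp (S.conv Δ μ)
  have hΦ : Continuous Φ :=
    (ContinuousLinearMap.compL ℂ _ _ _ (NormedSpace.inclusionInDoubleDual ℂ A a)).continuous.comp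
      (S.conv Δ).continuous
  have hr : IsClosed (Set.range (NormedSpace.inclusionInDoubleDualLi ℂ (E := A))) :=
    (NormedSpace.inclusionInDoubleDualLi ℂ
      (E := A)).isometry.isUniformInducing.isComplete_range.isClosed
  have hmem : Φ μ ∈ Set.range (NormedSpace.inclusionInDoubleDualLi ℂ (E := A)) := by
    refine hr.mem_of_tendsto ((hΦ.tendsto μ).comp (tendsto_leftTranslate_approxUnit μ))
      (Eventually.of_forall fun c => ?_)
    obtain ⟨f, hf, -⟩ := hS
    refine ⟨S.swap.slice μ (f a c), ?_⟩
    ext ν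
    change ν (S.swap.slice μ (f a c)) = S.tensorFun (leftTranslate μ c) ν (Δ a)
    rw [tensorFun_leftTranslate_eq (hf a c), ← dualTmul_swap]
    rfl
  obtain ⟨b, hb⟩ := hmem
  exact ⟨b, fun ν => congrArg (fun F => F ν) hb⟩

theorem exists_slice_conv_right (hS : S.swap.Cancels Δ) (ν : StrongDual ℂ A) (a : A) :
    ∃ b, ∀ μ : StrongDual ℂ A, μ b = S.conv Δ μ ν a := by
  obtain ⟨b, hb⟩ := hS.exists_slice_conv Δ ν a
  refine ⟨b, fun μ => ?_⟩
  rw [hb, conv_swap]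

variable {Δ}

theorem Cancels.apply_mul_eq_of_leftTranslate (hS : S.Cancels Δ) {μ ν ν' : StrongDual ℂ A}
    (h : ∀ c, S.conv Δ (leftTranslate μ c) ν = S.conv Δ (leftTranslate μ c) ν') (a b : A) :
    μ a * ν b = μ a * ν' b := by
  obtain ⟨f, hf, hd⟩ := hS
  have h1 : S.dualTmul μ ν = S.dualTmul μ ν' := by
    refine ContinuousLinearMap.ext_on hd ?_
    rintro _ ⟨a, c, rfl⟩
    rw [← tensorFun_leftTranslate_eq (hf a c), ← tensorFun_leftTranslate_eq (hf a c),
      ← conv_apply, ← conv_apply, h]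
  rw [← S.dualTmul_tmul, h1, S.dualTmul_tmul]

variable (S Δ)

theorem conjFunctional_conv (μ ν : StrongDual ℂ A) :
    conjFunctional (S.conv Δ μ ν) = S.conv Δ (conjFunctional μ) (conjFunctional ν) := by
  ext a
  rw [conjFunctional_apply, conv_apply, conv_apply, map_star, tensorFun_conj, star_star]

end Cancellation

section Coassociative

theorem mem_of_mem_of_dense {Q L : Type*} [NormedAddCommGroup Q] [NormedSpace ℂ Q]
    [NormedAddCommGroup L] [NormedSpace ℂ L] (T : Q →L[ℂ] L) (Z : Submodule ℂ L)
    (hZ : IsClosed (Z : Set L)) {W : Set Q} (hW : Dense (Submodule.span ℂ W : Set Q))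
    (h : ∀ q ∈ W, T q ∈ Z) (q : Q) : T q ∈ Z := by
  have h1 : Submodule.span ℂ W ≤ Z.comap T.toLinearMap := Submodule.span_le.mpr h
  have h2 : closure (Submodule.span ℂ W : Set Q) ⊆ T ⁻¹' Z :=
    closure_minimal h1 (hZ.preimage T.continuous)
  rw [hW.closure_eq] at h2
  exact h2 (Set.mem_univ q)

theorem mem_of_mem_of_dense₂ {P Q L : Type*} [NormedAddCommGroup P] [NormedSpace ℂ P]
    [NormedAddCommGroup Q] [NormedSpace ℂ Q] [NormedAddCommGroup L] [NormedSpace ℂ L]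
    (v : P →L[ℂ] Q →L[ℂ] L) (Z : Submodule ℂ L) (hZ : IsClosed (Z : Set L)) {U : Set P} {W : Set Q}
    (hU : Dense (Submodule.span ℂ U : Set P)) (hW : Dense (Submodule.span ℂ W : Set Q))
    (h : ∀ p ∈ U, ∀ q ∈ W, v p q ∈ Z) (p : P) (q : Q) : v p q ∈ Z :=
  mem_of_mem_of_dense (v.flip q) Z hZ hU
    (fun p hp => mem_of_mem_of_dense (v p) Z hZ hW (h p hp) q) p

variable {S} {L : Type*} [NormedAddCommGroup L] [InnerProductSpace ℂ L] [CompleteSpace L]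

/-- A vector functional of a nondegenerate representation of `M` which agrees with `μ ⊗ ν` on
elementary tensors is its strict extension. -/
theorem tensorFun_eq_inner (Ψ : M →⋆ₐ[ℂ] (L →L[ℂ] L)) {μ ν : StrongDual ℂ A} {ζ ζ' : L}
    (hζ' : ζ' ∈ (Submodule.span ℂ {ξ | ∃ e ξ', ξ = Ψ (S.incl e) ξ'}).topologicalClosure)
    (h : ∀ a b, μ a * ν b = ⟪ζ, Ψ (S.incl (S.tmul a b)) ζ'⟫_ℂ) (X : M) :
    S.tensorFun μ ν X = ⟪ζ, Ψ X ζ'⟫_ℂ := by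
  let π : E →⋆ₙₐ[ℂ] (L →L[ℂ] L) := Ψ.toNonUnitalStarAlgHom.comp S.incl
  have hπ : ∀ e, π e = Ψ (S.incl e) := fun _ => rfl
  have h1 : S.dualTmul μ ν = coeffFunctional π ζ ζ' := by
    refine S.ext_tmul fun a b => ?_
    rw [dualTmul_tmul, h, coeffFunctional_apply, hπ]
  have hlim : Tendsto (fun e => π e ζ') (approxUnit E) (𝓝 ζ') := by
    let Z : Submodule ℂ L :=
      { carrier := {ξ | Tendsto (fun e => π e ξ) (approxUnit E) (𝓝 ξ)}
        add_mem' := fun {x y} hx hy => by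
          change Tendsto _ _ _
          simp_rw [map_add]
          exact Tendsto.add hx hy
        zero_mem' := by
          change Tendsto _ _ _
          simp_rw [map_zero]
          exact tendsto_const_nhds
        smul_mem' := fun c x hx => by
          change Tendsto _ _ _
          simp_rw [map_smul]
          exact Tendsto.const_smul hx c }
    have hZ : IsClosed (Z : Set L) := by
      refine isClosed_of_closure_subset fun x hx => ?_
      change Tendsto _ _ _
      rw [Metric.tendsto_nhds]
      intro ε hε
      obtain ⟨y, hy, hxy⟩ := Metric.mem_closure_iff.mp hx (ε / 3) (by positivity)
      have hy' : Tendsto (fun e => π e y) (approxUnit E) (𝓝 y) := hy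
      filter_upwards [Metric.tendsto_nhds.mp hy' (ε / 3) (by positivity),
        eventually_approxUnit_norm_le] with e he he1
      have h3 : dist (π e x) (π e y) ≤ dist x y := by
        rw [dist_eq_norm, dist_eq_norm, ← map_sub]
        exact (norm_rep_apply_le π e _).trans (mul_le_of_le_one_left (norm_nonneg _) he1)
      have h4 := dist_triangle4 (π e x) (π e y) y x
      rw [dist_comm y x] at h4
      linarith
    have hle : (Submodule.span ℂ {ξ | ∃ e ξ', ξ = Ψ (S.incl e) ξ'}).topologicalClosure ≤ Z := by
      refine Submodule.topologicalClosure_minimal _ (Submodule.span_le.mpr ?_) hZ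
      rintro _ ⟨e, ξ', rfl⟩
      change Tendsto (fun x => π x (π e ξ')) _ (𝓝 (π e ξ'))
      have h5 : Tendsto (fun x => π (x * e) ξ') (approxUnit E) (𝓝 (π e ξ')) := by
        rw [tendsto_iff_norm_sub_tendsto_zero]
        have h6 := (tendsto_iff_norm_sub_tendsto_zero.mp (tendsto_approxUnit_mul e)).mul_const ‖ξ'‖
        rw [zero_mul] at h6
        refine squeeze_zero (fun _ => norm_nonneg _) (fun x => ?_) h6
        rw [← _root_.sub_apply, ← map_sub]
        exact norm_rep_apply_le π _ _
      refine h5.congr fun x => ?_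
      rw [map_mul]
      rfl
    exact hle hζ'
  refine S.tensorFun_eq_of_tendsto ?_
  have h7 : ∀ e, S.dualTmul μ ν (S.mulE X e) = ⟪ζ, Ψ X (π e ζ')⟫_ℂ := by
    intro e
    rw [h1, coeffFunctional_apply, hπ, incl_mulE, map_mul]
    rfl
  simp_rw [h7]
  exact ((continuous_const.inner (Ψ X).continuous).tendsto ζ').comp hlim

variable (S)

/-- Data witnessing the coassociativity of `Δ` on a triple tensor product of Hilbert spaces. -/
structure Coassociator (L : Type*) [NormedAddCommGroup L] [InnerProductSpace ℂ L]
    [CompleteSpace L] where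
  vecR : H →L[ℂ] K →L[ℂ] L
  vecL : K →L[ℂ] H →L[ℂ] L
  inner_vecR : ∀ α ζ α' ζ', ⟪vecR α ζ, vecR α' ζ'⟫_ℂ = ⟪α, α'⟫_ℂ * ⟪ζ, ζ'⟫_ℂ
  inner_vecL : ∀ ζ γ ζ' γ', ⟪vecL ζ γ, vecL ζ' γ'⟫_ℂ = ⟪ζ, ζ'⟫_ℂ * ⟪γ, γ'⟫_ℂ
  vecL_vec : ∀ α β γ, vecL (S.vec α β) γ = vecR α (S.vec β γ)
  mapR : M →⋆ₐ[ℂ] (L →L[ℂ] L)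
  mapL : M →⋆ₐ[ℂ] (L →L[ℂ] L)
  mapR_vecR : ∀ a b α ζ, mapR (S.incl (S.tmul a b)) (vecR α ζ) = vecR (S.rep a α) (S.op (Δ b) ζ)
  mapL_vecL : ∀ a b ζ γ, mapL (S.incl (S.tmul a b)) (vecL ζ γ) = vecL (S.op (Δ a) ζ) (S.rep b γ)
  mapR_comul : ∀ a, mapR (Δ a) = mapL (Δ a)

variable {S Δ}

theorem tensorFun_coeffFunctional
    (hrep : Dense (Submodule.span ℂ {ξ | ∃ a ξ', ξ = S.rep a ξ'} : Set H)) (α α' β β' : H) (X : M) :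
    S.tensorFun (coeffFunctional S.rep α α') (coeffFunctional S.rep β β') X =
      ⟪S.vec α β, S.op X (S.vec α' β')⟫_ℂ := by
  refine tensorFun_eq_inner S.op ?_ (fun a b => ?_) X
  · refine mem_of_mem_of_dense₂ S.vec _ (Submodule.isClosed_topologicalClosure _) hrep hrep ?_ _ _
    rintro _ ⟨a, ξ, rfl⟩ _ ⟨b, ξ', rfl⟩
    exact subset_closure (Submodule.subset_span ⟨S.tmul a b, S.vec ξ ξ',
      (S.op_tmul_vec a b ξ ξ').symm⟩)
  · rw [S.op_tmul_vec, S.inner_vec]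
    rfl

theorem conv_assoc_coeffFunctional (T : Coassociator S Δ L)
    (hrep : Dense (Submodule.span ℂ {ξ | ∃ a ξ', ξ = S.rep a ξ'} : Set H))
    (hΔ : Dense (Submodule.span ℂ {ξ | ∃ a ξ', ξ = S.op (Δ a) ξ'} : Set K))
    (α α' β β' γ γ' : H) (a : A) :
    S.conv Δ (S.conv Δ (coeffFunctional S.rep α α') (coeffFunctional S.rep β β'))
        (coeffFunctional S.rep γ γ') a =
      S.conv Δ (coeffFunctional S.rep α α') (S.conv Δ (coeffFunctional S.rep β β')
        (coeffFunctional S.rep γ γ')) a := by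
  have hL : ∀ X, S.tensorFun (S.conv Δ (coeffFunctional S.rep α α') (coeffFunctional S.rep β β'))
      (coeffFunctional S.rep γ γ') X =
      ⟪T.vecL (S.vec α β) γ, T.mapL X (T.vecL (S.vec α' β') γ')⟫_ℂ := by
    refine tensorFun_eq_inner T.mapL ?_ fun a b => ?_
    · refine mem_of_mem_of_dense₂ T.vecL _ (Submodule.isClosed_topologicalClosure _) hΔ hrep ?_ _ _
      rintro _ ⟨a, ξ, rfl⟩ _ ⟨b, ξ', rfl⟩
      exact subset_closure (Submodule.subset_span ⟨S.tmul a b, T.vecL ξ ξ',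
        (T.mapL_vecL a b ξ ξ').symm⟩)
    · rw [T.mapL_vecL, T.inner_vecL, conv_apply, tensorFun_coeffFunctional hrep]
      rfl
  have hR : ∀ X, S.tensorFun (coeffFunctional S.rep α α') (S.conv Δ (coeffFunctional S.rep β β')
      (coeffFunctional S.rep γ γ')) X =
      ⟪T.vecR α (S.vec β γ), T.mapR X (T.vecR α' (S.vec β' γ'))⟫_ℂ := by
    refine tensorFun_eq_inner T.mapR ?_ fun a b => ?_
    · refine mem_of_mem_of_dense₂ T.vecR _ (Submodule.isClosed_topologicalClosure _) hrep hΔ ?_ _ _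
      rintro _ ⟨a, ξ, rfl⟩ _ ⟨b, ξ', rfl⟩
      exact subset_closure (Submodule.subset_span ⟨S.tmul a b, T.vecR ξ ξ',
        (T.mapR_vecR a b ξ ξ').symm⟩)
    · rw [T.mapR_vecR, T.inner_vecR, conv_apply, tensorFun_coeffFunctional hrep]
      rfl
  rw [conv_apply, conv_apply, hL, hR, T.mapR_comul, T.vecL_vec, T.vecL_vec]

theorem conv_assoc (T : Coassociator S Δ L) (hS : S.Cancels Δ) (hS' : S.swap.Cancels Δ)
    (hrep : Dense (Submodule.span ℂ {ξ | ∃ a ξ', ξ = S.rep a ξ'} : Set H))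
    (hΔ : Dense (Submodule.span ℂ {ξ | ∃ a ξ', ξ = S.op (Δ a) ξ'} : Set K))
    (μ ν κ : StrongDual ℂ A) :
    S.conv Δ (S.conv Δ μ ν) κ = S.conv Δ μ (S.conv Δ ν κ) := by
  have key : ∀ x y : A, (∀ α α', coeffFunctional S.rep α α' x = coeffFunctional S.rep α α' y) →
      x = y := fun x y h => S.rep_ext h
  choose l hl using fun μ a => hS.exists_slice_conv Δ μ a
  choose r hr using fun ν a => exists_slice_conv_right Δ hS' ν a
  have h1 : ∀ (μ : StrongDual ℂ A) (β β' γ γ' : H) (a : A),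
      S.conv Δ (S.conv Δ μ (coeffFunctional S.rep β β')) (coeffFunctional S.rep γ γ') a =
      S.conv Δ μ (S.conv Δ (coeffFunctional S.rep β β') (coeffFunctional S.rep γ γ')) a := by
    intro μ β β' γ γ' a
    rw [← hr, ← hr, ← hr]
    congr 1
    refine key _ _ fun α α' => ?_
    rw [hr, hr, hr]
    exact conv_assoc_coeffFunctional T hrep hΔ α α' β β' γ γ' a
  have h2 : ∀ (μ κ : StrongDual ℂ A) (β β' : H) (a : A),
      S.conv Δ (S.conv Δ μ (coeffFunctional S.rep β β')) κ a =
      S.conv Δ μ (S.conv Δ (coeffFunctional S.rep β β') κ) a := by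
    intro μ κ β β' a
    rw [← hl, ← hl μ, ← hl]
    congr 1
    refine key _ _ fun γ γ' => ?_
    rw [hl, hl, hl]
    exact h1 μ β β' γ γ' a
  ext a
  rw [← hr κ a, ← hl μ, ← hl μ, ← hr κ]
  congr 1
  refine key _ _ fun β β' => ?_
  rw [hl, hr, hr, hl]
  exact h2 μ κ β β' a

end Coassociative

end TensorSquare

theorem tendsto_of_inner_tendsto_one {L : Type*} [NormedAddCommGroup L]
    [InnerProductSpace ℂ L] {ζ : L} {y : ℕ → L} (hζ : ‖ζ‖ = 1) (hy : ∀ n, ‖y n‖ ≤ 1)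
    (h : Tendsto (fun n => ⟪ζ, y n⟫_ℂ) atTop (𝓝 1)) : Tendsto y atTop (𝓝 ζ) := by
  rw [tendsto_iff_norm_sub_tendsto_zero]
  have h1 : Tendsto (fun n => 2 - 2 * (⟪ζ, y n⟫_ℂ).re) atTop (𝓝 0) := by
    have h2 := ((Complex.continuous_re.tendsto 1).comp h).const_mul 2
    have h3 := h2.const_sub 2
    simpa using h3
  have h4 : Tendsto (fun n => ‖y n - ζ‖ ^ 2) atTop (𝓝 0) := by
    refine squeeze_zero (fun _ => by positivity) (fun n => ?_) h1
    have h5 := norm_sub_sq (𝕜 := ℂ) (y n) ζ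
    rw [inner_re_symm] at h5
    rw [h5, hζ]
    have h6 := hy n
    have h7 := norm_nonneg (y n)
    change ‖y n‖ ^ 2 - 2 * (⟪ζ, y n⟫_ℂ).re + 1 ^ 2 ≤ _
    nlinarith
  have h8 := (Real.continuous_sqrt.tendsto 0).comp h4
  rw [Real.sqrt_zero] at h8
  refine h8.congr fun n => ?_
  rw [Function.comp_apply, Real.sqrt_sq (norm_nonneg _)]

section Coefficients

variable {A : Type*} [NonUnitalCStarAlgebra A]
  {L : Type*} [NormedAddCommGroup L] [InnerProductSpace ℂ L] [CompleteSpace L]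
  (π : A →⋆ₙₐ[ℂ] (L →L[ℂ] L))

theorem tendsto_coeffFunctional {ι : Type*} {l : Filter ι} {α β : ι → L} {α' β' : L}
    (hα : Tendsto α l (𝓝 α')) (hβ : Tendsto β l (𝓝 β')) :
    Tendsto (fun n => coeffFunctional π (α n) (β n)) l (𝓝 (coeffFunctional π α' β')) := by
  rw [tendsto_iff_norm_sub_tendsto_zero]
  have h1 := ((tendsto_iff_norm_sub_tendsto_zero.mp hα).mul hβ.norm).add
    ((tendsto_iff_norm_sub_tendsto_zero.mp hβ).const_mul ‖α'‖)
  rw [zero_mul, mul_zero, add_zero] at h1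
  refine squeeze_zero (fun _ => norm_nonneg _) (fun n => ?_) h1
  have h2 : coeffFunctional π (α n) (β n) - coeffFunctional π α' β' =
      coeffFunctional π (α n - α') (β n) + coeffFunctional π α' (β n - β') := by
    ext a
    simp only [_root_.sub_apply, _root_.add_apply, coeffFunctional_apply, inner_sub_left, map_sub,
      inner_sub_right]
    ring
  rw [h2]
  exact (norm_add_le _ _).trans
    (add_le_add (norm_coeffFunctional_le π _ _) (norm_coeffFunctional_le π _ _))

theorem tendsto_apply_sub_of_norm_le_one {ι : Type*} {l : Filter ι} {μ : ι → StrongDual ℂ A}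
    {ν : StrongDual ℂ A} (h : Tendsto μ l (𝓝 ν)) {x : ι → A} {C : ℝ} (hx : ∀ n, ‖x n‖ ≤ C) :
    Tendsto (fun n => μ n (x n) - ν (x n)) l (𝓝 0) := by
  rw [tendsto_zero_iff_norm_tendsto_zero]
  have h1 := (tendsto_iff_norm_sub_tendsto_zero.mp h).mul_const C
  rw [zero_mul] at h1
  refine squeeze_zero (fun _ => norm_nonneg _) (fun n => ?_) h1
  rw [← _root_.sub_apply]
  exact ((μ n - ν).le_opNorm _).trans (mul_le_mul_of_nonneg_left (hx n) (norm_nonneg _))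

/-- A sequence in the unit ball on which the coefficient `⟪ξ, · η⟫` tends to one. -/
structure Norming (ξ η : L) (x : ℕ → A) : Prop where
  norm_left : ‖ξ‖ = 1
  norm_right : ‖η‖ = 1
  norm_le : ∀ n, ‖x n‖ ≤ 1
  tendsto : Tendsto (fun n => coeffFunctional π ξ η (x n)) atTop (𝓝 1)

variable {π} {ξ η : L} {x : ℕ → A}

theorem norm_rep_apply_le_one {a : A} {ζ : L} (ha : ‖a‖ ≤ 1) (hζ : ‖ζ‖ = 1) : ‖π a ζ‖ ≤ 1 := by
  have h := norm_rep_apply_le π a ζ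
  rw [hζ, mul_one] at h
  exact h.trans ha

theorem Norming.symm (h : Norming π ξ η x) : Norming π η ξ fun n => star (x n) where
  norm_left := h.norm_right
  norm_right := h.norm_left
  norm_le := fun n => by
    rw [norm_star]
    exact h.norm_le n
  tendsto := by
    have h1 := ((continuous_star (R := ℂ)).tendsto 1).comp h.tendsto
    rw [star_one] at h1
    refine h1.congr fun n => ?_
    rw [Function.comp_apply, ← conjFunctional_coeffFunctional π ξ η, conjFunctional_apply,
      star_star]

theorem Norming.tendsto_apply (h : Norming π ξ η x) :
    Tendsto (fun n => π (x n) η) atTop (𝓝 ξ) :=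
  tendsto_of_inner_tendsto_one h.norm_left
    (fun n => norm_rep_apply_le_one (h.norm_le n) h.norm_right) h.tendsto

theorem exists_norming (hξ : ‖ξ‖ = 1) (hη : ‖η‖ = 1) (h : ‖coeffFunctional π ξ η‖ = 1) :
    ∃ x, Norming π ξ η x := by
  have h1 : ∀ n : ℕ, ∃ c : A, ‖c‖ ≤ 1 ∧
      ‖coeffFunctional π ξ η‖ - 1 / ((n : ℝ) + 1) < ‖coeffFunctional π ξ η c‖ := fun n =>
    exists_norm_le_one_lt_norm_apply _ (by positivity)
  choose c hc hc' using h1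
  have h2 : ∀ n, ∃ z : ℂ, ‖z‖ = 1 ∧ z * coeffFunctional π ξ η (c n) =
      (‖coeffFunctional π ξ η (c n)‖ : ℂ) := by
    intro n
    obtain ⟨z, hz, hz'⟩ := RCLike.exists_norm_eq_mul_self (coeffFunctional π ξ η (c n))
    exact ⟨z, hz, hz'.symm⟩
  choose z hz hz' using h2
  refine ⟨fun n => z n • c n, hξ, hη, fun n => ?_, ?_⟩
  · rw [norm_smul, hz, one_mul]
    exact hc n
  · have h3 : Tendsto (fun n => ‖coeffFunctional π ξ η (c n)‖) atTop (𝓝 1) := by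
      have h4 : Tendsto (fun n : ℕ => (1 : ℝ) - 1 / ((n : ℝ) + 1)) atTop (𝓝 1) := by
        simpa using tendsto_one_div_add_atTop_nhds_zero_nat.const_sub (1 : ℝ)
      refine tendsto_of_tendsto_of_tendsto_of_le_of_le h4 tendsto_const_nhds
        (fun n => ?_) fun n => ?_
      · have := hc' n
        rw [h] at this
        exact this.le
      · refine ((coeffFunctional π ξ η).le_opNorm _).trans ?_
        rw [h, one_mul]
        exact hc n
    have h5 := (Complex.continuous_ofReal.tendsto 1).comp h3
    rw [Complex.ofReal_one] at h5
    refine h5.congr fun n => ?_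
    rw [Function.comp_apply, ← hz', map_smul, smul_eq_mul]

end Coefficients

namespace TensorSquare

variable {A E M H K : Type*} [NonUnitalCStarAlgebra A] [NonUnitalCStarAlgebra E]
    [Ring M] [StarRing M] [Algebra ℂ M]
    [NormedAddCommGroup H] [InnerProductSpace ℂ H]
    [CompleteSpace H] [NormedAddCommGroup K] [InnerProductSpace ℂ K] [CompleteSpace K]
    {S : TensorSquare A E M H K} {Δ : A →⋆ₙₐ[ℂ] M}
  {L : Type*} [NormedAddCommGroup L] [InnerProductSpace ℂ L] [CompleteSpace L]
  {π : A →⋆ₙₐ[ℂ] (L →L[ℂ] L)} {ξ η : L} {x : ℕ → A}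

theorem tensorFun_tmul (μ ν : StrongDual ℂ A) (a b : A) :
    S.tensorFun μ ν (S.incl (S.tmul a b)) = μ a * ν b := by
  rw [tensorFun_incl, dualTmul_tmul]

theorem star_incl_tmul (a b : A) :
    star (S.incl (S.tmul a b)) = S.incl (S.tmul (star a) (star b)) := by
  rw [← map_star, star_tmul]

theorem incl_tmul_mul_incl_tmul (a b c d : A) :
    S.incl (S.tmul a b) * S.incl (S.tmul c d) = S.incl (S.tmul (a * c) (b * d)) := by
  rw [← map_mul, tmul_mul_tmul]

variable [StarModule ℂ M]

/-- The Cauchy-Schwarz inequality for the tensor square of a vector functional. -/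
theorem norm_tensorFun_mul_sq_le (π : A →⋆ₙₐ[ℂ] (L →L[ℂ] L)) (ξ : L) (Z X : M) :
    ‖S.tensorFun (coeffFunctional π ξ ξ) (coeffFunctional π ξ ξ) (Z * X)‖ ^ 2 ≤
      (S.tensorFun (coeffFunctional π ξ ξ) (coeffFunctional π ξ ξ) (Z * star Z)).re *
      (S.tensorFun (coeffFunctional π ξ ξ) (coeffFunctional π ξ ξ) (star X * X)).re := by
  have hconj : ∀ Y, S.tensorFun (coeffFunctional π ξ ξ) (coeffFunctional π ξ ξ) (star Y) =
      starRingEnd ℂ (S.tensorFun (coeffFunctional π ξ ξ) (coeffFunctional π ξ ξ) Y) := by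
    intro Y
    rw [tensorFun_conj, conjFunctional_coeffFunctional]
    rfl
  let core : PreInnerProductSpace.Core ℂ M :=
    { inner := fun X Y =>
        S.tensorFun (coeffFunctional π ξ ξ) (coeffFunctional π ξ ξ) (star X * Y)
      conj_inner_symm := fun X Y => by rw [← hconj, star_mul, star_star]
      re_inner_nonneg := fun X => (Complex.le_def.mp
        (S.tensorFun_star_mul_self_nonneg (isPositiveFunctional_coeffFunctional π ξ)
          (isPositiveFunctional_coeffFunctional π ξ) X)).1
      add_left := fun X Y Z => by rw [star_add, add_mul, map_add]
      smul_left := fun X Y c => by rw [star_smul, smul_mul_assoc, map_smul]; rfl }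
  have h := InnerProductSpace.Core.inner_mul_inner_self_le (c := core) (star Z) X
  have h1 : core.inner (star Z) X =
      S.tensorFun (coeffFunctional π ξ ξ) (coeffFunctional π ξ ξ) (Z * X) := by
    change S.tensorFun _ _ (star (star Z) * X) = _
    rw [star_star]
  have h2 : ‖core.inner X (star Z)‖ = ‖core.inner (star Z) X‖ := by
    rw [← core.conj_inner_symm, RCLike.norm_conj]
  have h3 : core.inner (star Z) (star Z) =
      S.tensorFun (coeffFunctional π ξ ξ) (coeffFunctional π ξ ξ) (Z * star Z) := by
    change S.tensorFun _ _ (star (star Z) * star Z) = _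
    rw [star_star]
  change ‖core.inner (star Z) X‖ * ‖core.inner X (star Z)‖ ≤
    RCLike.re (core.inner (star Z) (star Z)) * RCLike.re (core.inner X X) at h
  rw [h2, h3, h1, ← sq] at h
  exact h

end TensorSquare

namespace TensorSquare

variable {A E M H K : Type*} [NonUnitalCStarAlgebra A] [NonUnitalCStarAlgebra E]
    [Ring M] [StarRing M] [Algebra ℂ M] [StarModule ℂ M]
    [NormedAddCommGroup H] [InnerProductSpace ℂ H]
    [CompleteSpace H] [NormedAddCommGroup K] [InnerProductSpace ℂ K] [CompleteSpace K]
    {S : TensorSquare A E M H K} {Δ : A →⋆ₙₐ[ℂ] M}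
  {L : Type*} [NormedAddCommGroup L] [InnerProductSpace ℂ L] [CompleteSpace L]
  {π : A →⋆ₙₐ[ℂ] (L →L[ℂ] L)} {ξ η : L} {x : ℕ → A}

theorem tendsto_tensorFun_mul {ι : Type*} {l : Filter ι} {X : ι → M} {u : ι → ℝ}
    (hX : ∀ᶠ n in l, (S.tensorFun (coeffFunctional π ξ ξ) (coeffFunctional π ξ ξ)
      (star (X n) * X n)).re ≤ u n) (hu : Tendsto u l (𝓝 0)) (Z : M) :
    Tendsto (fun n => S.tensorFun (coeffFunctional π ξ ξ) (coeffFunctional π ξ ξ) (Z * X n)) l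
      (𝓝 0) := by
  have h1 := hu.const_mul (S.tensorFun (coeffFunctional π ξ ξ) (coeffFunctional π ξ ξ)
    (Z * star Z)).re
  rw [mul_zero] at h1
  have h0 : 0 ≤ (S.tensorFun (coeffFunctional π ξ ξ) (coeffFunctional π ξ ξ) (Z * star Z)).re := by
    have h := S.tensorFun_star_mul_self_nonneg (isPositiveFunctional_coeffFunctional π ξ)
      (isPositiveFunctional_coeffFunctional π ξ) (star Z)
    rw [star_star] at h
    exact (Complex.le_def.mp h).1
  have h2 : Tendsto (fun n => ‖S.tensorFun (coeffFunctional π ξ ξ) (coeffFunctional π ξ ξ)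
      (Z * X n)‖ ^ 2) l (𝓝 0) := by
    refine squeeze_zero' (Eventually.of_forall fun _ => by positivity) ?_ h1
    filter_upwards [hX] with n hn
    exact (norm_tensorFun_mul_sq_le π ξ Z (X n)).trans (mul_le_mul_of_nonneg_left hn h0)
  rw [tendsto_zero_iff_norm_tendsto_zero]
  have h8 := (Real.continuous_sqrt.tendsto 0).comp h2
  rw [Real.sqrt_zero] at h8
  refine h8.congr fun n => ?_
  rw [Function.comp_apply, Real.sqrt_sq (norm_nonneg _)]

/-- Cauchy-Schwarz with a one-sided translate. -/
theorem tendsto_tensorFun_rightTranslate_mul {ι : Type*} {l : Filter ι} {X : ι → M} {u : ι → ℝ}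
    (hX : ∀ n, (S.tensorFun (coeffFunctional π ξ ξ) (coeffFunctional π ξ ξ)
      (star (X n) * X n)).re ≤ u n) (hu : Tendsto u l (𝓝 0)) (y : A) (Z : M) :
    Tendsto (fun n => S.tensorFun (rightTranslate (coeffFunctional π ξ ξ) y)
      (coeffFunctional π ξ ξ) (Z * X n)) l (𝓝 0) := by
  let C : ℝ := ‖π (star y) ξ‖ ^ 2 * ‖ξ‖ ^ 2 * ‖S.op (Z * star Z)‖
  have key : ∀ n, ‖S.tensorFun (rightTranslate (coeffFunctional π ξ ξ) y)
      (coeffFunctional π ξ ξ) (Z * X n)‖ ^ 2 ≤ C * u n := by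
    intro n
    have hu0 : 0 ≤ u n := (Complex.le_def.mp (S.tensorFun_star_mul_self_nonneg
      (isPositiveFunctional_coeffFunctional π ξ)
      (isPositiveFunctional_coeffFunctional π ξ) (X n))).1.trans (hX n)
    have hlim : Tendsto (fun e => S.tensorFun (rightTranslate (coeffFunctional π ξ ξ) y)
        (rightTranslate (coeffFunctional π ξ ξ) e) (Z * X n)) (approxUnit A)
        (𝓝 (S.tensorFun (rightTranslate (coeffFunctional π ξ ξ) y)
          (coeffFunctional π ξ ξ) (Z * X n))) := by
      rw [tendsto_iff_norm_sub_tendsto_zero]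
      have h1 := ((tendsto_iff_norm_sub_tendsto_zero.mp
        (tendsto_rightTranslate_approxUnit (coeffFunctional π ξ ξ))).const_mul
        ‖rightTranslate (coeffFunctional π ξ ξ) y‖).mul_const ‖S.op (Z * X n)‖
      rw [mul_zero, zero_mul] at h1
      refine squeeze_zero (fun _ => norm_nonneg _) (fun e => ?_) h1
      have h2 := S.tensorFun_add_right (rightTranslate (coeffFunctional π ξ ξ) y)
        (rightTranslate (coeffFunctional π ξ ξ) e - coeffFunctional π ξ ξ)
        (coeffFunctional π ξ ξ) (Z * X n)
      rw [sub_add_cancel] at h2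
      rw [h2, add_sub_cancel_right]
      exact S.norm_tensorFun_apply_le _ _ _
    refine le_of_tendsto (hlim.norm.pow 2) ?_
    filter_upwards [eventually_approxUnit_norm_le] with e he
    rw [← tensorFun_tmul_mul, ← mul_assoc]
    refine (norm_tensorFun_mul_sq_le π ξ _ (X n)).trans (mul_le_mul ?_ (hX n) ?_ (by positivity))
    · have h3 : S.incl (S.tmul y e) * Z * star (S.incl (S.tmul y e) * Z) =
          S.incl (S.tmul y e) * (Z * star Z) * S.incl (S.tmul (star y) (star e)) := by
        rw [star_mul, star_incl_tmul]
        simp only [mul_assoc]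
      rw [h3, tensorFun_mul_tmul, tensorFun_tmul_mul, leftTranslate_coeffFunctional,
        leftTranslate_coeffFunctional, rightTranslate_coeffFunctional,
        rightTranslate_coeffFunctional]
      have h4 : ‖π (star e) ξ‖ ≤ ‖ξ‖ := (norm_rep_apply_le π _ _).trans
        (mul_le_of_le_one_left (norm_nonneg _) (by rwa [norm_star]))
      refine (Complex.re_le_norm _).trans ((S.norm_tensorFun_apply_le _ _ _).trans
        (mul_le_mul_of_nonneg_right ?_ (norm_nonneg _)))
      rw [sq, sq]
      refine mul_le_mul (norm_coeffFunctional_le π _ _)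
        ((norm_coeffFunctional_le π _ _).trans ?_) (norm_nonneg _) (by positivity)
      exact mul_le_mul h4 h4 (norm_nonneg _) (norm_nonneg _)
    · exact (Complex.le_def.mp (S.tensorFun_star_mul_self_nonneg
        (isPositiveFunctional_coeffFunctional π ξ)
        (isPositiveFunctional_coeffFunctional π ξ) (X n))).1
  have h1 := hu.const_mul C
  rw [mul_zero] at h1
  have h2 := squeeze_zero (fun _ => by positivity) key h1
  rw [tendsto_zero_iff_norm_tendsto_zero]
  have h8 := (Real.continuous_sqrt.tendsto 0).comp h2
  rw [Real.sqrt_zero] at h8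
  refine h8.congr fun n => ?_
  rw [Function.comp_apply, Real.sqrt_sq (norm_nonneg _)]

end TensorSquare

theorem tendsto_bilinear {X Y Z : Type*} [NormedAddCommGroup X] [NormedSpace ℂ X]
    [NormedAddCommGroup Y] [NormedSpace ℂ Y] [NormedAddCommGroup Z] [NormedSpace ℂ Z]
    (B : X →L[ℂ] Y →L[ℂ] Z) {ι : Type*} {l : Filter ι} {u : ι → X} {v : ι → Y} {p : X} {q : Y}
    (hu : Tendsto u l (𝓝 p)) (hv : Tendsto v l (𝓝 q)) :
    Tendsto (fun n => B (u n) (v n)) l (𝓝 (B p q)) :=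
  (B.continuous₂.tendsto (p, q)).comp (hu.prodMk_nhds hv)

namespace TensorSquare

variable {A E M H K : Type*} [NonUnitalCStarAlgebra A] [NonUnitalCStarAlgebra E]
    [Ring M] [StarRing M] [Algebra ℂ M]
    [NormedAddCommGroup H] [InnerProductSpace ℂ H]
    [CompleteSpace H] [NormedAddCommGroup K] [InnerProductSpace ℂ K] [CompleteSpace K]
    {S : TensorSquare A E M H K} {Δ : A →⋆ₙₐ[ℂ] M}
  {L : Type*} [NormedAddCommGroup L] [InnerProductSpace ℂ L] [CompleteSpace L]
  {π : A →⋆ₙₐ[ℂ] (L →L[ℂ] L)} {ξ η : L} {x : ℕ → A}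

theorem tendsto_conv {ι : Type*} {l : Filter ι} {μ ν : ι → StrongDual ℂ A}
    {μ' ν' : StrongDual ℂ A} (hμ : Tendsto μ l (𝓝 μ')) (hν : Tendsto ν l (𝓝 ν')) :
    Tendsto (fun n => S.conv Δ (μ n) (ν n)) l (𝓝 (S.conv Δ μ' ν')) :=
  tendsto_bilinear (S.conv Δ) hμ hν

theorem tensorFun_comul_mul_tmul (μ ν : StrongDual ℂ A) (a b c : A) :
    S.tensorFun μ ν (Δ a * S.incl (S.tmul b c)) =
      S.conv Δ (leftTranslate μ b) (leftTranslate ν c) a := by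
  rw [tensorFun_mul_tmul, conv_apply]

theorem tensorFun_tmul_mul_comul (μ ν : StrongDual ℂ A) (a b c : A) :
    S.tensorFun μ ν (S.incl (S.tmul b c) * Δ a) =
      S.conv Δ (rightTranslate μ b) (rightTranslate ν c) a := by
  rw [tensorFun_tmul_mul, conv_apply]

theorem tensorFun_self_star (ξ : L) (X : M) :
    S.tensorFun (coeffFunctional π ξ ξ) (coeffFunctional π ξ ξ) (star X) =
      star (S.tensorFun (coeffFunctional π ξ ξ) (coeffFunctional π ξ ξ) X) := by
  rw [tensorFun_conj, conjFunctional_coeffFunctional]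

/-- Expansion of `|Δ(x) - a ⊗ b|²`. -/
theorem tensorFun_comul_sub_tmul (ξ : L) (x a b : A) :
    S.tensorFun (coeffFunctional π ξ ξ) (coeffFunctional π ξ ξ)
      (star (Δ x - S.incl (S.tmul a b)) * (Δ x - S.incl (S.tmul a b))) =
      S.conv Δ (coeffFunctional π ξ ξ) (coeffFunctional π ξ ξ) (star x * x) -
        S.conv Δ (coeffFunctional π (π a ξ) ξ) (coeffFunctional π (π b ξ) ξ) x -
        star (S.conv Δ (coeffFunctional π (π a ξ) ξ) (coeffFunctional π (π b ξ) ξ) x) +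
        coeffFunctional π ξ ξ (star a * a) * coeffFunctional π ξ ξ (star b * b) := by
  have h1 : star (Δ x - S.incl (S.tmul a b)) * (Δ x - S.incl (S.tmul a b)) =
      Δ (star x * x) - S.incl (S.tmul (star a) (star b)) * Δ x -
        star (S.incl (S.tmul (star a) (star b)) * Δ x) +
        S.incl (S.tmul (star a * a) (star b * b)) := by
    rw [star_sub, star_mul, star_incl_tmul, star_incl_tmul, star_star, star_star, ← map_star,
      ← incl_tmul_mul_incl_tmul, map_mul]
    noncomm_ring
  rw [h1, map_add, map_sub, map_sub, tensorFun_self_star, tensorFun_tmul, tensorFun_tmul_mul_comul,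
    rightTranslate_coeffFunctional, rightTranslate_coeffFunctional, star_star, star_star,
    ← conv_apply]

theorem norm_coeffFunctional_le_one {α β : L} (hα : ‖α‖ ≤ 1) (hβ : ‖β‖ ≤ 1) :
    ‖coeffFunctional π α β‖ ≤ 1 :=
  (norm_coeffFunctional_le π α β).trans (mul_le_one₀ hα (norm_nonneg _) hβ)

theorem re_coeffFunctional_star_mul_self_le (hξ : ‖ξ‖ = 1) {a : A} (ha : ‖a‖ ≤ 1) :
    coeffFunctional π ξ ξ (star a * a) = (‖π a ξ‖ ^ 2 : ℝ) ∧ ‖π a ξ‖ ^ 2 ≤ 1 :=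
  ⟨re_coeffFunctional_self π ξ a,
    pow_le_one₀ (norm_nonneg _) (norm_rep_apply_le_one ha hξ)⟩

theorem re_conv_le_one {α α' β β' : L} (hα : ‖α‖ ≤ 1) (hα' : ‖α'‖ ≤ 1) (hβ : ‖β‖ ≤ 1)
    (hβ' : ‖β'‖ ≤ 1) {a : A} (ha : ‖a‖ ≤ 1) :
    (S.conv Δ (coeffFunctional π α α') (coeffFunctional π β β') a).re ≤ 1 := by
  refine (Complex.re_le_norm _).trans ((ContinuousLinearMap.le_opNorm _ _).trans ?_)
  refine mul_le_one₀ ((S.norm_conv_le Δ _ _).trans ?_) (norm_nonneg _) ha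
  exact mul_le_one₀ (norm_coeffFunctional_le_one hα hα') (norm_nonneg _)
    (norm_coeffFunctional_le_one hβ hβ')

theorem norm_star_mul_self_le_one {a : A} (ha : ‖a‖ ≤ 1) : ‖star a * a‖ ≤ 1 := by
  rw [CStarRing.norm_star_mul_self]
  exact mul_le_one₀ ha (norm_nonneg _) ha

theorem tendsto_conv_apply_one
    (hidem : S.conv Δ (coeffFunctional π ξ η) (coeffFunctional π ξ η) = coeffFunctional π ξ η)
    (hx : Norming π ξ η x) {μ : ℕ → StrongDual ℂ A}
    (hμ : Tendsto μ atTop (𝓝 (coeffFunctional π ξ η))) :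
    Tendsto (fun n => S.conv Δ (μ n) (μ n) (x n)) atTop (𝓝 (1 : ℝ)) := by
  have h1 := tendsto_conv (S := S) (Δ := Δ) hμ hμ
  rw [hidem] at h1
  have h2 := (tendsto_apply_sub_of_norm_le_one h1 hx.norm_le).add hx.tendsto
  simpa using h2

theorem tendsto_two_mul_sub {ι : Type*} {l : Filter ι} {z : ι → ℂ} {s : ℝ} (h : Tendsto z l (𝓝 s)) :
    Tendsto (fun n => 2 * s - 2 * (z n).re) l (𝓝 0) := by
  have h1 := (((Complex.continuous_re.tendsto s).comp h).const_mul 2).const_sub (2 * s)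
  rwa [Complex.ofReal_re, sub_self] at h1

variable [StarModule ℂ M]

theorem conv_self_of_norming (hx : Norming π ξ η x)
    (hidem : S.conv Δ (coeffFunctional π ξ η) (coeffFunctional π ξ η) = coeffFunctional π ξ η) :
    S.conv Δ (coeffFunctional π ξ ξ) (coeffFunctional π ξ ξ) = coeffFunctional π ξ ξ := by
  have hw : Tendsto (fun n => coeffFunctional π ξ (π (star (x n)) ξ)) atTop
      (𝓝 (coeffFunctional π ξ η)) :=
    tendsto_coeffFunctional π tendsto_const_nhds hx.symm.tendsto_apply
  have hz := tendsto_two_mul_sub (s := 1) (tendsto_conv_apply_one hidem hx hw)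
  have hξ1 := hx.norm_left.le
  have hxξ : ∀ n, ‖π (star (x n)) ξ‖ ≤ 1 := fun n =>
    norm_rep_apply_le_one (hx.symm.norm_le n) hx.norm_left
  have hX : ∀ n, (S.tensorFun (coeffFunctional π ξ ξ) (coeffFunctional π ξ ξ)
      (star (1 - Δ (x n) * S.incl (S.tmul (star (x n)) (star (x n)))) *
        (1 - Δ (x n) * S.incl (S.tmul (star (x n)) (star (x n)))))).re ≤
      2 * 1 - 2 * (S.conv Δ (coeffFunctional π ξ (π (star (x n)) ξ))
        (coeffFunctional π ξ (π (star (x n)) ξ)) (x n)).re := by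
    intro n
    have h1 : star (1 - Δ (x n) * S.incl (S.tmul (star (x n)) (star (x n)))) *
        (1 - Δ (x n) * S.incl (S.tmul (star (x n)) (star (x n)))) =
        1 - Δ (x n) * S.incl (S.tmul (star (x n)) (star (x n))) -
          star (Δ (x n) * S.incl (S.tmul (star (x n)) (star (x n)))) +
          S.incl (S.tmul (x n) (x n)) * Δ (star (x n) * x n) *
            S.incl (S.tmul (star (x n)) (star (x n))) := by
      rw [star_sub, star_one, star_mul, star_incl_tmul, star_star, map_mul, map_star]
      noncomm_ring
    rw [h1, map_add, map_sub, map_sub, tensorFun_self_star, tensorFun_comul_mul_tmul,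
      tensorFun_mul_tmul, tensorFun_tmul_mul_comul, leftTranslate_coeffFunctional,
      rightTranslate_coeffFunctional]
    have h2 : (S.tensorFun (coeffFunctional π ξ ξ) (coeffFunctional π ξ ξ) (1 : M)).re ≤ 1 := by
      refine (Complex.re_le_norm _).trans ((S.norm_tensorFun_apply_le _ _ _).trans ?_)
      refine mul_le_one₀ (mul_le_one₀ (norm_coeffFunctional_le_one hξ1 hξ1) (norm_nonneg _)
        (norm_coeffFunctional_le_one hξ1 hξ1)) (norm_nonneg _) ?_
      rw [map_one]
      exact ContinuousLinearMap.norm_id_le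
    have h3 := re_conv_le_one (S := S) (Δ := Δ) (π := π) (hxξ n) (hxξ n) (hxξ n) (hxξ n)
      (norm_star_mul_self_le_one (hx.norm_le n))
    rw [Complex.add_re, Complex.sub_re, Complex.sub_re, Complex.star_def, Complex.conj_re]
    linarith
  ext a
  have h4 := tendsto_tensorFun_mul (Eventually.of_forall hX) hz (Δ a)
  have h5 : ∀ n, S.tensorFun (coeffFunctional π ξ ξ) (coeffFunctional π ξ ξ)
      (Δ a * (1 - Δ (x n) * S.incl (S.tmul (star (x n)) (star (x n))))) =
      S.conv Δ (coeffFunctional π ξ ξ) (coeffFunctional π ξ ξ) a -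
        S.conv Δ (coeffFunctional π ξ (π (star (x n)) ξ))
          (coeffFunctional π ξ (π (star (x n)) ξ)) (a * x n) := by
    intro n
    rw [mul_sub, mul_one, ← mul_assoc, ← map_mul, map_sub, tensorFun_comul_mul_tmul,
      leftTranslate_coeffFunctional]
    rfl
  simp_rw [h5] at h4
  have h6 := tendsto_conv (S := S) (Δ := Δ) hw hw
  rw [hidem] at h6
  have h7 := tendsto_apply_sub_of_norm_le_one h6 (x := fun n => a * x n) (C := ‖a‖) fun n =>
    (norm_mul_le _ _).trans (mul_le_of_le_one_right (norm_nonneg _) (hx.norm_le n))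
  have h8 : Tendsto (fun n => coeffFunctional π ξ η (a * x n)) atTop
      (𝓝 (coeffFunctional π ξ ξ a)) := by
    have h9 := tendsto_coeffFunctional π (tendsto_const_nhds (x := ξ)) hx.tendsto_apply
    have h10 := (ContinuousLinearMap.apply ℂ ℂ a).continuous.tendsto _ |>.comp h9
    refine h10.congr fun n => ?_
    rw [Function.comp_apply, ← leftTranslate_coeffFunctional]
    rfl
  have h11 := (h4.add h7).add h8
  simp only [sub_add_sub_cancel, sub_add_cancel, zero_add] at h11
  exact tendsto_nhds_unique tendsto_const_nhds h11

end TensorSquare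

namespace TensorSquare

variable {A E M H K : Type*} [NonUnitalCStarAlgebra A] [NonUnitalCStarAlgebra E]
    [Ring M] [StarRing M] [Algebra ℂ M]
    [NormedAddCommGroup H] [InnerProductSpace ℂ H]
    [CompleteSpace H] [NormedAddCommGroup K] [InnerProductSpace ℂ K] [CompleteSpace K]
    {S : TensorSquare A E M H K} {Δ : A →⋆ₙₐ[ℂ] M}
  {L : Type*} [NormedAddCommGroup L] [InnerProductSpace ℂ L] [CompleteSpace L]
  {π : A →⋆ₙₐ[ℂ] (L →L[ℂ] L)} {ξ η : L} {x : ℕ → A}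

theorem Cancels.apply_mul_eq_of_rightTranslate (hS : S.Cancels Δ) {μ ν ν' : StrongDual ℂ A}
    (h : ∀ c, S.conv Δ (rightTranslate μ c) ν = S.conv Δ (rightTranslate μ c) ν') (a b : A) :
    μ a * ν b = μ a * ν' b := by
  have h1 : ∀ c, S.conv Δ (leftTranslate (conjFunctional μ) c) (conjFunctional ν) =
      S.conv Δ (leftTranslate (conjFunctional μ) c) (conjFunctional ν') := by
    intro c
    have h2 := congrArg conjFunctional (h (star c))
    rwa [conjFunctional_conv, conjFunctional_conv, conjFunctional_rightTranslate, star_star] at h2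
  have h3 := congrArg star (hS.apply_mul_eq_of_leftTranslate h1 (star a) (star b))
  simpa [conjFunctional_apply] using h3

/-- Properties of a comultiplication on `S` used for idempotent functionals. -/
structure IsComul (S : TensorSquare A E M H K) (Δ : A →⋆ₙₐ[ℂ] M) : Prop where
  assoc : ∀ μ ν κ, S.conv Δ (S.conv Δ μ ν) κ = S.conv Δ μ (S.conv Δ ν κ)
  cancels : S.Cancels Δ
  exists_slice : ∀ (ν : StrongDual ℂ A) (a : A), ∃ b, ∀ μ : StrongDual ℂ A, μ b = S.conv Δ μ ν a

variable [StarModule ℂ M]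

/-- An idempotent state absorbs its translates. -/
theorem IsComul.conv_rightTranslate (hΔ : IsComul S Δ) (hξ : ‖ξ‖ = 1)
    (hidem : S.conv Δ (coeffFunctional π ξ ξ) (coeffFunctional π ξ ξ) = coeffFunctional π ξ ξ)
    (y : A) : S.conv Δ (rightTranslate (coeffFunctional π ξ ξ) y) (coeffFunctional π ξ ξ) =
      coeffFunctional π ξ ξ y • coeffFunctional π ξ ξ := by
  have key : ∀ b : A, S.conv Δ (coeffFunctional π (π b ξ) ξ) (coeffFunctional π ξ ξ) b =
      coeffFunctional π ξ ξ (star b * b) → ∀ c, S.conv Δ (rightTranslate (coeffFunctional π ξ ξ) c)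
      (rightTranslate (coeffFunctional π ξ ξ) y) b =
      rightTranslate (coeffFunctional π ξ ξ) c b * coeffFunctional π ξ ξ y := by
    intro b hb c
    have h1 : Tendsto (fun e => coeffFunctional π (π e ξ) ξ) (approxUnit A)
        (𝓝 (coeffFunctional π ξ ξ)) := by
      refine (tendsto_rightTranslate_approxUnit (coeffFunctional π ξ ξ)).congr' ?_
      filter_upwards [eventually_approxUnit_star_eq] with e he
      rw [rightTranslate_coeffFunctional, he]
    have h2 := ((S.conv Δ (coeffFunctional π (π b ξ) ξ)).continuous.tendsto _).comp h1
    have h3 := ((ContinuousLinearMap.apply ℂ ℂ b).continuous.tendsto _).comp h2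
    change Tendsto (fun e => S.conv Δ (coeffFunctional π (π b ξ) ξ)
      (coeffFunctional π (π e ξ) ξ) b) _ (𝓝 (S.conv Δ (coeffFunctional π (π b ξ) ξ)
      (coeffFunctional π ξ ξ) b)) at h3
    rw [hb, re_coeffFunctional_self] at h3
    have h4 := tendsto_tensorFun_mul (S := S) (π := π) (ξ := ξ)
      (X := fun e => Δ b - S.incl (S.tmul b e)) (l := approxUnit A) (by
        filter_upwards [eventually_approxUnit_norm_le] with e he
        obtain ⟨h5, h6⟩ := re_coeffFunctional_star_mul_self_le (π := π) hξ he
        rw [tensorFun_comul_sub_tmul, hidem, h5, re_coeffFunctional_self, Complex.add_re,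
          Complex.sub_re, Complex.sub_re, Complex.star_def, Complex.conj_re, ← Complex.ofReal_mul,
          Complex.ofReal_re, Complex.ofReal_re]
        have h7 := mul_le_of_le_one_right (sq_nonneg ‖π b ξ‖) h6
        change _ ≤ 2 * ‖π b ξ‖ ^ 2 - 2 * (S.conv Δ (coeffFunctional π (π b ξ) ξ)
          (coeffFunctional π (π e ξ) ξ) b).re
        linarith) (tendsto_two_mul_sub h3) (S.incl (S.tmul c y))
    have h8 : Tendsto (fun e => rightTranslate (coeffFunctional π ξ ξ) c b *
        coeffFunctional π ξ ξ (y * e)) (approxUnit A)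
        (𝓝 (rightTranslate (coeffFunctional π ξ ξ) c b * coeffFunctional π ξ ξ y)) :=
      (((coeffFunctional π ξ ξ).continuous.tendsto y).comp (tendsto_mul_approxUnit y)).const_mul _
    have h9 := h4.add h8
    rw [zero_add] at h9
    refine tendsto_nhds_unique tendsto_const_nhds (h9.congr fun e => ?_)
    rw [mul_sub, map_sub, incl_tmul_mul_incl_tmul, tensorFun_tmul, tensorFun_tmul_mul_comul]
    exact sub_add_cancel _ _
  have h1 : ∀ c, S.conv Δ (rightTranslate (coeffFunctional π ξ ξ) c)
      (S.conv Δ (rightTranslate (coeffFunctional π ξ ξ) y) (coeffFunctional π ξ ξ)) =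
      S.conv Δ (rightTranslate (coeffFunctional π ξ ξ) c)
        (coeffFunctional π ξ ξ y • coeffFunctional π ξ ξ) := by
    intro c
    ext a
    obtain ⟨b, hb⟩ := hΔ.exists_slice (coeffFunctional π ξ ξ) a
    rw [← hΔ.assoc, ← hb, key b ?_ c, hb, map_smul, _root_.smul_apply, smul_eq_mul, mul_comm]
    rw [hb (S.conv Δ _ _), hΔ.assoc, hidem, ← hb, ← star_star b, ← rightTranslate_coeffFunctional, star_star]
    rfl
  have h2 := hΔ.cancels.apply_mul_eq_of_rightTranslate h1
  by_cases h0 : ∀ a, coeffFunctional π ξ ξ a = 0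
  · have h3 : coeffFunctional π ξ ξ = 0 := ContinuousLinearMap.ext h0
    have h4 : S.conv Δ (rightTranslate (coeffFunctional π ξ ξ) y) 0 = 0 := map_zero _
    rw [h3] at h4 ⊢
    rw [h4]
    ext b
    exact (zero_mul _).symm
  push Not at h0
  obtain ⟨a, ha⟩ := h0
  ext b
  exact mul_left_cancel₀ ha (h2 a b)

/-- Convolution by the adjoint of a contractive idempotent, evaluated on translates. -/
theorem IsComul.conv_rightTranslate_of_norming (hΔ : IsComul S Δ) (hx : Norming π ξ η x)
    (hidem : S.conv Δ (coeffFunctional π ξ η) (coeffFunctional π ξ η) = coeffFunctional π ξ η)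
    (hidem' : S.conv Δ (coeffFunctional π η η) (coeffFunctional π η η) = coeffFunctional π η η)
    (c : A) : S.conv Δ (rightTranslate (coeffFunctional π ξ ξ) c) (coeffFunctional π η ξ) =
      coeffFunctional π ξ η c • coeffFunctional π η ξ := by
  have hxη : Tendsto (fun n => π (x n) η) atTop (𝓝 ξ) := hx.tendsto_apply
  have hz := tendsto_two_mul_sub (s := 1) (tendsto_conv_apply_one hidem hx
    (tendsto_coeffFunctional π hxη (tendsto_const_nhds (x := η))))
  have hX : ∀ n, (S.tensorFun (coeffFunctional π η η) (coeffFunctional π η η)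
      (star (Δ (x n) - S.incl (S.tmul (x n) (x n))) *
        (Δ (x n) - S.incl (S.tmul (x n) (x n))))).re ≤
      2 * 1 - 2 * (S.conv Δ (coeffFunctional π (π (x n) η) η)
        (coeffFunctional π (π (x n) η) η) (x n)).re := by
    intro n
    obtain ⟨h5, h6⟩ := re_coeffFunctional_star_mul_self_le (π := π) hx.norm_right (hx.norm_le n)
    have h7 := re_conv_le_one (S := S) (Δ := Δ) (π := π) hx.norm_right.le hx.norm_right.le
      hx.norm_right.le hx.norm_right.le (norm_star_mul_self_le_one (hx.norm_le n))
    have h8 := mul_le_one₀ h6 (sq_nonneg _) h6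
    rw [tensorFun_comul_sub_tmul, h5, Complex.add_re, Complex.sub_re, Complex.sub_re,
      Complex.star_def, Complex.conj_re, ← Complex.ofReal_mul, Complex.ofReal_re]
    linarith
  have key : ∀ y, S.conv Δ (rightTranslate (coeffFunctional π η ξ) y) (coeffFunctional π η ξ) =
      coeffFunctional π η η y • coeffFunctional π η ξ := by
    intro y
    ext a
    have h1 := tendsto_tensorFun_rightTranslate_mul hX hz y (Δ a)
    have h2 : Tendsto (fun n => coeffFunctional π η (π (x n) η)) atTop
        (𝓝 (coeffFunctional π η ξ)) :=
      tendsto_coeffFunctional π (tendsto_const_nhds (x := η)) hxη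
    have h3 : Tendsto (fun n => coeffFunctional π (π (star y) η) (π (x n) η)) atTop
        (𝓝 (rightTranslate (coeffFunctional π η ξ) y)) := by
      rw [rightTranslate_coeffFunctional]
      exact tendsto_coeffFunctional π (tendsto_const_nhds (x := π (star y) η)) hxη
    have h4 := ((ContinuousLinearMap.apply ℂ ℂ a).continuous.tendsto _).comp
      (tendsto_conv (S := S) (Δ := Δ) h3 h2)
    have h5 := (((ContinuousLinearMap.apply ℂ ℂ a).continuous.tendsto _).comp h2).const_mul
      (coeffFunctional π η η y)
    have h6 := h1.add h4
    rw [zero_add] at h6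
    refine tendsto_nhds_unique h6 (h5.congr fun n => ?_)
    change coeffFunctional π η η y * coeffFunctional π η (π (x n) η) a =
      S.tensorFun _ _ (Δ a * (Δ (x n) - S.incl (S.tmul (x n) (x n)))) +
        S.conv Δ (coeffFunctional π (π (star y) η) (π (x n) η))
          (coeffFunctional π η (π (x n) η)) a
    rw [mul_sub, map_sub, tensorFun_comul_mul_tmul, leftTranslate_coeffFunctional,
      rightTranslate_coeffFunctional, leftTranslate_coeffFunctional, sub_add_cancel, ← map_mul,
      ← conv_apply, ← rightTranslate_coeffFunctional,
      hΔ.conv_rightTranslate hx.norm_right hidem' y, ← leftTranslate_coeffFunctional]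
    rfl
  have h1 : Tendsto (fun n => rightTranslate (coeffFunctional π η ξ) (star (x n) * c)) atTop
      (𝓝 (rightTranslate (coeffFunctional π ξ ξ) c)) := by
    have h2 := tendsto_coeffFunctional π (((π (star c)).continuous.tendsto ξ).comp hxη)
      (tendsto_const_nhds (x := ξ))
    rw [← rightTranslate_coeffFunctional] at h2
    refine h2.congr fun n => ?_
    rw [rightTranslate_coeffFunctional, star_mul, star_star, map_mul]
    rfl
  have h3 : Tendsto (fun n => coeffFunctional π η η (star (x n) * c)) atTop
      (𝓝 (coeffFunctional π ξ η c)) := by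
    refine (hxη.inner (tendsto_const_nhds (x := π c η))).congr fun n => ?_
    rw [coeffFunctional_apply, map_mul]
    exact inner_rep_left π _ _ _
  have h4 := tendsto_conv (S := S) (Δ := Δ) h1 (tendsto_const_nhds (x := coeffFunctional π η ξ))
  simp_rw [key] at h4
  exact tendsto_nhds_unique h4 (h3.smul_const _)

end TensorSquare

namespace TensorSquare

variable {A E M H K : Type*} [NonUnitalCStarAlgebra A] [NonUnitalCStarAlgebra E]
    [Ring M] [StarRing M] [Algebra ℂ M]
    [NormedAddCommGroup H] [InnerProductSpace ℂ H]
    [CompleteSpace H] [NormedAddCommGroup K] [InnerProductSpace ℂ K] [CompleteSpace K]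
    {S : TensorSquare A E M H K} {Δ : A →⋆ₙₐ[ℂ] M}
  {L : Type*} [NormedAddCommGroup L] [InnerProductSpace ℂ L] [CompleteSpace L]
  {π : A →⋆ₙₐ[ℂ] (L →L[ℂ] L)} {ξ η : L} {x : ℕ → A}

theorem one_le_norm_of_conv_self {μ : StrongDual ℂ A} (h : S.conv Δ μ μ = μ) (h0 : μ ≠ 0) :
    1 ≤ ‖μ‖ := by
  have h1 := S.norm_conv_le Δ μ μ
  rw [h] at h1
  have h2 : 0 < ‖μ‖ := norm_pos_iff.mpr h0
  exact le_of_mul_le_mul_right (by rwa [one_mul]) h2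

theorem conv_conj_self
    (hidem : S.conv Δ (coeffFunctional π ξ η) (coeffFunctional π ξ η) = coeffFunctional π ξ η) :
    S.conv Δ (coeffFunctional π η ξ) (coeffFunctional π η ξ) = coeffFunctional π η ξ := by
  have h := congrArg conjFunctional hidem
  rwa [conjFunctional_conv, conjFunctional_coeffFunctional] at h

/-- `|Δ(v) - v ⊗ v|²` vanishes under `φ ⊗ φ`. -/
theorem tensorFun_comul_sub_tmul_eq_zero {v : A}
    (hφ : S.conv Δ (coeffFunctional π ξ ξ) (coeffFunctional π ξ ξ) = coeffFunctional π ξ ξ)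
    (hidem : S.conv Δ (coeffFunctional π η ξ) (coeffFunctional π η ξ) = coeffFunctional π η ξ)
    (hv : coeffFunctional π ξ η = leftTranslate (coeffFunctional π ξ ξ) v)
    (hv1 : coeffFunctional π η ξ v = 1) :
    S.tensorFun (coeffFunctional π ξ ξ) (coeffFunctional π ξ ξ)
      (star (Δ v - S.incl (S.tmul v v)) * (Δ v - S.incl (S.tmul v v))) = 0 := by
  have h1 : coeffFunctional π (π v ξ) ξ = coeffFunctional π η ξ := by
    rw [← conjFunctional_coeffFunctional, ← leftTranslate_coeffFunctional, ← hv,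
      conjFunctional_coeffFunctional]
  have h2 : coeffFunctional π ξ ξ (star v * v) = 1 := by
    rw [← hv1, ← h1, coeffFunctional_apply, coeffFunctional_apply, inner_rep_left, map_mul]
    rfl
  rw [tensorFun_comul_sub_tmul, hφ, h1, hidem, hv1, h2, star_one]
  norm_num

variable [StarModule ℂ M]

/-- The structure of a contractive idempotent, given as a coefficient of unit vectors. -/
theorem IsComul.exists_implementing (hΔ : IsComul S Δ) (hξ : ‖ξ‖ = 1) (hη : ‖η‖ = 1)
    (hnorm : ‖coeffFunctional π ξ η‖ = 1)
    (hidem : S.conv Δ (coeffFunctional π ξ η) (coeffFunctional π ξ η) = coeffFunctional π ξ η) :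
    S.conv Δ (coeffFunctional π ξ ξ) (coeffFunctional π ξ ξ) = coeffFunctional π ξ ξ ∧
    S.conv Δ (coeffFunctional π η η) (coeffFunctional π η η) = coeffFunctional π η η ∧
    ∃ v, coeffFunctional π ξ η = rightTranslate (coeffFunctional π η η) v ∧
      coeffFunctional π ξ η = leftTranslate (coeffFunctional π ξ ξ) v ∧
      S.tensorFun (coeffFunctional π ξ ξ) (coeffFunctional π ξ ξ)
        (star (Δ v - S.incl (S.tmul v v)) * (Δ v - S.incl (S.tmul v v))) = 0 ∧
      S.tensorFun (coeffFunctional π η η) (coeffFunctional π η η)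
        ((Δ v - S.incl (S.tmul v v)) * star (Δ v - S.incl (S.tmul v v))) = 0 := by
  obtain ⟨x, hx⟩ := exists_norming hξ hη hnorm
  have hidem' := conv_conj_self hidem
  have hφ := conv_self_of_norming hx hidem
  have hψ := conv_self_of_norming hx.symm hidem'
  obtain ⟨a, ha⟩ : ∃ a, coeffFunctional π η ξ a = 1 := by
    have h0 : coeffFunctional π η ξ ≠ 0 := by
      intro h0
      have h1 := congrArg norm (conjFunctional_coeffFunctional π ξ η)
      rw [norm_conjFunctional, hnorm, h0, norm_zero] at h1
      exact one_ne_zero h1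
    obtain ⟨b, hb⟩ := DFunLike.ne_iff.mp h0
    refine ⟨(coeffFunctional π η ξ b)⁻¹ • b, ?_⟩
    rw [map_smul, smul_eq_mul]
    exact inv_mul_cancel₀ hb
  obtain ⟨v, hv⟩ := hΔ.exists_slice (coeffFunctional π η ξ) a
  have h1 : coeffFunctional π ξ η = leftTranslate (coeffFunctional π ξ ξ) v := by
    ext c
    change _ = rightTranslate (coeffFunctional π ξ ξ) c v
    rw [hv, hΔ.conv_rightTranslate_of_norming hx hidem hψ c, _root_.smul_apply, ha, smul_eq_mul,
      mul_one]
  have h2 : coeffFunctional π ξ η = rightTranslate (coeffFunctional π η η) v := by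
    ext c
    change _ = leftTranslate (coeffFunctional π η η) c v
    have h3 := congrArg conjFunctional
      (hΔ.conv_rightTranslate_of_norming hx.symm hidem' hφ (star c))
    rw [conjFunctional_conv, conjFunctional_coeffFunctional, conjFunctional_rightTranslate,
      conjFunctional_coeffFunctional, star_star, conjFunctional_smul,
      conjFunctional_coeffFunctional] at h3
    rw [hv, h3, _root_.smul_apply, ha, ← conjFunctional_coeffFunctional π ξ η,
      conjFunctional_apply, star_star, star_star, smul_eq_mul, mul_one]
  have hv1 : coeffFunctional π η ξ v = 1 := by rw [hv, hidem', ha]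
  refine ⟨hφ, hψ, v, h2, h1, tensorFun_comul_sub_tmul_eq_zero hφ hidem' h1 hv1, ?_⟩
  have h4 : Δ v - S.incl (S.tmul v v) =
      star (Δ (star v) - S.incl (S.tmul (star v) (star v))) := by
    rw [star_sub, star_incl_tmul, star_star, map_star, star_star]
  rw [h4, star_star]
  refine tensorFun_comul_sub_tmul_eq_zero hψ hidem ?_ ?_
  · have h5 := congrArg conjFunctional h2
    rwa [conjFunctional_rightTranslate, conjFunctional_coeffFunctional,
      conjFunctional_coeffFunctional] at h5
  · rw [← conjFunctional_coeffFunctional π η ξ, conjFunctional_apply, star_star, hv1, star_one]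

/-- The absolute values of a contractive idempotent are idempotent states. -/
theorem IsComul.absoluteValues {A E : Type u} [NonUnitalCStarAlgebra A] [NonUnitalCStarAlgebra E]
    {S : TensorSquare A E M H K} {Δ : A →⋆ₙₐ[ℂ] M} (hΔ : IsComul S Δ) {ω : StrongDual ℂ A}
    (hω : ω ≠ 0) (hidem : S.conv Δ ω ω = ω) (hle : ‖ω‖ ≤ 1) :
    (IsState (rightAbs ω) ∧ rightAbs ω ≠ 0 ∧
      S.conv Δ (rightAbs ω) (rightAbs ω) = rightAbs ω) ∧
    (IsState (leftAbs ω) ∧ leftAbs ω ≠ 0 ∧ S.conv Δ (leftAbs ω) (leftAbs ω) = leftAbs ω) ∧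
    ∃ v, ω = rightTranslate (leftAbs ω) v ∧ ω = leftTranslate (rightAbs ω) v ∧
      S.tensorFun (rightAbs ω) (rightAbs ω)
        (star (Δ v - S.incl (S.tmul v v)) * (Δ v - S.incl (S.tmul v v))) = 0 ∧
      S.tensorFun (leftAbs ω) (leftAbs ω)
        ((Δ v - S.incl (S.tmul v v)) * star (Δ v - S.incl (S.tmul v v))) = 0 := by
  have hnorm : ‖ω‖ = 1 := le_antisymm hle (one_le_norm_of_conv_self hidem hω)
  obtain ⟨R, η, hξ, hη, hωc, hr, hl⟩ := exists_coeff_absoluteValues hnorm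
  rw [hr, hl]
  rw [hωc] at hidem hnorm hω
  obtain ⟨hφ, hψ, v, h1, h2, h3, h4⟩ := hΔ.exists_implementing hξ hη hnorm hidem
  have hstate : ∀ ζ : R.space, ‖ζ‖ = 1 →
      S.conv Δ (coeffFunctional R.rep ζ ζ) (coeffFunctional R.rep ζ ζ) =
        coeffFunctional R.rep ζ ζ → coeffFunctional R.rep ζ ζ ≠ 0 →
      IsState (coeffFunctional R.rep ζ ζ) := fun ζ hζ h h0 =>
    ⟨isPositiveFunctional_coeffFunctional R.rep ζ,
      le_antisymm (norm_coeffFunctional_le_one hζ.le hζ.le) (one_le_norm_of_conv_self h h0)⟩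
  have hφ0 : coeffFunctional R.rep R.vec R.vec ≠ 0 := fun h0 => hω (by
    rw [h2, h0]
    rfl)
  have hψ0 : coeffFunctional R.rep η η ≠ 0 := fun h0 => hω (by
    rw [h1, h0]
    rfl)
  exact ⟨⟨hstate _ hξ hφ hφ0, hφ0, hφ⟩, ⟨hstate _ hη hψ hψ0, hψ0, hψ⟩, v, hωc.trans h1,
    hωc.trans h2, h3, h4⟩

end TensorSquare

section HilbertTensor

variable {H K L : Type*} [NormedAddCommGroup H] [InnerProductSpace ℂ H]
  [NormedAddCommGroup K] [InnerProductSpace ℂ K]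
  [NormedAddCommGroup L] [InnerProductSpace ℂ L]

theorem inner_vecTensor (ξ ξ' : H) (η η' : K) :
    ⟪vecTensor ξ η, vecTensor ξ' η'⟫_ℂ = ⟪ξ, ξ'⟫_ℂ * ⟪η, η'⟫_ℂ := by
  rw [vecTensor, vecTensor, LinearIsometry.inner_map_map, TensorProduct.inner_tmul]

theorem norm_vecTensor (ξ : H) (η : K) : ‖vecTensor ξ η‖ = ‖ξ‖ * ‖η‖ := by
  rw [vecTensor, LinearIsometry.norm_map, TensorProduct.norm_tmul]

variable (H K) in
/-- The elementary tensor of vectors as a bounded bilinear map. -/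
def vecTensorL : H →L[ℂ] K →L[ℂ] HilbertTensor H K :=
  LinearMap.mkContinuous₂ (LinearMap.mk₂ ℂ vecTensor
    (fun ξ ξ' η => by simp only [vecTensor, TensorProduct.add_tmul, map_add])
    (fun c ξ η => by
      rw [vecTensor, vecTensor, ← TensorProduct.smul_tmul', map_smul])
    (fun ξ η η' => by simp only [vecTensor, TensorProduct.tmul_add, map_add])
    (fun c ξ η => by simp only [vecTensor, TensorProduct.tmul_smul, map_smul])) 1 fun ξ η => by
      rw [one_mul]
      exact (norm_vecTensor ξ η).le

theorem dense_span_vecTensor :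
    Dense (Submodule.span ℂ {ζ | ∃ ξ η, ζ = vecTensorL H K ξ η} : Set (HilbertTensor H K)) := by
  refine denseRange_tensorEmb.mono ?_
  rintro _ ⟨t, rfl⟩
  induction t with
  | zero => rw [map_zero]; exact zero_mem _
  | add x y hx hy => rw [map_add]; exact add_mem hx hy
  | tmul x y => exact Submodule.subset_span ⟨x, y, rfl⟩

theorem hilbertTensor_op_ext {T T' : HilbertTensor H K →L[ℂ] HilbertTensor H K}
    (h : ∀ ξ η, T (vecTensor ξ η) = T' (vecTensor ξ η)) : T = T' := by
  refine ContinuousLinearMap.ext_on dense_span_vecTensor ?_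
  rintro _ ⟨ξ, η, rfl⟩
  exact h ξ η

theorem opTensor_mul (a a' : H →L[ℂ] H) (b b' : K →L[ℂ] K) :
    opTensor a b * opTensor a' b' = opTensor (a * a') (b * b') := by
  refine hilbertTensor_op_ext fun ξ η => ?_
  change opTensor a b (opTensor a' b' (vecTensor ξ η)) = _
  rw [opTensor_vecTensor, opTensor_vecTensor, opTensor_vecTensor]
  rfl

theorem star_opTensor [CompleteSpace H] [CompleteSpace K] (a : H →L[ℂ] H) (b : K →L[ℂ] K) :
    star (opTensor a b) = opTensor (star a) (star b) := by
  refine hilbertTensor_op_ext fun ξ η => ?_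
  have h : ∀ γ δ, ⟪vecTensor γ δ, star (opTensor a b) (vecTensor ξ η)⟫_ℂ =
      ⟪vecTensor γ δ, opTensor (star a) (star b) (vecTensor ξ η)⟫_ℂ := by
    intro γ δ
    rw [ContinuousLinearMap.star_eq_adjoint, ContinuousLinearMap.adjoint_inner_right,
      opTensor_vecTensor, opTensor_vecTensor, inner_vecTensor, inner_vecTensor,
      ContinuousLinearMap.star_eq_adjoint, ContinuousLinearMap.star_eq_adjoint,
      ContinuousLinearMap.adjoint_inner_right, ContinuousLinearMap.adjoint_inner_right]
  refine dense_span_vecTensor.eq_of_inner_right ℂ fun ζ hζ => ?_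
  induction hζ using Submodule.span_induction with
  | mem x hx =>
    obtain ⟨γ, δ, rfl⟩ := hx
    exact h γ δ
  | zero => rw [inner_zero_left, inner_zero_left]
  | add x y _ _ hx hy => rw [inner_add_left, inner_add_left, hx, hy]
  | smul c x _ hx => rw [inner_smul_left, inner_smul_left, hx]

theorem norm_hilbertAssoc (x : HilbertTensor (HilbertTensor H K) L) :
    ‖hilbertAssoc x‖ = ‖x‖ := by
  refine denseRange_tripleEmb.induction_on (p := fun x => ‖hilbertAssoc x‖ = ‖x‖) x
    (isClosed_eq (by fun_prop) (by fun_prop)) fun t => ?_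
  have h : hilbertAssoc (tripleEmb H K L t) = assocEmb t :=
    ContinuousLinearMap.extend_eq _ (e := (tripleEmb H K L).toContinuousLinearMap)
      denseRange_tripleEmb (tripleEmb H K L).isometry.isUniformInducing t
  rw [h, LinearIsometry.norm_map, LinearIsometry.norm_map]

theorem inner_hilbertAssoc (x y : HilbertTensor (HilbertTensor H K) L) :
    ⟪hilbertAssoc x, hilbertAssoc y⟫_ℂ = ⟪x, y⟫_ℂ :=
  LinearIsometry.inner_map_map
    (⟨hilbertAssoc.toLinearMap, norm_hilbertAssoc⟩ : HilbertTensor (HilbertTensor H K) L →ₗᵢ[ℂ]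
      HilbertTensor H (HilbertTensor K L)) x y

end HilbertTensor

section Spatial

variable {H : Type*} [NormedAddCommGroup H] [InnerProductSpace ℂ H] [CompleteSpace H]

theorem dense_span_subtype {B : NonUnitalStarSubalgebra ℂ (H →L[ℂ] H)} {s : Set (H →L[ℂ] H)}
    (hs : (Submodule.span ℂ s).topologicalClosure = B.toSubmodule) {s' : Set B}
    (h : ∀ x ∈ s, ∃ y ∈ s', (y : H →L[ℂ] H) = x) :
    Dense (Submodule.span ℂ s' : Set B) := by
  intro x
  rw [closure_subtype]
  have h1 : Submodule.span ℂ s ≤ (Submodule.span ℂ s').map B.toSubmodule.subtype := by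
    refine Submodule.span_le.mpr fun y hy => ?_
    obtain ⟨z, hz, rfl⟩ := h y hy
    exact ⟨z, Submodule.subset_span hz, rfl⟩
  have h2 : (x : H →L[ℂ] H) ∈ (Submodule.span ℂ s).topologicalClosure := by
    rw [hs]
    exact x.2
  exact closure_mono h1 h2

theorem span_opTensor_topologicalClosure (A : NonUnitalStarSubalgebra ℂ (H →L[ℂ] H)) :
    (Submodule.span ℂ {x | ∃ a ∈ A, ∃ b ∈ A, x = opTensor a b}).topologicalClosure =
      (spatialTensor A A).toSubmodule := by
  have h : (Submodule.span ℂ {x | ∃ a ∈ A, ∃ b ∈ A, x = opTensor a b} :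
      Set (HilbertTensor H H →L[ℂ] HilbertTensor H H)) =
      NonUnitalStarAlgebra.adjoin ℂ {x | ∃ a ∈ A, ∃ b ∈ A, x = opTensor a b} := by
    refine subset_antisymm (fun x hx => ?_) fun x hx => ?_
    · have h1 : Submodule.span ℂ {x | ∃ a ∈ A, ∃ b ∈ A, x = opTensor a b} ≤
          (NonUnitalStarAlgebra.adjoin ℂ
            {x | ∃ a ∈ A, ∃ b ∈ A, x = opTensor a b}).toSubmodule :=
        Submodule.span_le.mpr (NonUnitalStarAlgebra.subset_adjoin ℂ _)
      exact h1 hx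
    · change x ∈ Submodule.span ℂ {x | ∃ a ∈ A, ∃ b ∈ A, x = opTensor a b}
      induction hx using NonUnitalStarAlgebra.adjoin_induction with
      | mem x hx => exact Submodule.subset_span hx
      | add x y _ _ hx hy => exact add_mem hx hy
      | zero => exact zero_mem _
      | mul x y hxA hyA hx hy =>
        clear hxA hyA
        induction hx using Submodule.span_induction with
        | zero => rw [zero_mul]; exact zero_mem _
        | add x x' _ _ hx hx' => rw [add_mul]; exact add_mem hx hx'
        | smul c x _ hx => rw [smul_mul_assoc]; exact Submodule.smul_mem _ c hx
        | mem x hx =>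
          obtain ⟨a, ha, b, hb, rfl⟩ := hx
          induction hy using Submodule.span_induction with
          | zero => rw [mul_zero]; exact zero_mem _
          | add x x' _ _ hx hx' => rw [mul_add]; exact add_mem hx hx'
          | smul c x _ hx => rw [mul_smul_comm]; exact Submodule.smul_mem _ c hx
          | mem y hy =>
            obtain ⟨a', ha', b', hb', rfl⟩ := hy
            rw [opTensor_mul]
            exact Submodule.subset_span ⟨_, mul_mem ha ha', _, mul_mem hb hb', rfl⟩
      | smul c x _ hx => exact Submodule.smul_mem _ c hx
      | star x hxA hx =>
        clear hxA
        induction hx using Submodule.span_induction with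
        | zero => rw [star_zero]; exact zero_mem _
        | add x x' _ _ hx hx' => rw [star_add]; exact add_mem hx hx'
        | smul c x _ hx => rw [star_smul]; exact Submodule.smul_mem _ _ hx
        | mem x hx =>
          obtain ⟨a, ha, b, hb, rfl⟩ := hx
          rw [star_opTensor]
          exact Submodule.subset_span ⟨_, star_mem ha, _, star_mem hb, rfl⟩
  refine SetLike.coe_injective ?_
  rw [Submodule.topologicalClosure_coe, h]
  rfl

theorem isClosed_spatialTensor (A : NonUnitalStarSubalgebra ℂ (H →L[ℂ] H)) :
    IsClosed (spatialTensor A A : Set (HilbertTensor H H →L[ℂ] HilbertTensor H H)) :=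
  NonUnitalStarSubalgebra.isClosed_topologicalClosure _

attribute [local instance] isClosed_spatialTensor

variable (A : NonUnitalStarSubalgebra ℂ (H →L[ℂ] H))

theorem opTensor_mem_spatialTensor (a b : A) :
    opTensor (a : H →L[ℂ] H) (b : H →L[ℂ] H) ∈ spatialTensor A A :=
  NonUnitalStarSubalgebra.le_topologicalClosure _
    (NonUnitalStarAlgebra.subset_adjoin ℂ _ ⟨a, a.2, b, b.2, rfl⟩)

variable [IsClosed (A : Set (H →L[ℂ] H))]

/-- The tensor square of a concrete C*-algebra, with its multiplier algebra. -/
def spatialSquare : TensorSquare A (spatialTensor A A) (multiplierAlgebra (spatialTensor A A)) H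
    (HilbertTensor H H) where
  rep := NonUnitalStarSubalgebraClass.subtype A
  rep_injective := Subtype.val_injective
  vec := vecTensorL H H
  inner_vec := fun α β α' β' => inner_vecTensor α α' β β'
  dense_vec := dense_span_vecTensor
  incl :=
    { toFun := toMultiplier
      map_smul' := fun _ _ => rfl
      map_zero' := rfl
      map_add' := fun _ _ => rfl
      map_mul' := fun _ _ => rfl
      map_star' := fun _ => rfl }
  op := (multiplierAlgebra (spatialTensor A A)).subtype
  op_incl_injective := Subtype.val_injective
  exists_mul := fun X e => ⟨⟨_, (X.2 e e.2).1⟩, rfl⟩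
  tmul := fun a b => ⟨opTensor a b, opTensor_mem_spatialTensor A a b⟩
  op_tmul_vec := fun a b α β => opTensor_vecTensor (a : H →L[ℂ] H) (b : H →L[ℂ] H) α β
  dense_tmul := by
    refine dense_span_subtype (span_opTensor_topologicalClosure A) ?_
    rintro _ ⟨a, ha, b, hb, rfl⟩
    exact ⟨_, ⟨⟨a, ha⟩, ⟨b, hb⟩, rfl⟩, rfl⟩

end Spatial

theorem continuous_induced_of_norm_sub_le {X V W : Type*} [SeminormedAddCommGroup V]
    [SeminormedAddCommGroup W] (p : X → V) (f : X → W) (C : ℝ)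
    (h : ∀ x y, ‖f x - f y‖ ≤ C * ‖p x - p y‖) :
    Continuous[TopologicalSpace.induced p inferInstance, inferInstance] f := by
  let _ : TopologicalSpace X := TopologicalSpace.induced p inferInstance
  have hp : Continuous p := continuous_induced_dom
  refine continuous_iff_continuousAt.mpr fun x => ?_
  refine tendsto_iff_norm_sub_tendsto_zero.mpr ?_
  have h1 := (tendsto_iff_norm_sub_tendsto_zero.mp (hp.tendsto x)).const_mul C
  rw [mul_zero] at h1
  exact squeeze_zero (fun _ => norm_nonneg _) (fun y => h y x) h1

section InducedTopology

variable {X V I : Type*} [TopologicalSpace V] (p q : I → X → V)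

theorem continuous_iInf_inf_induced {Y : Type*} [TopologicalSpace Y] {f : Y → X}
    (hp : ∀ i, Continuous fun y => p i (f y)) (hq : ∀ i, Continuous fun y => q i (f y)) :
    Continuous[inferInstance, ⨅ i, TopologicalSpace.induced (p i) inferInstance ⊓
      TopologicalSpace.induced (q i) inferInstance] f :=
  continuous_iInf_rng.mpr fun i => continuous_inf_rng.mpr
    ⟨continuous_induced_rng.mpr (hp i), continuous_induced_rng.mpr (hq i)⟩

theorem tendsto_nhds_iInf_inf_induced {Y : Type*} {l : Filter Y} {f : Y → X} {x : X}
    (hp : ∀ i, Tendsto (fun y => p i (f y)) l (𝓝 (p i x)))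
    (hq : ∀ i, Tendsto (fun y => q i (f y)) l (𝓝 (q i x))) :
    Tendsto f l (@nhds X (⨅ i, TopologicalSpace.induced (p i) inferInstance ⊓
      TopologicalSpace.induced (q i) inferInstance) x) := by
  rw [nhds_iInf]
  refine tendsto_iInf.mpr fun i => ?_
  rw [nhds_inf, nhds_induced, nhds_induced]
  exact tendsto_inf.mpr ⟨tendsto_comap_iff.mpr (hp i), tendsto_comap_iff.mpr (hq i)⟩

end InducedTopology

attribute [local instance] isClosed_spatialTensor LocallyCompactQuantumGroup.isClosed

section Strict

variable {H : Type*} [NormedAddCommGroup H] [InnerProductSpace ℂ H] [CompleteSpace H]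
  (A : NonUnitalStarSubalgebra ℂ (H →L[ℂ] H)) [IsClosed (A : Set (H →L[ℂ] H))]

theorem isTensorFunctional_tensorFun (μ ν : StrongDual ℂ A) :
    IsTensorFunctional μ ν ((spatialSquare A).tensorFun μ ν) := by
  refine ⟨?_, fun a b => TensorSquare.tensorFun_tmul (S := spatialSquare A) μ ν a b⟩
  obtain ⟨g, C, h⟩ := (spatialSquare A).isStrict_tensorFun μ ν
  refine continuous_le_dom ((iInf_le _ g).trans inf_le_left)
    (continuous_induced_of_norm_sub_le _ _ C fun X Y => ?_)
  rw [← map_sub]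
  refine (h (X - Y)).trans (le_of_eq ?_)
  congr 1
  rw [← (spatialSquare A).norm_opIncl, TensorSquare.opIncl_mulE, map_sub, sub_mul]
  rfl

theorem IsTensorFunctional.eq_tensorFun {μ ν : StrongDual ℂ A}
    {F : multiplierAlgebra (spatialTensor A A) →ₗ[ℂ] ℂ} (hF : IsTensorFunctional μ ν F) :
    F = (spatialSquare A).tensorFun μ ν := by
  have hcont : Continuous fun e : spatialTensor A A => F (toMultiplier e) := by
    refine (@Continuous.comp _ _ _ _ (strictTopology (spatialTensor A A)) _ _ _ hF.1 ?_)
    exact continuous_iInf_inf_induced _ _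
      (fun a => continuous_subtype_val.mul continuous_const)
      (fun a => continuous_const.mul continuous_subtype_val)
  refine (spatialSquare A).eq_tensorFun hcont hF.2 fun X => ?_
  have h1 : Tendsto (fun e => X * toMultiplier e) (approxUnit (spatialTensor A A))
      (@nhds _ (strictTopology (spatialTensor A A)) X) := by
    refine tendsto_nhds_iInf_inf_induced _ _ (fun a => ?_) (fun a => ?_)
    · have h2 := (continuous_subtype_val.tendsto _).comp (tendsto_approxUnit_mul a)
      have h3 := h2.const_mul (X : HilbertTensor H H →L[ℂ] HilbertTensor H H)
      refine h3.congr fun e => ?_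
      exact (mul_assoc _ _ _).symm
    · have h2 := (continuous_subtype_val.tendsto _).comp
        (tendsto_mul_approxUnit (⟨_, (X.2 a a.2).2⟩ : spatialTensor A A))
      refine h2.congr fun e => ?_
      exact mul_assoc _ _ _
  exact ((@Continuous.tendsto _ _ (strictTopology (spatialTensor A A)) _ _ hF.1) X).comp h1

theorem tensorFunctional_eq_tensorFun (μ ν : StrongDual ℂ A) :
    tensorFunctional μ ν = (spatialSquare A).tensorFun μ ν := by
  have h : ∃ F, IsTensorFunctional μ ν F := ⟨_, isTensorFunctional_tensorFun A μ ν⟩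
  unfold tensorFunctional
  rw [dif_pos h]
  exact IsTensorFunctional.eq_tensorFun A h.choose_spec

end Strict

section Comultiplication

variable {H : Type*} [NormedAddCommGroup H] [InnerProductSpace ℂ H] [CompleteSpace H]
  {A : NonUnitalStarSubalgebra ℂ (H →L[ℂ] H)} [IsClosed (A : Set (H →L[ℂ] H))]
  {Δ : A →⋆ₙₐ[ℂ] multiplierAlgebra (spatialTensor A A)}

theorem SatisfiesCancellation.cancels (h : SatisfiesCancellation Δ) :
    (spatialSquare A).Cancels Δ := by
  have hmem : ∀ a c : A, (Δ a : HilbertTensor H H →L[ℂ] HilbertTensor H H) *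
      opTensor (c : H →L[ℂ] H) 1 ∈ spatialTensor A A := fun a c => by
    have h1 := (Submodule.le_topologicalClosure _) (Submodule.subset_span (R := ℂ)
      (s := {x : HilbertTensor H H →L[ℂ] HilbertTensor H H | ∃ a b : A,
        x = (Δ a : HilbertTensor H H →L[ℂ] HilbertTensor H H) * opTensor (b : H →L[ℂ] H) 1})
      ⟨a, c, rfl⟩)
    rw [h.1] at h1
    exact h1
  refine ⟨fun a c => ⟨_, hmem a c⟩, fun a c α β => ?_, dense_span_subtype h.1 ?_⟩
  · exact congrArg (Δ a : HilbertTensor H H →L[ℂ] HilbertTensor H H)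
      (opTensor_vecTensor (c : H →L[ℂ] H) 1 α β)
  · rintro _ ⟨a, c, rfl⟩
    exact ⟨_, ⟨a, c, rfl⟩, rfl⟩

theorem SatisfiesCancellation.cancels_swap (h : SatisfiesCancellation Δ) :
    (spatialSquare A).swap.Cancels Δ := by
  have hmem : ∀ a c : A, (Δ a : HilbertTensor H H →L[ℂ] HilbertTensor H H) *
      opTensor 1 (c : H →L[ℂ] H) ∈ spatialTensor A A := fun a c => by
    have h1 := (Submodule.le_topologicalClosure _) (Submodule.subset_span (R := ℂ)
      (s := {x : HilbertTensor H H →L[ℂ] HilbertTensor H H | ∃ a b : A,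
        x = (Δ a : HilbertTensor H H →L[ℂ] HilbertTensor H H) * opTensor 1 (b : H →L[ℂ] H)})
      ⟨a, c, rfl⟩)
    rw [h.2] at h1
    exact h1
  refine ⟨fun a c => ⟨_, hmem a c⟩, fun a c α β => ?_, dense_span_subtype h.2 ?_⟩
  · exact congrArg (Δ a : HilbertTensor H H →L[ℂ] HilbertTensor H H)
      (opTensor_vecTensor 1 (c : H →L[ℂ] H) β α)
  · rintro _ ⟨a, c, rfl⟩
    exact ⟨_, ⟨a, c, rfl⟩, rfl⟩

theorem IsNondegenerate.dense (h : IsNondegenerate A) :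
    Dense (Submodule.span ℂ {ξ | ∃ a ξ', ξ = (spatialSquare A).rep a ξ'} : Set H) := by
  have h1 : {ξ | ∃ a ξ', ξ = (spatialSquare A).rep a ξ'} =
      {η : H | ∃ a ∈ A, ∃ ξ : H, η = a ξ} := by
    ext ξ
    exact ⟨fun ⟨a, ξ', h⟩ => ⟨a, a.2, ξ', h⟩, fun ⟨a, ha, ξ', h⟩ => ⟨⟨a, ha⟩, ξ', h⟩⟩
  rw [h1, Submodule.dense_iff_topologicalClosure_eq_top]
  exact h

theorem IsNondegenerateComul.dense (hΔ : IsNondegenerateComul Δ) (h : IsNondegenerate A) :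
    Dense (Submodule.span ℂ {ξ | ∃ a ξ', ξ = (spatialSquare A).op (Δ a) ξ'} :
      Set (HilbertTensor H H)) := by
  have hE : ∀ t ∈ spatialTensor A A, ∀ ζ : HilbertTensor H H, t ζ ∈
      (Submodule.span ℂ {ξ | ∃ a ξ', ξ = (spatialSquare A).op (Δ a) ξ'}).topologicalClosure := by
    intro t ht ζ
    have h1 : (Submodule.span ℂ {x : HilbertTensor H H →L[ℂ] HilbertTensor H H |
        ∃ a : A, ∃ t ∈ spatialTensor A A,
          x = (Δ a : HilbertTensor H H →L[ℂ] HilbertTensor H H) * t}).topologicalClosure ≤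
        (Submodule.span ℂ {ξ | ∃ a ξ', ξ = (spatialSquare A).op (Δ a)
          ξ'}).topologicalClosure.comap
          (ContinuousLinearMap.apply ℂ (HilbertTensor H H) ζ).toLinearMap := by
      refine Submodule.topologicalClosure_minimal _ (Submodule.span_le.mpr ?_)
        ((Submodule.isClosed_topologicalClosure _).preimage
          (ContinuousLinearMap.apply ℂ (HilbertTensor H H) ζ).continuous)
      rintro _ ⟨a, t, -, rfl⟩
      exact subset_closure (Submodule.subset_span ⟨a, t ζ, rfl⟩)
    rw [hΔ] at h1
    exact h1 ht
  rw [Submodule.dense_iff_topologicalClosure_eq_top, eq_top_iff]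
  have h2 := TensorSquare.mem_of_mem_of_dense₂ (vecTensorL H H)
    (Submodule.span ℂ {ξ | ∃ a ξ', ξ = (spatialSquare A).op (Δ a) ξ'}).topologicalClosure
    (Submodule.isClosed_topologicalClosure _) h.dense h.dense (by
      rintro _ ⟨a, ξ, rfl⟩ _ ⟨b, ξ', rfl⟩
      have h3 := hE _ (opTensor_mem_spatialTensor A a b) (vecTensor ξ ξ')
      rw [opTensor_vecTensor] at h3
      exact h3)
  have h4 := Submodule.dense_iff_topologicalClosure_eq_top.mp
    (dense_span_vecTensor (H := H) (K := H))
  rw [← h4]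
  refine Submodule.topologicalClosure_minimal _ (Submodule.span_le.mpr ?_)
    (Submodule.isClosed_topologicalClosure _)
  rintro _ ⟨α, β, rfl⟩
  exact h2 α β

theorem IsCoassociative.nonempty_coassociator (h : IsCoassociative Δ) :
    Nonempty ((spatialSquare A).Coassociator Δ (HilbertTensor H (HilbertTensor H H))) := by
  obtain ⟨Ψ₁, Ψ₂, h1, h2, h3⟩ := h
  exact ⟨
    { vecR := vecTensorL H (HilbertTensor H H)
      vecL := (ContinuousLinearMap.compL ℂ H _ _ hilbertAssoc).comp
        (vecTensorL (HilbertTensor H H) H)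
      inner_vecR := fun α ζ α' ζ' => inner_vecTensor α α' ζ ζ'
      inner_vecL := fun ζ γ ζ' γ' => by
        change ⟪hilbertAssoc (vecTensor ζ γ), hilbertAssoc (vecTensor ζ' γ')⟫_ℂ = _
        rw [inner_hilbertAssoc, inner_vecTensor]
      vecL_vec := fun α β γ => hilbertAssoc_vecTensor α β γ
      mapR := Ψ₁
      mapL := Ψ₂
      mapR_vecR := fun a b α ζ => by
        change Ψ₁ (elemTensor a b) (vecTensor α ζ) = _
        rw [h1, opTensor_vecTensor]
        rfl
      mapL_vecL := fun a b ζ γ => by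
        change (Ψ₂ (elemTensor a b) ∘L hilbertAssoc) (vecTensor ζ γ) = _
        rw [h2]
        exact congrArg hilbertAssoc (opTensor_vecTensor _ _ ζ γ)
      mapR_comul := h3 }⟩

end Comultiplication

namespace LocallyCompactQuantumGroup

variable {H : Type*} [NormedAddCommGroup H] [InnerProductSpace ℂ H] [CompleteSpace H]
  (G : LocallyCompactQuantumGroup H)

theorem isComul : (spatialSquare G.C0).IsComul G.comul := by
  obtain ⟨T⟩ := G.coassociative.nonempty_coassociator
  exact ⟨TensorSquare.conv_assoc T G.cancellation.cancels G.cancellation.cancels_swap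
    G.nondegenerate.dense (G.comul_nondegenerate.dense G.nondegenerate), G.cancellation.cancels,
    TensorSquare.exists_slice_conv_right G.comul G.cancellation.cancels_swap⟩

variable {G}

theorem isIdempotent_iff {ω : G.MeasureAlgebra} :
    IsIdempotent ω ↔ ω ≠ 0 ∧ (spatialSquare G.C0).conv G.comul ω ω = ω := by
  refine and_congr_right fun _ => ?_
  rw [ContinuousLinearMap.ext_iff]
  refine forall_congr' fun a => ?_
  rw [convolution, tensorFunctional_eq_tensorFun]
  rfl

end LocallyCompactQuantumGroup

end

theorem mainTheorem1 {H : Type*} [NormedAddCommGroup H] [InnerProductSpace ℂ H] [CompleteSpace H]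
    (G : LocallyCompactQuantumGroup H) (hG : G.IsCoamenable) (ω : G.MeasureAlgebra)
    (hω : LocallyCompactQuantumGroup.IsContractiveIdempotent ω) :
    LocallyCompactQuantumGroup.IsIdempotentState (rightAbs ω) ∧
    LocallyCompactQuantumGroup.IsIdempotentState (leftAbs ω) ∧
    ∃ v : G.C0, ω = rightTranslate (leftAbs ω) v ∧ ω = leftTranslate (rightAbs ω) v ∧
      G.comul v - elemTensor v v ∈
        LocallyCompactQuantumGroup.tensorNull (rightAbs ω) ∩
          star (LocallyCompactQuantumGroup.tensorNull (leftAbs ω)) := by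
  have := G.isClosed
  have := isClosed_spatialTensor G.C0
  obtain ⟨hidem, hle⟩ := hω
  obtain ⟨hne, hidem⟩ := LocallyCompactQuantumGroup.isIdempotent_iff.mp hidem
  obtain ⟨⟨hr, hr0, hri⟩, ⟨hl, hl0, hli⟩, v, h1, h2, h3, h4⟩ :=
    G.isComul.absoluteValues hne hidem hle
  refine ⟨⟨LocallyCompactQuantumGroup.isIdempotent_iff.mpr ⟨hr0, hri⟩, hr⟩,
    ⟨LocallyCompactQuantumGroup.isIdempotent_iff.mpr ⟨hl0, hli⟩, hl⟩, v, h1, h2, ?_, ?_⟩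
  · change tensorFunctional _ _ _ = 0
    rw [tensorFunctional_eq_tensorFun]
    exact h3
  · change tensorFunctional _ _ (star (star _) * star _) = 0
    rw [tensorFunctional_eq_tensorFun, star_star]
    exact h4
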